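/- Let $G$ be a graph on nodes $1,\dots,n$ that arrive in this order, fixed in advance; at step $i$ the node $i$ arrives with its edges to earlier nodes. Neighbourhoods $N[u]=N(u)\cup\{u\}$ and degrees $d(u)$ below are those in the graph present at the current step. The cost of a clustering of $G$ is the number of edges between different clusters plus the number of non-edges inside clusters. Every node $u$ has an independent rank $\pi(u)$, uniform in $[0,1]$. Reference Clustering (1-pivot). With $p(u)=\arg\min_{w\in N[u]}\pi(w)$ in the whole graph $G$, a node $u$ belongs to the cluster of $p(u)$ if $p(p(u))=p(u)$, and is a singleton otherwise. Sparse-Pivot with parameters $\varepsilon$, $L$, $s$. It maintains a partial pivot array $p$ (no pivot means singleton); $B_v=\{x: p(x)=v\}$, and $v$ is a pivot if $p(v)=v$. $\textsc{Explore}(u)$ gives the pivot $u$ to every node of $N[u]$ that has no pivot or a pivot of rank larger than $\pi(u)$; nodes outside $N[u]$ whose pivot thereby stops being a pivot lose it. On arrival of $u$: (a) if $\pi(u)\,d(u)\le L$, let $v=\arg\min_{w\in N[u]}\pi(w)$. If $v=u$, set $p(u)=u$ and run $\textsc{Explore}(u)$. If $v\ne u$ is a pivot, set $p(u)=v$, and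 run $\textsc{Explore}(v)$ if $\pi(u)\,d(v)\le L$. Otherwise $u$ gets no pivot. (b) if $\pi(u)\,d(u)>L$, draw $s$ independent uniform samples $x$ from $N[u]$ and let $v$ be the node of smallest rank among those pivots $p(x)$ that are adjacent to $u$; if $v$ exists and $\pi(v)<\pi(u)$, set $p(u)=v$, otherwise $u$ gets no pivot. After that, for every $v$ whose set $B=B_v$ has changed, a set $C_v\subseteq B$ is computed: start with $C_v=B$ and, for $t=1,(1+\varepsilon),\dots,(1+\varepsilon)^{\lceil\log_{1+\varepsilon}n\rceil}$ in turn, replace $C_v$ by $C_t=\{x\in B: d(x)\ge t\}$ if $X(B,C_t)<X(B,C_v)$, where both estimates are computed with fresh samples. Here $$X(B,C)=\frac{\sum_{w\in C}d(w)-2\binom{|C|}2+3Y+\sum_{w\in B\setminus C}\left(\tfrac12Z_{B\setminus C}(w)+Z_{V\setminus B}(w)\right)+9\varepsilon|C|}{1-37\varepsilon},$$ $V$ is the set of the nodes that have arrived, $Y$ is $\binom{|C|}2$ times the fraction of non-edges among $\lceil 5|C|\log n/\varepsilon^3\rceil$ independent uniform pairs of distinct nodes of $C$, and $Z_S(w)$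 is $d(w)$ times the fraction of edges leading to $S$ among $\lceil10\log n/\varepsilon^3\rceil$ independent uniform edges at $w$ (an estimate with nothing to sample from is $0$). The clusters output are the sets $C_v$; all other nodes are singletons. Theorem. There is an absolute constant $K>0$ such that for every $0<\varepsilon<1/1000$ and every $c\in\mathbb N$ there is $A=A(\varepsilon,c)>0$ such that for all $n$, all $G$, all real $L\ge A\log n$ and all integers $s\ge A\log n$: (i) if $G$ is not a disjoint union of cliques, then $$\mathbb E[\mathrm{cost}(\text{Sparse-Pivot})]\le 4(1+K\varepsilon)\,\mathbb E[\mathrm{cost}(\text{Reference Clustering})];$$ (ii) if $G$ is a disjoint union of cliques, then $\mathbb E[\mathrm{cost}(\text{Reference Clustering})]=0$ and $\mathbb E[\mathrm{cost}(\text{Sparse-Pivot})]\le n^{-c}$. -/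

import Mathlib

open scoped ENNReal

noncomputable section

namespace CorrelationClustering

/-! The nodes are `Fin n` and node `i` is the `i`-th to arrive. The graph present after the
insertion of node `i` is the subgraph of `G` induced on the nodes `j ≤ i`, and `G` itself is the
graph at the time at which the clusterings are compared. -/

/-- Number of disagreements of the clustering whose clusters are the fibres of `f`:
cut edges plus non-edges inside a cluster. -/
def cost {n : ℕ} {α : Type} (G : SimpleGraph (Fin n)) (f : Fin n → α) : ℕ :=
  open Classical in
  (Finset.univ.filter fun e : Fin n × Fin n =>
    e.1 < e.2 ∧ ((G.Adj e.1 e.2 ∧ f e.1 ≠ f e.2) ∨ (¬ G.Adj e.1 e.2 ∧ f e.1 = f e.2))).card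

/-- Neighbours of `u` in the graph present after the insertion of `i`. -/
def nbrs {n : ℕ} (G : SimpleGraph (Fin n)) (i u : Fin n) : Finset (Fin n) :=
  open Classical in Finset.univ.filter fun w => w ≤ i ∧ G.Adj u w

/-- The closed neighbourhood `N[u]` after the insertion of `i`. -/
def closedNbrs {n : ℕ} (G : SimpleGraph (Fin n)) (i u : Fin n) : Finset (Fin n) :=
  insert u (nbrs G i u)

/-- The degree `d(u)` after the insertion of `i`. -/
def deg {n : ℕ} (G : SimpleGraph (Fin n)) (i u : Fin n) : ℕ := (nbrs G i u).card

/-- The node of smallest rank in `S` (ties, an event of probability zero, go to the earliest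
node), `none` if `S` is empty. -/
def argminRank {n : ℕ} (π : Fin n → unitInterval) (S : Finset (Fin n)) : Option (Fin n) :=
  open Classical in
  if h : (S.filter fun v => ∀ w ∈ S, π v ≤ π w).Nonempty then
    some ((S.filter fun v => ∀ w ∈ S, π v ≤ π w).min' h)
  else none

/-! ### The reference clustering -/

/-- `p(u) = argmin_{w ∈ N[u]} π(w)` in the whole graph. -/
def refPivot {n : ℕ} (G : SimpleGraph (Fin n)) (π : Fin n → unitInterval) (u : Fin n) :
    Option (Fin n) :=
  open Classical in argminRank π (Finset.univ.filter fun w => w = u ∨ G.Adj u w)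

/-- `u` lies in the cluster `inl v` of its pivot `v = p(u)` if `p(v) = v`, and it is the
singleton `inr u` otherwise. -/
def refClustering {n : ℕ} (G : SimpleGraph (Fin n)) (π : Fin n → unitInterval) (u : Fin n) :
    Fin n ⊕ Fin n :=
  match refPivot G π u with
  | some v => if refPivot G π v = some v then Sum.inl v else Sum.inr u
  | none => Sum.inr u

/-! ### Sampling and cost estimates -/

/-- `k` independent samples of `q`. -/
def iid {α : Type} (q : PMF α) : ℕ → PMF (List α)
  | 0 => pure []
  | k + 1 => do
      let a ← q
      let l ← iid q k
      pure (a :: l)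

/-- Estimate of the number of non-edges inside `C`: sample `⌈5 |C| log n / ε³⌉` uniform pairs of
distinct nodes of `C` and rescale the number of non-edges seen. -/
def inClusterCostEstimate {n : ℕ} (G : SimpleGraph (Fin n)) (ε : ℝ) (C : Finset (Fin n)) :
    PMF ℝ :=
  open Classical in
  let τ : ℕ := ⌈5 * (C.card : ℝ) * Real.log n / ε ^ 3⌉₊
  if h : C.offDiag.Nonempty then do
    let l ← iid (PMF.uniformOfFinset C.offDiag h) τ
    pure ((l.countP (fun e => decide (¬ G.Adj e.1 e.2)) : ℝ) * (C.card.choose 2 : ℝ) / (τ : ℝ))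
  else pure 0

/-- The contribution `Z_{B∖C}(w) / 2 + Z_{V∖B}(w)` of a node `w` of `B ∖ C`, estimated from
`⌈10 log n / ε³⌉` uniform edges incident to `w`. -/
def singletonCostEstimate {n : ℕ} (G : SimpleGraph (Fin n)) (ε : ℝ) (i : Fin n)
    (B C : Finset (Fin n)) (w : Fin n) : PMF ℝ :=
  let η : ℕ := ⌈10 * Real.log n / ε ^ 3⌉₊
  if h : (nbrs G i w).Nonempty then do
    let l ← iid (PMF.uniformOfFinset (nbrs G i w) h) η
    pure ((deg G i w : ℝ) / (η : ℝ) * (l.countP (fun x => decide (x ∈ B \ C)) : ℝ) / 2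
      + (deg G i w : ℝ) / (η : ℝ) * (l.countP (fun x => decide (x ∉ B)) : ℝ))
  else pure 0

/-- Estimate, in the graph present after the insertion of `i`, of the cost of making `C ⊆ B` one
cluster and the nodes of `B ∖ C` singletons. -/
def costEstimate {n : ℕ} (G : SimpleGraph (Fin n)) (ε : ℝ) (i : Fin n)
    (B C : Finset (Fin n)) : PMF ℝ := do
  let y ← inClusterCostEstimate G ε C
  let z ← (List.finRange n).foldlM (fun (acc : ℝ) (w : Fin n) =>
    if w ∈ B \ C then do
      let x ← singletonCostEstimate G ε i B C w
      pure (acc + x)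
    else (pure acc : PMF ℝ)) 0
  pure (((∑ w ∈ C, (deg G i w : ℝ)) - 2 * (C.card.choose 2 : ℝ) + 3 * y + z
    + 9 * ε * (C.card : ℝ)) / (1 - 37 * ε))

/-- Keep `C` if its estimated cost is strictly smaller than that of `C'`, else keep `C'`. -/
def costComparison {n : ℕ} (G : SimpleGraph (Fin n)) (ε : ℝ) (i : Fin n)
    (B C C' : Finset (Fin n)) : PMF (Finset (Fin n)) :=
  open Classical in do
  let x ← costEstimate G ε i B C
  let x' ← costEstimate G ε i B C'
  pure (if x < x' then C else C')

/-- The nodes of `B` of degree at least `t`. -/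
def atLeast {n : ℕ} (G : SimpleGraph (Fin n)) (i : Fin n) (B : Finset (Fin n)) (t : ℝ) :
    Finset (Fin n) :=
  open Classical in B.filter fun u => t ≤ (deg G i u : ℝ)

/-- Starting from `C = B`, compare in turn with the nodes of degree at least `t`, for
`t = 1, 1 + ε, (1 + ε)², …` up to the first power that is at least `n`. -/
def breakCluster {n : ℕ} (G : SimpleGraph (Fin n)) (ε : ℝ) (i : Fin n) (B : Finset (Fin n)) :
    PMF (Finset (Fin n)) :=
  (List.range (⌈Real.logb (1 + ε) n⌉₊ + 1)).foldlM
    (fun C j => costComparison G ε i B (atLeast G i B ((1 + ε) ^ j)) C) B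

/-! ### Sparse-Pivot -/

/-- The set `B_v` of the nodes with pivot `v`. -/
def assigned {n : ℕ} (p : Fin n → Option (Fin n)) (v : Fin n) : Finset (Fin n) :=
  Finset.univ.filter fun x => p x = some v

/-- Explore from a pivot `u`: every node of `N[u]` without a pivot or with a pivot of larger rank
than `u` gets the pivot `u`; in particular the pivots of larger rank in `N[u]` stop being
pivots, and the nodes outside `N[u]` that had one of those as their pivot lose it and become
singletons. -/
def explore {n : ℕ} (G : SimpleGraph (Fin n)) (π : Fin n → unitInterval) (i u : Fin n)
    (p : Fin n → Option (Fin n)) (z : Fin n) : Option (Fin n) :=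
  open Classical in
  if z ∈ closedNbrs G i u ∧ ∀ w, p z = some w → π u < π w then some u
  else if ∃ w ∈ closedNbrs G i u, p w = some w ∧ π u < π w ∧ p z = some w then none
  else p z

/-- Choice of the pivot of the arriving node `i` (with the calls of `explore` that it causes).
`none` stands for "no pivot", that is a singleton. -/
def insertPivot {n : ℕ} (G : SimpleGraph (Fin n)) (L : ℝ) (s : ℕ) (π : Fin n → unitInterval)
    (i : Fin n) (p : Fin n → Option (Fin n)) : PMF (Fin n → Option (Fin n)) :=
  open Classical in
  if (π i : ℝ) * (deg G i i : ℝ) ≤ L then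
    pure (match argminRank π (closedNbrs G i i) with
      | none => p
      | some v =>
        if v = i then explore G π i i (Function.update p i (some i))
        else if p v = some v then
          if (π i : ℝ) * (deg G i v : ℝ) ≤ L then
            explore G π i v (Function.update p i (some v))
          else Function.update p i (some v)
        else Function.update p i none)
  else do
    let S ← iid (PMF.uniformOfFinset (closedNbrs G i i) (Finset.insert_nonempty _ _)) s
    pure (match argminRank π
        (Finset.univ.filter fun v => G.Adj v i ∧ ∃ x ∈ S, x ≠ i ∧ p x = some v) with
      | none => Function.update p i none
      | some v =>
        if π v < π i then Function.update p i (some v) else Function.update p i none)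

/-- The state of the algorithm: the pivot array `p`, and for every pivot `v` the set
`C_v ⊆ B_v` of the nodes that are kept in the cluster of `v`. -/
structure State (n : ℕ) where
  pivot : Fin n → Option (Fin n)
  kept : Fin n → Finset (Fin n)

/-- Insertion of node `i`: the pivot array is updated, and then `C_v` is recomputed for every `v`
whose set `B_v` has changed. -/
def insertNode {n : ℕ} (G : SimpleGraph (Fin n)) (ε L : ℝ) (s : ℕ) (π : Fin n → unitInterval)
    (σ : State n) (i : Fin n) : PMF (State n) := do
  let p ← insertPivot G L s π i σ.pivot
  let kept ← (List.finRange n).foldlM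
    (fun (K : Fin n → Finset (Fin n)) (v : Fin n) =>
      if assigned p v ≠ assigned σ.pivot v then do
        let C ← breakCluster G ε i (assigned p v)
        pure (Function.update K v C)
      else (pure K : PMF (Fin n → Finset (Fin n)))) σ.kept
  pure ⟨p, kept⟩

/-- Sparse-Pivot with the ranks `π`: the law of the state after all `n` insertions. -/
def sparsePivot {n : ℕ} (G : SimpleGraph (Fin n)) (ε L : ℝ) (s : ℕ)
    (π : Fin n → unitInterval) : PMF (State n) :=
  (List.finRange n).foldlM (insertNode G ε L s π) ⟨fun _ => none, fun _ => ∅⟩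

/-- The clustering of a state: the clusters are the sets `C_v`, every other node is a
singleton. -/
def State.clustering {n : ℕ} (σ : State n) (u : Fin n) : Fin n ⊕ Fin n :=
  match σ.pivot u with
  | some v => if u ∈ σ.kept v then Sum.inl v else Sum.inr u
  | none => Sum.inr u

/-! ### Expected costs, the ranks being independent and uniform in `[0,1]` -/

/-- Expected cost of Sparse-Pivot over the ranks and over its samples. -/
def expectedCostSparsePivot {n : ℕ} (G : SimpleGraph (Fin n)) (ε L : ℝ) (s : ℕ) : ℝ≥0∞ :=
  ∫⁻ π : Fin n → unitInterval,
    ∑' σ : State n, sparsePivot G ε L s π σ * (cost G σ.clustering : ℝ≥0∞)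

/-- Expected cost of the reference clustering. -/
def expectedCostReference {n : ℕ} (G : SimpleGraph (Fin n)) : ℝ≥0∞ :=
  ∫⁻ π : Fin n → unitInterval, (cost G (refClustering G π) : ℝ≥0∞)

/-- `G` is a disjoint union of cliques, so that it has a clustering without disagreements. -/
def IsDisjointUnionOfCliques {n : ℕ} (G : SimpleGraph (Fin n)) : Prop :=
  ∀ x y z, G.Adj x y → G.Adj y z → x ≠ z → G.Adj x z

end CorrelationClustering

end

/-! Fix the ranks first. Twice the cost of a clustering is the sum of all degrees plus, over its
clusters `C`, the quantity `val` (non-edges minus edges inside `C`, as ordered pairs). Hence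
clusterings whose clusters are subsets of the sets `B_v` can be compared one pivot at a time. The
algorithm is compared with `comparator`: the reference clustering in which every node without its
reference pivot is made a singleton. `ev_cost_sparsePivot_le` gives the factor 4 against it, from
the following statement about one star `B`: the broken cluster is in expectation within `4 + O(ε)`
of every subset `C` of `B` (`ev_breakCluster_le`).

For that statement, `exists_threshold` shows that some degree threshold achieves `4 + O(ε)`: either
no cluster at all is good enough, or one averages over thresholds between about `|C| / 3` and `|C|`.
The loop uses noisy estimates. A Bernstein bound makes the probability of a wrong comparison decay
exponentially in (gap)² / (sample weight × cost). The penalty `9 ε |C|` keeps all sample weights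
small compared with the estimated cost. Comparisons with a tiny gap may go wrong often, so the loop
is analysed with `potential`, which pays for them; it drifts by a factor `1 + O(ε² / log n)` per
comparison, and there are `O(log n / ε)` comparisons. When the best level set is nearly a perfect
cluster the penalty is too expensive, but then all other level sets are far worse and errors have
negligible probability (`ev_breakCost_nearlyPerfect`); for an isolated clique there are no errors at
all (`ev_breakCost_perfect`). The set `C_v` may date from an old step; since the pivots evolve
without looking at the kept sets, this does no harm (`ev_charge_kept_le`).

It remains to compare `comparator` with the reference clustering. With high probability over the
samples the pivot array is `IsFaithful`: a node `u` that misses its pivot `v` has few earlier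
neighbours with pivot `v`. If `u` has many later neighbours in its cluster, one of them should
arrive light and trigger an exploration that repairs `u`. So for a node never repaired, the degree
of `v` or the degrees of many nodes of the cluster are large compared with the number of those
neighbours, and the lost edges are paid for by cut edges (`sum_laterIn_le`). The exception is a
cluster that is small compared with the degree of its pivot. Exchanging the rank of `v` with that of
each node of `N[v]` shows that the expected charge for this event is at most a constant times the
disagreements at `v` (`lintegral_smallCluster_le`).

The ranks for which light nodes are missing have tiny measure: conditioned on the rank of `v` and on
which nodes lie below it, the other ranks are independent and uniform above it (`volume_miss_le`).
What is left is an additive error at most `ε n^(-c)`. If `G` is not a union of cliques it is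
absorbed because the reference cost is at least 1; otherwise it is the whole bound. -/

namespace CorrelationClustering

/-! ### Expectations over probability mass functions -/

/-- Expected value of a nonnegative function. -/
noncomputable def ev {α : Type} (p : PMF α) (f : α → ℝ≥0∞) : ℝ≥0∞ := ∑' a, p a * f a

section ev
variable {α β : Type}

theorem ev_pure (a : α) (f : α → ℝ≥0∞) : ev (pure a : PMF α) f = f a := by
  classical
  unfold ev
  rw [tsum_eq_single a]
  · change (PMF.pure a) a * f a = f a
    simp
  · intro b hb
    change (PMF.pure a) b * f b = 0
    simp [PMF.pure_apply, hb]

theorem ev_bind (p : PMF α) (q : α → PMF β) (f : β → ℝ≥0∞) :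
    ev (p >>= q) f = ev p fun a => ev (q a) f := by
  unfold ev
  change ∑' b, (p.bind q) b * f b = _
  simp_rw [PMF.bind_apply, ← ENNReal.tsum_mul_right, ← ENNReal.tsum_mul_left]
  rw [ENNReal.tsum_comm]
  simp_rw [mul_assoc]

theorem ev_mono_support {p : PMF α} {f g : α → ℝ≥0∞} (h : ∀ a ∈ p.support, f a ≤ g a) :
    ev p f ≤ ev p g := by
  refine ENNReal.tsum_le_tsum fun a => ?_
  by_cases ha : a ∈ p.support
  · gcongr; exact h a ha
  · rw [PMF.mem_support_iff, not_not] at ha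
    simp [ha]

theorem ev_congr_support {p : PMF α} {f g : α → ℝ≥0∞} (h : ∀ a ∈ p.support, f a = g a) :
    ev p f = ev p g :=
  le_antisymm (ev_mono_support fun a ha => (h a ha).le) (ev_mono_support fun a ha => (h a ha).ge)

theorem ev_mono {p : PMF α} {f g : α → ℝ≥0∞} (h : ∀ a, f a ≤ g a) : ev p f ≤ ev p g :=
  ev_mono_support fun a _ => h a

theorem ev_const (p : PMF α) (c : ℝ≥0∞) : ev p (fun _ => c) = c := by
  unfold ev; rw [ENNReal.tsum_mul_right, p.tsum_coe, one_mul]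

theorem ev_add (p : PMF α) (f g : α → ℝ≥0∞) : ev p (fun a => f a + g a) = ev p f + ev p g := by
  unfold ev; simp_rw [mul_add]; exact ENNReal.tsum_add

theorem ev_mul_left (p : PMF α) (c : ℝ≥0∞) (f : α → ℝ≥0∞) :
    ev p (fun a => c * f a) = c * ev p f := by
  unfold ev; rw [← ENNReal.tsum_mul_left]; congr 1; ext a; ring

theorem ev_mul_right (p : PMF α) (c : ℝ≥0∞) (f : α → ℝ≥0∞) :
    ev p (fun a => f a * c) = ev p f * c := by
  unfold ev; rw [← ENNReal.tsum_mul_right]; congr 1; ext a; ring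

theorem ev_sum {ι : Type} (p : PMF α) (s : Finset ι) (f : ι → α → ℝ≥0∞) :
    ev p (fun a => ∑ i ∈ s, f i a) = ∑ i ∈ s, ev p (f i) := by
  classical
  induction s using Finset.induction_on with
  | empty => simpa using ev_const p 0
  | insert i s hi ih => simp_rw [Finset.sum_insert hi, ev_add, ih]

theorem mem_support_bind {p : PMF α} {q : α → PMF β} {b : β} (h : b ∈ (p >>= q).support) :
    ∃ a ∈ p.support, b ∈ (q a).support := (PMF.mem_support_bind_iff p q b).1 h

theorem mem_support_pure {a b : α} (h : b ∈ (pure a : PMF α).support) : b = a :=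
  (PMF.mem_support_pure_iff a b).1 h

theorem ev_uniform (s : Finset α) (hs : s.Nonempty) (f : α → ℝ≥0∞) :
    ev (PMF.uniformOfFinset s hs) f = (∑ a ∈ s, f a) / s.card := by
  classical
  unfold ev
  rw [tsum_eq_sum (s := s)]
  · rw [div_eq_mul_inv, Finset.sum_mul]
    refine Finset.sum_congr rfl fun a ha => ?_
    rw [PMF.uniformOfFinset_apply, if_pos ha, mul_comm]
  · intro b hb
    rw [PMF.uniformOfFinset_apply, if_neg hb, zero_mul]

theorem ev_uniform_ofReal (s : Finset α) (hs : s.Nonempty) (f : α → ℝ) (hf : ∀ a ∈ s, 0 ≤ f a) :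
    ev (PMF.uniformOfFinset s hs) (fun a => ENNReal.ofReal (f a)) =
      ENNReal.ofReal ((∑ a ∈ s, f a) / s.card) := by
  rw [ev_uniform, ENNReal.ofReal_div_of_pos (by exact_mod_cast hs.card_pos),
    ENNReal.ofReal_sum_of_nonneg hf, ENNReal.ofReal_natCast]

theorem mem_support_iid {q : PMF α} {k : ℕ} {l : List α} (h : l ∈ (iid q k).support) :
    l.length = k ∧ ∀ a ∈ l, a ∈ q.support := by
  induction k generalizing l with
  | zero => rw [mem_support_pure h]; simp
  | succ k ih =>
    obtain ⟨a, ha, h⟩ := mem_support_bind h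
    obtain ⟨l', hl', h⟩ := mem_support_bind h
    rw [mem_support_pure h]
    obtain ⟨h1, h2⟩ := ih hl'
    simp only [List.length_cons, h1, List.mem_cons, forall_eq_or_imp, true_and]
    exact ⟨ha, h2⟩

/-- Expectation of a product over independent samples. -/
theorem ev_iid_prod (q : PMF α) (k : ℕ) (g : α → ℝ≥0∞) :
    ev (iid q k) (fun l => (l.map g).prod) = ev q g ^ k := by
  induction k with
  | zero => simp [iid, ev_pure]
  | succ k ih =>
    simp only [iid, ev_bind, ev_pure, List.map_cons, List.prod_cons, ev_mul_left, ev_mul_right, ih,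
      pow_succ']

theorem ofReal_exp_mul_sum (c : ℝ) (g : α → ℝ) (l : List α) :
    ENNReal.ofReal (Real.exp (c * (l.map g).sum)) =
      (l.map fun a => ENNReal.ofReal (Real.exp (c * g a))).prod := by
  induction l with
  | nil => simp
  | cons a l ih =>
    rw [List.map_cons, List.sum_cons, mul_add, Real.exp_add, ENNReal.ofReal_mul (Real.exp_nonneg _),
      ih, List.map_cons, List.prod_cons]

/-- Bernstein-type bound for the exponential moment of a rescaled sum of uniform samples of a
`[0,1]`-valued function. -/
theorem ev_exp_sum_uniform_le (s : Finset α) (hs : s.Nonempty) (k : ℕ) (g : α → ℝ)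
    (h0 : ∀ a ∈ s, 0 ≤ g a) (h1 : ∀ a ∈ s, g a ≤ 1) (c : ℝ) (hc : |c| ≤ 1) :
    ev (iid (PMF.uniformOfFinset s hs) k)
        (fun l => ENNReal.ofReal (Real.exp (c * (l.map g).sum))) ≤
      ENNReal.ofReal (Real.exp ((c + c ^ 2) * (k * ((∑ a ∈ s, g a) / s.card)))) := by
  simp_rw [ofReal_exp_mul_sum]
  rw [ev_iid_prod, ev_uniform_ofReal _ _ _ (fun a _ => Real.exp_nonneg _)]
  have hcard : (0 : ℝ) < s.card := by exact_mod_cast hs.card_pos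
  have key : (∑ a ∈ s, Real.exp (c * g a)) / s.card ≤
      Real.exp ((c + c ^ 2) * ((∑ a ∈ s, g a) / s.card)) := by
    have h2 : ∀ a ∈ s, Real.exp (c * g a) ≤ 1 + (c + c ^ 2) * g a := by
      intro a ha
      have hg0 := h0 a ha
      have hg1 := h1 a ha
      have habs : |c * g a| ≤ 1 := by
        rw [abs_mul, abs_of_nonneg hg0]
        calc |c| * g a ≤ 1 * 1 := by gcongr
          _ = 1 := one_mul 1
      -- Here `exp x ≤ 1 + x + x²` for `|x| ≤ 1`, and `g² ≤ g` replaces the second moment by the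
      -- mean. Thus only the mean of the samples enters the exponent.
      have := (abs_le.1 (Real.abs_exp_sub_one_sub_id_le habs)).2
      have h3 : (c * g a) ^ 2 ≤ c ^ 2 * g a := by
        rw [mul_pow]
        have : g a ^ 2 ≤ g a := by nlinarith
        gcongr
      linarith
    calc (∑ a ∈ s, Real.exp (c * g a)) / s.card
        ≤ (∑ a ∈ s, (1 + (c + c ^ 2) * g a)) / s.card := by
          gcongr with a ha; exact h2 a ha
      _ = (c + c ^ 2) * ((∑ a ∈ s, g a) / s.card) + 1 := by
          rw [Finset.sum_add_distrib, ← Finset.mul_sum]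
          simp only [Finset.sum_const, nsmul_eq_mul, mul_one]
          field_simp
          ring
      _ ≤ _ := Real.add_one_le_exp _
  calc (ENNReal.ofReal ((∑ a ∈ s, Real.exp (c * g a)) / s.card)) ^ k
      ≤ (ENNReal.ofReal (Real.exp ((c + c ^ 2) * ((∑ a ∈ s, g a) / s.card)))) ^ k := by
        gcongr
    _ = _ := by
        rw [← ENNReal.ofReal_pow (Real.exp_nonneg _), ← Real.exp_nat_mul]
        congr 2; ring

end ev


/-! ### Edge and non-edge counts -/

section counts
variable {n : ℕ} (G : SimpleGraph (Fin n))

/-- Indicator of adjacency. -/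
noncomputable def adjW (x y : Fin n) : ℝ := open Classical in if G.Adj x y then 1 else 0

/-- Indicator of being distinct and not adjacent. -/
noncomputable def nonW (x y : Fin n) : ℝ := open Classical in if x ≠ y ∧ ¬ G.Adj x y then 1 else 0

/-- Number of adjacent ordered pairs in `S × T`. -/
noncomputable def eSum (S T : Finset (Fin n)) : ℝ := ∑ x ∈ S, ∑ y ∈ T, adjW G x y

/-- Number of non-adjacent ordered pairs of distinct nodes in `S × T`. -/
noncomputable def nSum (S T : Finset (Fin n)) : ℝ := ∑ x ∈ S, ∑ y ∈ T, nonW G x y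

/-- Non-edges minus edges inside `C`, counted as ordered pairs. -/
noncomputable def val (C : Finset (Fin n)) : ℝ := nSum G C C - eSum G C C

variable {G}

theorem adjW_nonneg (x y : Fin n) : 0 ≤ adjW G x y := by unfold adjW; split_ifs <;> norm_num
theorem nonW_nonneg (x y : Fin n) : 0 ≤ nonW G x y := by unfold nonW; split_ifs <;> norm_num
theorem adjW_le_one (x y : Fin n) : adjW G x y ≤ 1 := by unfold adjW; split_ifs <;> norm_num
theorem nonW_le_one (x y : Fin n) : nonW G x y ≤ 1 := by unfold nonW; split_ifs <;> norm_num
theorem adjW_comm (x y : Fin n) : adjW G x y = adjW G y x := by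
  by_cases h : G.Adj x y
  · simp [adjW, h, h.symm]
  · have h' : ¬ G.Adj y x := fun h' => h h'.symm
    simp [adjW, h, h']
theorem nonW_comm (x y : Fin n) : nonW G x y = nonW G y x := by
  by_cases h : G.Adj x y
  · simp [nonW, h, h.symm]
  · have h' : ¬ G.Adj y x := fun h' => h h'.symm
    simp [nonW, h, h', eq_comm]
theorem adjW_self (x : Fin n) : adjW G x x = 0 := by simp [adjW]
theorem nonW_self (x : Fin n) : nonW G x x = 0 := by simp [nonW]
theorem adjW_of_adj {x y : Fin n} (h : G.Adj x y) : adjW G x y = 1 := by simp [adjW, h]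
theorem adjW_of_not_adj {x y : Fin n} (h : ¬ G.Adj x y) : adjW G x y = 0 := by simp [adjW, h]
theorem adjW_add_nonW {x y : Fin n} (h : x ≠ y) : adjW G x y + nonW G x y = 1 := by
  unfold adjW nonW; by_cases h' : G.Adj x y <;> simp [h, h']
theorem adjW_add_nonW_eq (x y : Fin n) :
    adjW G x y + nonW G x y = 1 - if x = y then 1 else 0 := by
  by_cases h : x = y
  · subst h; simp [adjW_self, nonW_self]
  · simp [adjW_add_nonW h, h]

theorem eSum_nonneg (S T : Finset (Fin n)) : 0 ≤ eSum G S T :=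
  Finset.sum_nonneg fun x _ => Finset.sum_nonneg fun y _ => adjW_nonneg x y
theorem nSum_nonneg (S T : Finset (Fin n)) : 0 ≤ nSum G S T :=
  Finset.sum_nonneg fun x _ => Finset.sum_nonneg fun y _ => nonW_nonneg x y
theorem eSum_comm (S T : Finset (Fin n)) : eSum G S T = eSum G T S := by
  unfold eSum; rw [Finset.sum_comm]; simp_rw [adjW_comm]

theorem eSum_union_left {S S' : Finset (Fin n)} (h : Disjoint S S') (T : Finset (Fin n)) :
    eSum G (S ∪ S') T = eSum G S T + eSum G S' T := Finset.sum_union h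
theorem eSum_union_right {S S' : Finset (Fin n)} (h : Disjoint S S') (T : Finset (Fin n)) :
    eSum G T (S ∪ S') = eSum G T S + eSum G T S' := by
  rw [eSum_comm, eSum_union_left h, eSum_comm S, eSum_comm S']

theorem eSum_mono {S S' T T' : Finset (Fin n)} (h : S ⊆ S') (h' : T ⊆ T') :
    eSum G S T ≤ eSum G S' T' :=
  (Finset.sum_le_sum fun x _ => Finset.sum_le_sum_of_subset_of_nonneg h'
    fun y _ _ => adjW_nonneg x y).trans (Finset.sum_le_sum_of_subset_of_nonneg h
    fun x _ _ => Finset.sum_nonneg fun y _ => adjW_nonneg x y)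
theorem nSum_mono {S S' T T' : Finset (Fin n)} (h : S ⊆ S') (h' : T ⊆ T') :
    nSum G S T ≤ nSum G S' T' :=
  (Finset.sum_le_sum fun x _ => Finset.sum_le_sum_of_subset_of_nonneg h'
    fun y _ _ => nonW_nonneg x y).trans (Finset.sum_le_sum_of_subset_of_nonneg h
    fun x _ _ => Finset.sum_nonneg fun y _ => nonW_nonneg x y)

theorem eSum_singleton_add_nSum {C : Finset (Fin n)} {x : Fin n} (hx : x ∈ C) :
    (∑ y ∈ C, adjW G x y) + ∑ y ∈ C, nonW G x y = C.card - 1 := by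
  rw [← Finset.sum_add_distrib]
  simp_rw [adjW_add_nonW_eq]
  rw [Finset.sum_sub_distrib]
  simp [hx]

theorem eSum_add_nSum_self (C : Finset (Fin n)) :
    eSum G C C + nSum G C C = C.card * (C.card - 1) := by
  unfold eSum nSum
  rw [← Finset.sum_add_distrib, Finset.sum_congr rfl fun x hx => eSum_singleton_add_nSum hx]
  rw [Finset.sum_const, nsmul_eq_mul]

theorem val_eq (C : Finset (Fin n)) : val G C = 2 * nSum G C C - C.card * (C.card - 1) := by
  rw [← eSum_add_nSum_self (G := G), val]; ring

theorem val_eq' (C : Finset (Fin n)) : val G C = C.card * (C.card - 1) - 2 * eSum G C C := by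
  rw [← eSum_add_nSum_self (G := G), val]; ring

@[simp] theorem val_empty : val G ∅ = 0 := by simp [val, eSum, nSum]

theorem neg_eSum_le_val (C : Finset (Fin n)) : - eSum G C C ≤ val G C := by
  have := nSum_nonneg (G := G) C C
  unfold val; linarith

theorem deg_eq_sum (i u : Fin n) : (deg G i u : ℝ) = ∑ y ∈ Finset.Iic i, adjW G u y := by
  classical
  unfold deg nbrs adjW
  rw [Finset.sum_boole]
  congr 2
  ext y; simp

theorem sum_adjW_le_deg {i u : Fin n} {S : Finset (Fin n)} (hS : ∀ x ∈ S, x ≤ i) :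
    ∑ y ∈ S, adjW G u y ≤ deg G i u := by
  rw [deg_eq_sum]
  exact Finset.sum_le_sum_of_subset_of_nonneg (fun x hx => Finset.mem_Iic.2 (hS x hx))
    fun y _ _ => adjW_nonneg u y

theorem deg_lt (i u : Fin n) : deg G i u < n := by
  have h : nbrs G i u ⊆ Finset.univ.erase u := by
    intro x hx
    simp only [nbrs, Finset.mem_filter] at hx
    simpa using hx.2.2.ne'
  have := Finset.card_le_card h
  rw [Finset.card_erase_of_mem (Finset.mem_univ u), Finset.card_univ, Fintype.card_fin] at this
  have := u.pos
  unfold deg; omega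

variable (G) in
/-- The degree in the whole graph. -/
noncomputable def fdeg (u : Fin n) : ℝ := ∑ y, adjW G u y

theorem deg_le_fdeg (i u : Fin n) : (deg G i u : ℝ) ≤ fdeg G u := by
  rw [deg_eq_sum]
  exact Finset.sum_le_sum_of_subset_of_nonneg (Finset.subset_univ _) fun y _ _ => adjW_nonneg u y

theorem fdeg_nonneg (u : Fin n) : 0 ≤ fdeg G u := Finset.sum_nonneg fun y _ => adjW_nonneg u y

open Classical in
/-- Twice the cost of a clustering is the sum over the nodes of the disagreements at them. -/
theorem two_mul_cost_eq_sum {α : Type} (f : Fin n → α) :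
    2 * (cost G f : ℝ) = ∑ x, ∑ y, (if f x = f y then nonW G x y else adjW G x y) := by
  have h1 : (cost G f : ℝ) = ∑ x, ∑ y, if x < y then
      (if f x = f y then nonW G x y else adjW G x y) else 0 := by
    unfold cost
    rw [Finset.card_filter, Nat.cast_sum, ← Finset.univ_product_univ, Finset.sum_product]
    refine Finset.sum_congr rfl fun x _ => Finset.sum_congr rfl fun y _ => ?_
    unfold nonW adjW
    by_cases hxy : x < y
    · by_cases ha : G.Adj x y <;> by_cases hc : f x = f y <;> simp [hxy, hxy.ne, ha, hc]
    · simp [hxy]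
  have h2 : (cost G f : ℝ) = ∑ x, ∑ y, if y < x then
      (if f x = f y then nonW G x y else adjW G x y) else 0 := by
    rw [h1, Finset.sum_comm]
    refine Finset.sum_congr rfl fun x _ => Finset.sum_congr rfl fun y _ => ?_
    rw [nonW_comm, adjW_comm]
    simp only [eq_comm]
  rw [two_mul]
  nth_rw 1 [h1]
  rw [h2, ← Finset.sum_add_distrib]
  refine Finset.sum_congr rfl fun x _ => ?_
  rw [← Finset.sum_add_distrib]
  refine Finset.sum_congr rfl fun y _ => ?_
  rcases lt_trichotomy x y with h | h | h
  · simp [h, h.not_gt]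
  · subst h; simp [nonW_self]
  · simp [h, h.not_gt]

/-- Twice the cost of a clustering in terms of degrees and of the inner structure of its
clusters. -/
theorem two_mul_cost_eq (f : Fin n → Fin n ⊕ Fin n) (hf : ∀ u w, f u = Sum.inr w → w = u) :
    2 * (cost G f : ℝ) = ∑ x, fdeg G x +
      ∑ v, val G (Finset.univ.filter fun u => f u = Sum.inl v) := by
  classical
  have h3 : 2 * (cost G f : ℝ) = ∑ x, ∑ y, (if f x = f y then nonW G x y else adjW G x y) := by
    convert two_mul_cost_eq_sum (G := G) f
  -- Every edge is first counted as cut; a pair inside a cluster `inl v` is then corrected by `nonW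
  -- - adjW`. Two nodes sharing a value `inr w` are equal by `hf` and contribute nothing.
  have h4 : ∀ x y, (if f x = f y then nonW G x y else adjW G x y) = adjW G x y +
      ∑ v, if f x = Sum.inl v ∧ f y = Sum.inl v then nonW G x y - adjW G x y else 0 := by
    intro x y
    by_cases hxy : f x = f y
    · rw [if_pos hxy]
      rcases hx : f x with v | w
      · rw [Finset.sum_eq_single v]
        · simp [← hxy, hx]
        · intro b _ hb; rw [if_neg]; rintro ⟨h, -⟩; exact hb (Sum.inl_injective h).symm
        · simp
      · have e1 := hf x w hx
        have e2 := hf y w (hxy ▸ hx)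
        rw [← e1, ← e2]; simp [adjW_self, nonW_self]
    · rw [if_neg hxy, Finset.sum_eq_zero, add_zero]
      intro v _
      rw [if_neg]; rintro ⟨h, h'⟩; exact hxy (h.trans h'.symm)
  rw [h3]
  simp_rw [h4, Finset.sum_add_distrib]
  congr 1
  have h5 : ∀ x : Fin n, ∑ y, ∑ v, (if f x = Sum.inl v ∧ f y = Sum.inl v then
      nonW G x y - adjW G x y else 0) = ∑ v, ∑ y, (if f x = Sum.inl v ∧ f y = Sum.inl v then
      nonW G x y - adjW G x y else 0) := fun x => Finset.sum_comm
  simp_rw [h5]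
  rw [Finset.sum_comm]
  refine Finset.sum_congr rfl fun v _ => ?_
  unfold val nSum eSum
  rw [← Finset.sum_sub_distrib, Finset.sum_filter]
  refine Finset.sum_congr rfl fun x _ => ?_
  split_ifs with h
  · rw [← Finset.sum_sub_distrib, Finset.sum_filter]
    exact Finset.sum_congr rfl fun y _ => by simp [h]
  · exact Finset.sum_eq_zero fun y _ => by simp [h]

end counts


/-! ### Some degree threshold is nearly as good as the best single cluster -/

section threshold

/-- Exponent of the power of `1 + ε` below `j / 3`. -/
noncomputable def thresholdExponent (ε : ℝ) (j : ℕ) : ℕ := ⌊Real.logb (1 + ε) ((j : ℝ) / 3)⌋₊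

/-- Number of the thresholds derived from `N < j ≤ 3 N` that are at most `x`. -/
noncomputable def thresholdCount (ε : ℝ) (N x : ℕ) : ℕ :=
  open Classical in
  ((Finset.Ioc N (3 * N)).filter fun j => (1 + ε) ^ thresholdExponent ε j ≤ (x : ℝ)).card

variable {ε : ℝ}

theorem pow_thresholdExponent_le (hε : 0 < ε) {j : ℕ} (hj : 3 ≤ j) :
    (1 + ε) ^ thresholdExponent ε j ≤ (j : ℝ) / 3 := by
  have h1 : (1 : ℝ) ≤ (j : ℝ) / 3 := by
    rw [le_div_iff₀ (by norm_num)]; norm_num; exact_mod_cast hj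
  have hlog : 0 ≤ Real.logb (1 + ε) ((j : ℝ) / 3) := Real.logb_nonneg (by linarith) h1
  have := Nat.floor_le hlog
  rw [← Real.rpow_natCast]
  calc (1 + ε) ^ ((thresholdExponent ε j : ℕ) : ℝ)
      ≤ (1 + ε) ^ Real.logb (1 + ε) ((j : ℝ) / 3) :=
        Real.rpow_le_rpow_of_exponent_le (by linarith) this
    _ = _ := Real.rpow_logb (by linarith) (by linarith) (by linarith)

theorem lt_pow_thresholdExponent_succ (hε : 0 < ε) {j : ℕ} (hj : 0 < j) :
    (j : ℝ) / 3 < (1 + ε) ^ (thresholdExponent ε j + 1) := by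
  have h0 : (0 : ℝ) < (j : ℝ) / 3 := by positivity
  have := Nat.lt_floor_add_one (Real.logb (1 + ε) ((j : ℝ) / 3))
  rw [← Real.rpow_natCast]
  calc (j : ℝ) / 3 = (1 + ε) ^ Real.logb (1 + ε) ((j : ℝ) / 3) :=
        (Real.rpow_logb (by linarith) (by linarith) h0).symm
    _ < _ := Real.rpow_lt_rpow_of_exponent_lt (by linarith) (by unfold thresholdExponent; push_cast; exact this)

theorem pow_thresholdExponent_le_of_le (hε : 0 < ε) {j x : ℕ} (hx : 1 ≤ x) (h : j ≤ 3 * x) :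
    (1 + ε) ^ thresholdExponent ε j ≤ (x : ℝ) := by
  by_cases hj : 3 ≤ j
  · refine (pow_thresholdExponent_le hε hj).trans ?_
    rw [div_le_iff₀ (by norm_num)]
    have : (j : ℝ) ≤ 3 * x := by exact_mod_cast h
    linarith
  -- For `j < 3` the logarithm is not positive and the truncated floor gives exponent 0, hence
  -- threshold 1, which `x ≥ 1` still reaches.
  · have : thresholdExponent ε j = 0 := by
      unfold thresholdExponent
      rw [Nat.floor_eq_zero]
      refine lt_of_le_of_lt (b := (0 : ℝ)) ?_ one_pos
      push Not at hj
      have : (j : ℝ) ≤ 3 := by exact_mod_cast hj.le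
      exact Real.logb_nonpos (by linarith) (by positivity) (by rw [div_le_one₀ (by norm_num)]; exact this)
    rw [this, pow_zero]; exact_mod_cast hx

/-- Rounding thresholds down to powers of `1 + ε` only helps here: every index `j ≤ 3x` counts, so
no factor `1 + ε` is lost. -/
theorem le_thresholdCount (hε : 0 < ε) (N x : ℕ) :
    (3 * min (x : ℝ) N - N : ℝ) ≤ thresholdCount ε N x := by
  classical
  by_cases hx : x = 0
  · subst hx
    have h0 : (0 : ℝ) ≤ thresholdCount ε N 0 := by positivity
    have h1 : (0 : ℝ) ≤ N := by positivity
    simp only [Nat.cast_zero, min_eq_left h1]; linarith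
  have hsub : Finset.Ioc N (3 * min x N) ⊆ ((Finset.Ioc N (3 * N)).filter
      fun j => (1 + ε) ^ thresholdExponent ε j ≤ (x : ℝ)) := by
    intro j hj
    rw [Finset.mem_Ioc] at hj
    rw [Finset.mem_filter, Finset.mem_Ioc]
    exact ⟨⟨hj.1, by omega⟩, pow_thresholdExponent_le_of_le hε (by omega) (by omega)⟩
  have h2 : 3 * min x N - N ≤ thresholdCount ε N x := by
    refine le_trans (by rw [Nat.card_Ioc]) (Finset.card_le_card hsub)
  have h3 : 3 * min x N ≤ thresholdCount ε N x + N := by omega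
  have h4 : (3 * min (x : ℝ) N : ℝ) ≤ thresholdCount ε N x + N := by exact_mod_cast h3
  linarith

theorem thresholdCount_le (N x : ℕ) : thresholdCount ε N x ≤ 2 * N := by
  classical
  refine (Finset.card_filter_le _ _).trans ?_
  rw [Nat.card_Ioc]; omega

/-- Rounding down loses less than a factor `1 + ε`, so counted indices satisfy `j ≤ 3(1 + ε)x`. The
count must be nonzero because the right side can be negative otherwise. -/
theorem thresholdCount_le' (hε : 0 < ε) {N x : ℕ} (h : thresholdCount ε N x ≠ 0) :
    (thresholdCount ε N x : ℝ) ≤ 3 * (1 + ε) * x - N := by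
  classical
  have hsub : ((Finset.Ioc N (3 * N)).filter
      fun j => (1 + ε) ^ thresholdExponent ε j ≤ (x : ℝ)) ⊆
      Finset.Ioc N ⌊3 * (1 + ε) * x⌋₊ := by
    intro j hj
    rw [Finset.mem_filter, Finset.mem_Ioc] at hj
    rw [Finset.mem_Ioc]
    refine ⟨hj.1.1, Nat.le_floor ?_⟩
    have := lt_pow_thresholdExponent_succ hε (j := j) (by omega)
    rw [pow_succ] at this
    have h5 := hj.2
    have : (j : ℝ) / 3 ≤ x * (1 + ε) := this.le.trans (by gcongr)
    linarith
  have h2 : thresholdCount ε N x ≤ ⌊3 * (1 + ε) * x⌋₊ - N := by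
    refine (Finset.card_le_card hsub).trans (by rw [Nat.card_Ioc])
  have h3 : thresholdCount ε N x + N ≤ ⌊3 * (1 + ε) * x⌋₊ := by omega
  have h4 : (⌊3 * (1 + ε) * x⌋₊ : ℝ) ≤ 3 * (1 + ε) * x := Nat.floor_le (by positivity)
  have h5 : (thresholdCount ε N x + N : ℝ) ≤ ⌊3 * (1 + ε) * x⌋₊ := by exact_mod_cast h3
  linarith

theorem thresholdCount_mono {N x y : ℕ} (h : x ≤ y) :
    thresholdCount ε N x ≤ thresholdCount ε N y := by
  classical
  refine Finset.card_le_card fun j hj => ?_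
  rw [Finset.mem_filter] at hj ⊢
  exact ⟨hj.1, hj.2.trans (by exact_mod_cast h)⟩

theorem thresholdCount_min (N x y : ℕ) :
    thresholdCount ε N (min x y) = min (thresholdCount ε N x) (thresholdCount ε N y) := by
  rcases le_total x y with h | h
  · rw [min_eq_left h, min_eq_left (thresholdCount_mono h)]
  · rw [min_eq_right h, min_eq_right (thresholdCount_mono h)]

variable {n : ℕ} {G : SimpleGraph (Fin n)}

open Classical in
/-- Averaging `val` over the thresholds. -/
theorem sum_val_threshold (d : Fin n → ℕ) (B : Finset (Fin n)) (N : ℕ) :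
    ∑ j ∈ Finset.Ioc N (3 * N),
        val G (B.filter fun u => (1 + ε) ^ thresholdExponent ε j ≤ (d u : ℝ)) =
      ∑ u ∈ B, ∑ w ∈ B, (thresholdCount ε N (min (d u) (d w)) : ℝ) * (nonW G u w - adjW G u w) := by
  have h1 : ∀ j, val G (B.filter fun u => (1 + ε) ^ thresholdExponent ε j ≤ (d u : ℝ)) =
      ∑ u ∈ B, ∑ w ∈ B, (if (1 + ε) ^ thresholdExponent ε j ≤ ((min (d u) (d w) : ℕ) : ℝ)
        then 1 else 0) * (nonW G u w - adjW G u w) := by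
    intro j
    unfold val nSum eSum
    rw [← Finset.sum_sub_distrib, Finset.sum_filter]
    refine Finset.sum_congr rfl fun u _ => ?_
    rw [← Finset.sum_sub_distrib, Finset.sum_filter]
    split_ifs with h
    · refine Finset.sum_congr rfl fun w _ => ?_
      simp [h]
    · symm
      refine Finset.sum_eq_zero fun w _ => ?_
      rw [if_neg, zero_mul]
      intro h'
      exact h (h'.trans (by exact_mod_cast min_le_left _ _))
  simp_rw [h1]
  rw [Finset.sum_comm]
  refine Finset.sum_congr rfl fun u _ => ?_
  rw [Finset.sum_comm]
  refine Finset.sum_congr rfl fun w _ => ?_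
  rw [← Finset.sum_mul, Finset.sum_boole]
  rfl

/-- Contribution of the pairs inside the single cluster. -/
theorem sum_threshold_inside (hε : 0 < ε) (d : Fin n → ℕ) (C : Finset (Fin n)) (N : ℕ)
    (hN : C.card = N + 1) (hd : ∀ u ∈ C, ∑ y ∈ C, adjW G u y ≤ d u) :
    ∑ u ∈ C, ∑ w ∈ C, (thresholdCount ε N (min (d u) (d w)) : ℝ) * (nonW G u w - adjW G u w) ≤
      8 * N * val G C + 6 * N * ∑ u ∈ C, (d u : ℝ) := by
  set c : Fin n → ℝ := fun u => thresholdCount ε N (d u) with hc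
  have hc2 : ∀ u, c u ≤ 2 * N := fun u => by
    have := thresholdCount_le (ε := ε) N (d u)
    simp only [hc]; exact_mod_cast this
  have hc0 : ∀ u, 0 ≤ c u := fun u => by simp only [hc]; positivity
  -- The count of a pair is `min (c u) (c w)`. The bounds `min ≥ c u + c w - 2N`, used on edges, and
  -- `min ≤ c u`, used on non-edges, make the double sum decouple into rows.
  have hpair : ∀ u w, (thresholdCount ε N (min (d u) (d w)) : ℝ) * (nonW G u w - adjW G u w) ≤
      8 * N * (nonW G u w - adjW G u w) + (6 * N + (2 * N - c u) + (2 * N - c w)) * adjW G u w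
      - (8 * N - c u) * nonW G u w := by
    intro u w
    have hm : (thresholdCount ε N (min (d u) (d w)) : ℝ) = min (c u) (c w) := by
      rw [thresholdCount_min]; push_cast; rfl
    rw [hm]
    have h1 := adjW_nonneg (G := G) u w
    have h2 := nonW_nonneg (G := G) u w
    have h3 : c u + c w - 2 * N ≤ min (c u) (c w) := by
      rcases min_cases (c u) (c w) with ⟨h, _⟩ | ⟨h, _⟩ <;> rw [h] <;> linarith [hc2 u, hc2 w]
    have h4 : min (c u) (c w) ≤ c u := min_le_left _ _
    nlinarith [mul_le_mul_of_nonneg_right h3 h1, mul_le_mul_of_nonneg_right h4 h2]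
  have hsymm : ∑ u ∈ C, ∑ w ∈ C, (2 * N - c w) * adjW G u w =
      ∑ u ∈ C, ∑ w ∈ C, (2 * N - c u) * adjW G u w := by
    rw [Finset.sum_comm]
    simp_rw [adjW_comm]
  have hstep : ∑ u ∈ C, ∑ w ∈ C, (thresholdCount ε N (min (d u) (d w)) : ℝ) *
      (nonW G u w - adjW G u w) ≤ 8 * N * val G C + ∑ u ∈ C,
        ((6 * N + 2 * (2 * N - c u)) * (∑ w ∈ C, adjW G u w)
          - (8 * N - c u) * ∑ w ∈ C, nonW G u w) := by
    refine (Finset.sum_le_sum fun u _ => Finset.sum_le_sum fun w _ => hpair u w).trans_eq ?_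
    have e1 : ∀ u w, 8 * N * (nonW G u w - adjW G u w) +
        (6 * N + (2 * N - c u) + (2 * N - c w)) * adjW G u w - (8 * N - c u) * nonW G u w =
        (8 * N * (nonW G u w - adjW G u w) + ((6 * N + (2 * N - c u)) * adjW G u w
          - (8 * N - c u) * nonW G u w)) + (2 * N - c w) * adjW G u w := fun u w => by ring
    have e2 : val G C = ∑ u ∈ C, ∑ w ∈ C, (nonW G u w - adjW G u w) := by
      simp only [val, nSum, eSum, Finset.sum_sub_distrib]
    simp_rw [e1, Finset.sum_add_distrib]
    rw [hsymm, e2, Finset.mul_sum, ← Finset.sum_add_distrib, ← Finset.sum_add_distrib,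
      ← Finset.sum_add_distrib]
    refine Finset.sum_congr rfl fun u _ => ?_
    rw [Finset.sum_sub_distrib, ← Finset.mul_sum, ← Finset.mul_sum, ← Finset.mul_sum,
      ← Finset.mul_sum]
    ring
  refine hstep.trans ?_
  rw [Finset.mul_sum]
  gcongr with u hu
  set e := ∑ w ∈ C, adjW G u w with he
  have hne : ∑ w ∈ C, nonW G u w = N - e := by
    have := eSum_singleton_add_nSum (G := G) hu
    rw [hN] at this; push_cast at this; linarith
  rw [hne]
  have he0 : 0 ≤ e := Finset.sum_nonneg fun y _ => adjW_nonneg u y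
  have heN : e ≤ N := by
    have : 0 ≤ ∑ w ∈ C, nonW G u w := Finset.sum_nonneg fun y _ => nonW_nonneg u y
    linarith
  have hed : e ≤ d u := hd u hu
  have hlow := le_thresholdCount hε N (d u)
  change _ ≤ c u at hlow
  have hcu := hc2 u
  have hcu0 := hc0 u
  have hN0 : (0 : ℝ) ≤ N := by positivity
  -- With inner degree `e` this is the row inequality rearranged. Only `3e > N` matters: if `d u ≤
  -- N`, then `2N - c u ≤ 3(N - d u)`; if `d u ≥ N`, all thresholds count and the left side
  -- vanishes.
  have goal : (2 * N - c u) * (3 * e - N) ≤ 6 * N * (d u + N - 2 * e) := by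
    by_cases h3 : 3 * e ≤ N
    · have : (2 * N - c u) * (3 * e - N) ≤ 0 :=
        mul_nonpos_of_nonneg_of_nonpos (by linarith) (by linarith)
      have : 0 ≤ 6 * N * (d u + N - 2 * e) := by
        apply mul_nonneg (by positivity); linarith
      linarith
    · rcases le_total (d u : ℝ) N with h | h
      · rw [min_eq_left h] at hlow
        calc (2 * N - c u) * (3 * e - N) ≤ (2 * N - c u) * (2 * N) := by
              apply mul_le_mul_of_nonneg_left <;> linarith
          _ ≤ (3 * (N - d u)) * (2 * N) := by
              apply mul_le_mul_of_nonneg_right <;> linarith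
          _ = 6 * N * (N - d u) := by ring
          _ ≤ _ := by
              apply mul_le_mul_of_nonneg_left <;> linarith
      · rw [min_eq_right h] at hlow
        have : c u = 2 * N := by linarith
        rw [this, sub_self, zero_mul]
        apply mul_nonneg (by positivity); linarith
  nlinarith [goal]

end threshold


/-! ### Pairs outside the single cluster, and the averaging argument over thresholds. -/

section thresholdChoice
variable {ε : ℝ} {n : ℕ} {G : SimpleGraph (Fin n)}

/-- Contribution of the pairs that are not inside the single cluster. -/
theorem sum_threshold_outside (d : Fin n → ℕ) (B C : Finset (Fin n)) (hC : C ⊆ B) (N : ℕ) :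
    ∑ u ∈ B, ∑ w ∈ B, (thresholdCount ε N (min (d u) (d w)) : ℝ) * (nonW G u w - adjW G u w) ≤
      ∑ u ∈ C, ∑ w ∈ C, (thresholdCount ε N (min (d u) (d w)) : ℝ) * (nonW G u w - adjW G u w) +
      ∑ u ∈ (B \ C).filter (fun u => thresholdCount ε N (d u) ≠ 0), (thresholdCount ε N (d u) : ℝ) *
        (2 * C.card + ((B \ C).filter (fun u => thresholdCount ε N (d u) ≠ 0)).card - 1) := by
  classical
  set M := B \ C with hM
  set M' := M.filter (fun u => thresholdCount ε N (d u) ≠ 0) with hM'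
  set m : Fin n → Fin n → ℝ := fun u w => thresholdCount ε N (min (d u) (d w)) with hm
  have hm0 : ∀ u w, 0 ≤ m u w := fun u w => by simp only [hm]; positivity
  have hmc : ∀ u w, m u w = m w u := fun u w => by simp only [hm, min_comm]
  have hml : ∀ u w, m u w ≤ thresholdCount ε N (d u) := fun u w => by
    simp only [hm]; exact_mod_cast thresholdCount_mono (min_le_left _ _)
  set g : Fin n → Fin n → ℝ := fun u w => m u w * (nonW G u w - adjW G u w) with hg
  have hgc : ∀ u w, g u w = g w u := fun u w => by
    simp only [hg, hmc u w, nonW_comm u w, adjW_comm u w]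
  have hgm : ∀ u w, g u w ≤ m u w := fun u w => by
    have h1 := adjW_nonneg (G := G) u w
    have h2 := nonW_le_one (G := G) u w
    have := hm0 u w
    simp only [hg]
    calc m u w * (nonW G u w - adjW G u w) ≤ m u w * 1 := by
          apply mul_le_mul_of_nonneg_left _ this; linarith
      _ = _ := mul_one _
  have hgs : ∀ u, g u u = 0 := fun u => by simp [hg, adjW_self, nonW_self]
  have hB : B = C ∪ M := by rw [hM, Finset.union_sdiff_of_subset hC]
  have hdisj : Disjoint C M := Finset.disjoint_sdiff
  have hsplit : ∑ u ∈ B, ∑ w ∈ B, g u w = ∑ u ∈ C, ∑ w ∈ C, g u w +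
      2 * ∑ u ∈ M, ∑ w ∈ C, g u w + ∑ u ∈ M, ∑ w ∈ M, g u w := by
    rw [hB, Finset.sum_union hdisj]
    simp_rw [Finset.sum_union hdisj, Finset.sum_add_distrib]
    have : ∑ u ∈ C, ∑ w ∈ M, g u w = ∑ u ∈ M, ∑ w ∈ C, g u w := by
      rw [Finset.sum_comm]; simp_rw [hgc]
    rw [this]; ring
  change ∑ u ∈ B, ∑ w ∈ B, g u w ≤ ∑ u ∈ C, ∑ w ∈ C, g u w + _
  rw [hsplit, add_assoc]
  gcongr
  -- Edges are dropped and each remaining pair is bounded by the count of `u`. The diagonal pair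
  -- contributes nothing, hence the `- 1`; a row of count zero is not positive.
  have hrow : ∀ u ∈ M, 2 * ∑ w ∈ C, g u w + ∑ w ∈ M, g u w ≤
      if thresholdCount ε N (d u) ≠ 0 then
        (thresholdCount ε N (d u) : ℝ) * (2 * C.card + M'.card - 1) else 0 := by
    intro u hu
    split_ifs with h
    · have h1 : ∑ w ∈ C, g u w ≤ ∑ w ∈ C, (thresholdCount ε N (d u) : ℝ) :=
        Finset.sum_le_sum fun w _ => (hgm u w).trans (hml u w)
      have h2 : ∑ w ∈ M, g u w ≤ ∑ w ∈ M'.erase u, (thresholdCount ε N (d u) : ℝ) := by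
        have hsub : M'.erase u ⊆ M := (Finset.erase_subset _ _).trans (Finset.filter_subset _ _)
        rw [← Finset.sum_sdiff hsub]
        have h3 : ∑ w ∈ M \ M'.erase u, g u w ≤ 0 := by
          refine Finset.sum_nonpos fun w hw => ?_
          rw [Finset.mem_sdiff, Finset.mem_erase, hM', Finset.mem_filter] at hw
          by_cases huw : w = u
          · rw [huw, hgs]
          · have : thresholdCount ε N (d w) = 0 := by
              by_contra h'; exact hw.2 ⟨huw, hw.1, h'⟩
            refine (hgm u w).trans ?_
            rw [hmc]
            refine (hml w u).trans ?_
            rw [this]; simp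
        have h4 : ∑ w ∈ M'.erase u, g u w ≤ ∑ w ∈ M'.erase u, (thresholdCount ε N (d u) : ℝ) :=
          Finset.sum_le_sum fun w _ => (hgm u w).trans (hml u w)
        linarith
      rw [Finset.sum_const, nsmul_eq_mul] at h1 h2
      have hmem : u ∈ M' := Finset.mem_filter.2 ⟨hu, h⟩
      have h5 : ((M'.erase u).card : ℝ) = M'.card - 1 := by
        rw [Finset.card_erase_of_mem hmem, Nat.cast_pred (Finset.card_pos.2 ⟨u, hmem⟩)]
      rw [h5] at h2
      linarith
    · push Not at h
      have h1 : ∀ w, g u w ≤ 0 := fun w => (hgm u w).trans ((hml u w).trans (by rw [h]; simp))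
      have h2 : ∑ w ∈ C, g u w ≤ 0 := Finset.sum_nonpos fun w _ => h1 w
      have h3 : ∑ w ∈ M, g u w ≤ 0 := Finset.sum_nonpos fun w _ => h1 w
      linarith
  rw [Finset.mul_sum, ← Finset.sum_add_distrib, Finset.sum_filter]
  exact Finset.sum_le_sum hrow

/-- For the outer nodes that some threshold reaches, `m` is their number, `S` their total degree and
`T` their total count. After inserting `hT`, the bound `3S ≤ (N+1)N` cancels the terms of lower
order. For `m ≥ 2` there is slack left over; for `m = 1` the slack is gone, and `N + 1 ≤ 7S` is
needed, which gives `20 = 6 + 14`. -/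
theorem threshold_arith {N S T m : ℝ} (hε : 0 < ε) (hε' : ε < 1 / 1000) (hN : 1 ≤ N)
    (hS0 : 0 ≤ S) (hT : T ≤ 3 * (1 + ε) * S - N * m) (hS : 3 * S ≤ (N + 1) * N)
    (hm : 2 ≤ m ∨ (m = 1 ∧ N ≤ 3 * (1 + ε) * S)) :
    T * (2 * (N + 1) + m - 1) ≤ (6 + 20 * ε) * N * S := by
  rcases hm with hm | ⟨rfl, hN'⟩
  · have h1 : 0 ≤ m - 1 - ε * (m + 1) := by nlinarith
    have h2 : 0 ≤ N * ((N + 1) * (m - 1 - ε * (m + 1)) + m * (m - 1)) := by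
      apply mul_nonneg (by linarith)
      apply add_nonneg
      · exact mul_nonneg (by linarith) h1
      · apply mul_nonneg <;> linarith
    have h3 : 0 ≤ ε * (N * S) := by positivity
    have h4 : (1 + ε) * (m + 1) * (3 * S) ≤ (1 + ε) * (m + 1) * ((N + 1) * N) := by gcongr
    have h5 : T * (2 * (N + 1) + m - 1) ≤ (3 * (1 + ε) * S - N * m) * (2 * (N + 1) + m - 1) := by
      apply mul_le_mul_of_nonneg_right hT; linarith
    linarith
  · have hSN' : N ≤ 3.1 * S := by nlinarith
    have h5 : T * (2 * (N + 1) + 1 - 1) ≤ (3 * (1 + ε) * S - N * 1) * (2 * (N + 1) + 1 - 1) := by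
      apply mul_le_mul_of_nonneg_right hT; linarith
    have h4 : (1 + ε) * (3 * S) ≤ (1 + ε) * ((N + 1) * N) := by gcongr
    have h6 : 2 * ε * (N * (N + 1)) ≤ 2 * ε * (N * (7 * S)) := by
      gcongr; linarith
    linarith

open Classical in
/-- Some degree threshold gives, up to a factor close to `4`, the best single cluster. -/
theorem exists_threshold (hε : 0 < ε) (hε' : ε < 1 / 1000) (hn : 0 < n) (d : Fin n → ℕ)
    (hdn : ∀ u, d u < n) (B C : Finset (Fin n)) (hC : C ⊆ B)
    (hd : ∀ u ∈ C, ∑ y ∈ C, adjW G u y ≤ d u) :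
    ∃ j ∈ Finset.range (⌈Real.logb (1 + ε) n⌉₊ + 1),
      ∑ u ∈ B, (d u : ℝ) + val G (B.filter fun u => (1 + ε) ^ j ≤ (d u : ℝ)) ≤
        (4 + 10 * ε) * (∑ u ∈ B, (d u : ℝ) + val G C) := by
  have hn0 : (0 : ℝ) < n := by exact_mod_cast hn
  set D := ∑ u ∈ B, (d u : ℝ) with hD
  set DC := ∑ u ∈ C, (d u : ℝ) with hDC
  set DM := ∑ u ∈ B \ C, (d u : ℝ) with hDM
  have hDsplit : D = DM + DC := (Finset.sum_sdiff hC).symm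
  have heC : eSum G C C ≤ DC := Finset.sum_le_sum hd
  have hDM0 : 0 ≤ DM := Finset.sum_nonneg fun u _ => by positivity
  have hval := neg_eSum_le_val (G := G) C
  have hgg : DM ≤ D + val G C := by linarith
  -- In this case `D ≤ 4 (D + val C)`, so making everything a singleton suffices; the last threshold
  -- is at least `n` and exceeds every degree.
  by_cases hcase : -(4 * val G C) ≤ 3 * D
  · refine ⟨⌈Real.logb (1 + ε) n⌉₊, by simp, ?_⟩
    have hempty : B.filter (fun u => (1 + ε) ^ ⌈Real.logb (1 + ε) n⌉₊ ≤ (d u : ℝ)) = ∅ := by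
      refine Finset.filter_eq_empty_iff.2 fun u _ => not_le.2 ?_
      have h1 : (n : ℝ) ≤ (1 + ε) ^ ⌈Real.logb (1 + ε) n⌉₊ := by
        rw [← Real.rpow_natCast]
        calc (n : ℝ) = (1 + ε) ^ Real.logb (1 + ε) n :=
              (Real.rpow_logb (by linarith) (by linarith) hn0).symm
          _ ≤ _ := Real.rpow_le_rpow_of_exponent_le (by linarith) (Nat.le_ceil _)
      exact lt_of_lt_of_le (by exact_mod_cast hdn u) h1
    rw [hempty, val_empty]
    nlinarith
  push Not at hcase
  have hsum := eSum_add_nSum_self (G := G) C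
  have hnS := nSum_nonneg (G := G) C C
  have hD0 : 0 ≤ D := Finset.sum_nonneg fun u _ => by positivity
  have hepos : 0 < eSum G C C := by linarith
  have hk : 2 ≤ C.card := by
    by_contra hk
    have : (C.card : ℝ) = 0 ∨ (C.card : ℝ) = 1 := by
      have : C.card = 0 ∨ C.card = 1 := by omega
      rcases this with h | h <;> simp [h]
    rcases this with h | h <;> rw [h] at hsum <;> linarith
  -- From now on `C` contains an edge. `N` is the degree inside a clique on `C`, and the thresholds
  -- to be averaged lie roughly between `N / 3` and `N`.
  obtain ⟨N, hN⟩ : ∃ N, C.card = N + 1 := ⟨C.card - 1, by omega⟩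
  have hN1 : (1 : ℝ) ≤ N := by
    have : 1 ≤ N := by omega
    exact_mod_cast this
  have hkN : (C.card : ℝ) = N + 1 := by rw [hN]; push_cast; rfl
  have hNn : N < n := by
    have := Finset.card_le_univ C
    rw [Fintype.card_fin] at this; omega
  -- Failure of `hcase` says `4(e - non) > 3 DM + 3 DC` for the edges `e` and non-edges `non` of
  -- `C`. Since `DC ≥ e`, this leaves `3 DM < e ≤ (N+1)N`: the nodes outside `C` have little total
  -- degree.
  have h3DM : 3 * DM ≤ (N + 1) * N := by
    have : val G C = nSum G C C - eSum G C C := rfl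
    rw [hkN] at hsum
    nlinarith
  -- the average over the thresholds
  have havg : ∑ j ∈ Finset.Ioc N (3 * N),
      (D + val G (B.filter fun u => (1 + ε) ^ thresholdExponent ε j ≤ (d u : ℝ))) ≤
      ∑ j ∈ Finset.Ioc N (3 * N), (4 + 10 * ε) * (D + val G C) := by
    rw [Finset.sum_add_distrib, sum_val_threshold, Finset.sum_const, Finset.sum_const, Nat.card_Ioc]
    have h2N : ((3 * N - N : ℕ) : ℝ) = 2 * N := by
      have : 3 * N - N = 2 * N := by omega
      rw [this]; push_cast; rfl
    rw [nsmul_eq_mul, nsmul_eq_mul, h2N]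
    have h1 := sum_threshold_outside (ε := ε) (G := G) d B C hC N
    have h2 := sum_threshold_inside (G := G) hε d C N hN hd
    set M' := (B \ C).filter (fun u => thresholdCount ε N (d u) ≠ 0) with hM'
    set S := ∑ u ∈ M', (d u : ℝ) with hS
    have hSDM : S ≤ DM := Finset.sum_le_sum_of_subset_of_nonneg (Finset.filter_subset _ _)
      fun u _ _ => by positivity
    have hS0 : 0 ≤ S := Finset.sum_nonneg fun u _ => by positivity
    have h3 : ∑ u ∈ M', (thresholdCount ε N (d u) : ℝ) * (2 * C.card + M'.card - 1) ≤
        (6 + 20 * ε) * N * S := by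
      rw [← Finset.sum_mul]
      have hc : ∑ u ∈ M', (thresholdCount ε N (d u) : ℝ) ≤ 3 * (1 + ε) * S - N * M'.card := by
        calc ∑ u ∈ M', (thresholdCount ε N (d u) : ℝ)
            ≤ ∑ u ∈ M', (3 * (1 + ε) * d u - N) :=
              Finset.sum_le_sum fun u hu => thresholdCount_le' hε (Finset.mem_filter.1 hu).2
          _ = _ := by
              rw [Finset.sum_sub_distrib, ← Finset.mul_sum, Finset.sum_const, nsmul_eq_mul]; ring
      rcases Nat.eq_zero_or_pos M'.card with h0 | h0
      · rw [Finset.card_eq_zero] at h0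
        simp [hS, h0]
      · have hm1 : (1 : ℝ) ≤ M'.card := by exact_mod_cast h0
        rw [hkN]
        have hS3 : 3 * S ≤ (N + 1) * N := by linarith
        refine threshold_arith hε hε' hN1 hS0 hc hS3 ?_
        rcases Nat.lt_or_ge 1 M'.card with h1' | h1'
        · left; exact_mod_cast h1'
        · right
          have hm1' : M'.card = 1 := by omega
          refine ⟨by rw [hm1']; simp, ?_⟩
          obtain ⟨u, hu⟩ := Finset.card_pos.1 h0
          have hu0 := (Finset.mem_filter.1 hu).2
          have hcu := thresholdCount_le' hε hu0
          have hcu1 : (1 : ℝ) ≤ thresholdCount ε N (d u) := by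
            exact_mod_cast Nat.one_le_iff_ne_zero.2 hu0
          have hdS : (d u : ℝ) ≤ S := Finset.single_le_sum (f := fun u => (d u : ℝ))
            (fun u _ => by positivity) hu
          have : 3 * (1 + ε) * d u ≤ 3 * (1 + ε) * S := by gcongr
          linarith
    have h4 : (6 + 20 * ε) * N * S ≤ 6 * N * DM + 20 * N * ε * (D + val G C) := by
      have e1 : N * S ≤ N * DM := by gcongr
      have e2 : ε * (N * S) ≤ ε * (N * (D + val G C)) := by gcongr; linarith
      linarith
    have h5 : ∑ u ∈ C, (d u : ℝ) = DC := rfl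
    rw [h5] at h2
    have h6 : N * D = N * DM + N * DC := by rw [hDsplit]; ring
    linarith
  obtain ⟨j, hj, hle⟩ := Finset.exists_le_of_sum_le (by
    rw [Finset.nonempty_Ioc]; omega) havg
  refine ⟨thresholdExponent ε j, ?_, hle⟩
  rw [Finset.mem_range, Nat.lt_succ_iff]
  rw [Finset.mem_Ioc] at hj
  unfold thresholdExponent
  refine (Nat.floor_le_ceil _).trans (Nat.ceil_mono ?_)
  have hj0 : (0 : ℝ) < j := by exact_mod_cast (by omega : 0 < j)
  refine Real.logb_le_logb_of_le (by linarith) (by positivity) ?_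
  rw [div_le_iff₀ (by norm_num)]
  have : j ≤ n * 3 := by omega
  exact_mod_cast this

end thresholdChoice


/-! ### Exponential moments of the cost estimates -/

section estimate
variable {n : ℕ} (G : SimpleGraph (Fin n))

/-- Edges with an endpoint in `B` that are cut, plus non-edges inside `C`, when `C` is one cluster
and the nodes of `B ∖ C` are singletons. -/
noncomputable def breakCost (i : Fin n) (B C : Finset (Fin n)) : ℝ :=
  ∑ w ∈ B, (deg G i w : ℝ) - eSum G B B / 2 + val G C / 2

/-- The quantity estimated by the algorithm, up to a constant factor. -/
noncomputable def penalizedCost (ε : ℝ) (i : Fin n) (B C : Finset (Fin n)) : ℝ :=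
  breakCost G i B C + 9 * ε * C.card

/-- Expected value of the estimate of the contribution of `w ∈ B ∖ C`. -/
noncomputable def singletonMean (i : Fin n) (B C : Finset (Fin n)) (w : Fin n) : ℝ :=
  (∑ y ∈ B \ C, adjW G w y) / 2 + (deg G i w - ∑ y ∈ B, adjW G w y)

/-- Expected value of the part of the estimate that is obtained by sampling. -/
noncomputable def sampledMean (i : Fin n) (B C : Finset (Fin n)) : ℝ :=
  3 / 2 * nSum G C C + ∑ w ∈ B \ C, singletonMean G i B C w

variable {G} {ε : ℝ} {i : Fin n} {B C : Finset (Fin n)}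

theorem singletonMean_nonneg (hB : ∀ x ∈ B, x ≤ i) (w : Fin n) : 0 ≤ singletonMean G i B C w := by
  have h1 := sum_adjW_le_deg (G := G) (u := w) hB
  have h2 : 0 ≤ ∑ y ∈ B \ C, adjW G w y := Finset.sum_nonneg fun y _ => adjW_nonneg w y
  unfold singletonMean; linarith

theorem sampledMean_nonneg (hB : ∀ x ∈ B, x ≤ i) : 0 ≤ sampledMean G i B C :=
  add_nonneg (mul_nonneg (by norm_num) (nSum_nonneg C C))
    (Finset.sum_nonneg fun w _ => singletonMean_nonneg hB w)

theorem eSum_split (hC : C ⊆ B) :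
    eSum G B B = eSum G C C + eSum G (B \ C) (B \ C) + 2 * eSum G (B \ C) C := by
  have hd : Disjoint C (B \ C) := Finset.disjoint_sdiff
  have hB : B = C ∪ B \ C := (Finset.union_sdiff_of_subset hC).symm
  have h1 : eSum G B B = eSum G (C ∪ B \ C) (C ∪ B \ C) := by rw [← hB]
  rw [h1, eSum_union_left hd, eSum_union_right hd, eSum_union_right hd, eSum_comm C (B \ C)]
  ring

theorem sum_singletonMean (hC : C ⊆ B) : ∑ w ∈ B \ C, singletonMean G i B C w =
    ∑ w ∈ B \ C, (deg G i w : ℝ) - eSum G (B \ C) (B \ C) / 2 - eSum G (B \ C) C := by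
  unfold singletonMean
  rw [Finset.sum_add_distrib, Finset.sum_sub_distrib, ← Finset.sum_div]
  change eSum G (B \ C) (B \ C) / 2 + (_ - eSum G (B \ C) B) = _
  have h1 : eSum G (B \ C) B = eSum G (B \ C) (C ∪ B \ C) := by
    rw [Finset.union_sdiff_of_subset hC]
  rw [h1, eSum_union_right Finset.disjoint_sdiff]
  ring

/-- Explains the weight 3 of `Y`: subtracting `|C|(|C| - 1)`, that is edges plus non-edges as
ordered pairs, removes each non-edge of `C` twice, and adding it three times leaves it counted once.
-/
theorem breakCost_eq_estimate (hC : C ⊆ B) :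
    breakCost G i B C = ∑ w ∈ C, (deg G i w : ℝ) - C.card * (C.card - 1) + sampledMean G i B C := by
  unfold sampledMean
  rw [sum_singletonMean hC, ← eSum_add_nSum_self (G := G), breakCost, eSum_split hC,
    ← Finset.sum_sdiff hC, val]
  ring

/-- The unsampled part is at least `- nSum C C`, because the degrees cover the edges inside `C`,
while `nSum C C` is at most two thirds of the sampled mean. So the fluctuations, which the sampled
mean controls, are controlled by the cost. -/
theorem sampledMean_le (hB : ∀ x ∈ B, x ≤ i) (hC : C ⊆ B) :
    sampledMean G i B C ≤ 3 * breakCost G i B C := by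
  have h1 := breakCost_eq_estimate (G := G) (i := i) hC
  have h2 : eSum G C C ≤ ∑ w ∈ C, (deg G i w : ℝ) :=
    Finset.sum_le_sum fun w _ => sum_adjW_le_deg fun x hx => hB x (hC hx)
  have h3 : 0 ≤ ∑ w ∈ B \ C, singletonMean G i B C w :=
    Finset.sum_nonneg fun w _ => singletonMean_nonneg hB w
  rw [← eSum_add_nSum_self (G := G)] at h1
  unfold sampledMean at h1 ⊢
  have := nSum_nonneg (G := G) C C
  linarith

theorem breakCost_nonneg (hB : ∀ x ∈ B, x ≤ i) (hC : C ⊆ B) : 0 ≤ breakCost G i B C := by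
  have := sampledMean_le (G := G) hB hC
  have := sampledMean_nonneg (G := G) (C := C) hB
  linarith

theorem mul_countP_add (l : List (Fin n)) (p q : Fin n → Prop) [DecidablePred p] [DecidablePred q]
    (a : ℝ) :
    a * (l.countP (fun x => decide (p x)) : ℝ) / 2 + a * (l.countP (fun x => decide (q x)) : ℝ) =
      a * (l.map fun x => (if p x then 1 else 0) / 2 + if q x then (1 : ℝ) else 0).sum := by
  induction l with
  | nil => simp
  | cons x l ih =>
    rw [List.map_cons, List.sum_cons, mul_add, ← ih, List.countP_cons, List.countP_cons]
    by_cases hp : p x <;> by_cases hq : q x <;> simp [hp, hq] <;> ring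

theorem countP_eq_sum {α : Type} (l : List α) (p : α → Prop) [DecidablePred p] :
    (l.countP (fun x => decide (p x)) : ℝ) = (l.map fun x => if p x then (1 : ℝ) else 0).sum := by
  induction l with
  | nil => simp
  | cons x l ih =>
    rw [List.map_cons, List.sum_cons, ← ih, List.countP_cons]
    by_cases hp : p x <;> simp [hp]; ring

/-- A sampled edge contributes at most `deg / η ≤ b`, so the Bernstein bound applies with scale `b`.
A node without edges has nothing to sample, and its mean is 0. -/
theorem ev_exp_singletonCostEstimate_le (hB : ∀ x ∈ B, x ≤ i) (w : Fin n) {b t : ℝ}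
    (hlog : 0 < Real.log n) (hε : 0 < ε)
    (hb : deg G i w * (ε ^ 3 / (10 * Real.log n)) ≤ b) (ht : |t| * b ≤ 1) :
    ev (singletonCostEstimate G ε i B C w) (fun x => ENNReal.ofReal (Real.exp (t * x))) ≤
      ENNReal.ofReal (Real.exp ((t + t ^ 2 * b) * singletonMean G i B C w)) := by
  classical
  unfold singletonCostEstimate
  have hb0 : 0 ≤ b := le_trans (by positivity) hb
  split_ifs with h
  · rw [ev_bind]
    simp only [ev_pure]
    set η : ℕ := ⌈10 * Real.log n / ε ^ 3⌉₊ with hη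
    have hη1 : 10 * Real.log n / ε ^ 3 ≤ η := Nat.le_ceil _
    have hη0 : (0 : ℝ) < η := lt_of_lt_of_le (by positivity) hη1
    have hd0 : (0 : ℝ) < deg G i w := by exact_mod_cast h.card_pos
    have hle : deg G i w / (η : ℝ) ≤ b := by
      refine le_trans ?_ hb
      rw [div_le_iff₀ hη0]
      have h1 : (1 : ℝ) = ε ^ 3 / (10 * Real.log n) * (10 * Real.log n / ε ^ 3) := by field_simp
      calc (deg G i w : ℝ) = deg G i w * (ε ^ 3 / (10 * Real.log n) * (10 * Real.log n / ε ^ 3)) := by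
            rw [← h1, mul_one]
        _ ≤ deg G i w * (ε ^ 3 / (10 * Real.log n) * η) := by gcongr
        _ = _ := by ring
    set g : Fin n → ℝ := fun x => (if x ∈ B \ C then 1 else 0) / 2 + if x ∉ B then (1 : ℝ) else 0
      with hg
    have hg0 : ∀ x, 0 ≤ g x := fun x => by simp only [hg]; split_ifs <;> norm_num
    have hg1 : ∀ x, g x ≤ 1 := fun x => by
      simp only [hg, Finset.mem_sdiff]
      by_cases hx : x ∈ B <;> by_cases hx' : x ∈ C <;> simp [hx, hx'] <;> norm_num
    have hsum : ∑ x ∈ nbrs G i w, g x = singletonMean G i B C w := by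
      have e1 : ∀ S : Finset (Fin n), (∀ x ∈ S, x ≤ i) →
          ∑ x ∈ nbrs G i w, (if x ∈ S then (1 : ℝ) else 0) = ∑ y ∈ S, adjW G w y := by
        intro S hS
        unfold adjW
        rw [Finset.sum_boole, Finset.sum_boole]
        congr 2
        ext x
        simp only [nbrs, Finset.mem_filter, Finset.mem_univ, true_and]
        exact ⟨fun h => ⟨h.2, h.1.2⟩, fun h => ⟨⟨hS x h.1, h.2⟩, h.1⟩⟩
      have e2 : ∀ x, (if x ∉ B then (1 : ℝ) else 0) = 1 - if x ∈ B then 1 else 0 := by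
        intro x; by_cases hx : x ∈ B <;> simp [hx]
      simp only [hg, e2]
      rw [Finset.sum_add_distrib, Finset.sum_sub_distrib, ← Finset.sum_div,
        e1 _ (fun x hx => hB x (Finset.mem_sdiff.1 hx).1), e1 _ hB]
      simp [singletonMean, deg]
    have hexp : ∀ l : List (Fin n), t * ((deg G i w : ℝ) / (η : ℝ) *
        (l.countP (fun x => decide (x ∈ B \ C)) : ℝ) / 2
        + (deg G i w : ℝ) / (η : ℝ) * (l.countP (fun x => decide (x ∉ B)) : ℝ)) =
        (t * (deg G i w / (η : ℝ))) * (l.map g).sum := by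
      intro l
      rw [mul_countP_add]; ring
    simp_rw [hexp]
    refine (ev_exp_sum_uniform_le _ h η g (fun a _ => hg0 a) (fun a _ => hg1 a) _ ?_).trans ?_
    · rw [abs_mul, abs_of_nonneg (by positivity : (0 : ℝ) ≤ deg G i w / (η : ℝ))]
      exact (mul_le_mul_of_nonneg_left hle (abs_nonneg t)).trans ht
    · rw [hsum]
      apply ENNReal.ofReal_le_ofReal
      apply Real.exp_le_exp.2
      have hm := singletonMean_nonneg (G := G) (C := C) hB w
      have h3 : (t * (deg G i w / (η : ℝ)) + (t * (deg G i w / (η : ℝ))) ^ 2) *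
          (η * (singletonMean G i B C w / (nbrs G i w).card)) =
          (t + t ^ 2 * (deg G i w / (η : ℝ))) * singletonMean G i B C w := by
        change _ * (_ * (_ / (deg G i w : ℝ))) = _
        field_simp
      rw [h3]
      gcongr
  · rw [ev_pure]
    rw [Finset.not_nonempty_iff_eq_empty] at h
    have hd : (deg G i w : ℝ) = 0 := by simp [deg, h]
    have hz : singletonMean G i B C w = 0 := by
      have h1 := sum_adjW_le_deg (G := G) (u := w) hB
      have h2 : ∑ y ∈ B \ C, adjW G w y ≤ ∑ y ∈ B, adjW G w y :=
        Finset.sum_le_sum_of_subset_of_nonneg Finset.sdiff_subset fun y _ _ => adjW_nonneg w y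
      have h3 : 0 ≤ ∑ y ∈ B \ C, adjW G w y := Finset.sum_nonneg fun y _ => adjW_nonneg w y
      unfold singletonMean
      rw [hd] at h1 ⊢
      linarith
    rw [hz]; simp

theorem sum_offDiag_nonadj (C : Finset (Fin n)) :
    (open Classical in ∑ e ∈ C.offDiag, if ¬ G.Adj e.1 e.2 then (1 : ℝ) else 0) = nSum G C C := by
  classical
  unfold nSum nonW
  rw [← Finset.sum_product', Finset.sum_boole, Finset.sum_boole]
  congr 2
  ext e
  simp only [Finset.mem_filter, Finset.mem_offDiag, Finset.mem_product]
  tauto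

/-- The number of samples grows linearly in `|C|`, so one sample, weighing `3 (|C| choose 2) / τ`,
is of order `|C| ε³ / log n` although the number of pairs is quadratic. -/
theorem ev_exp_inClusterCostEstimate_le {b t : ℝ} (hlog : 0 < Real.log n) (hε : 0 < ε)
    (hb : 3 * C.card * (ε ^ 3 / (10 * Real.log n)) ≤ b) (ht : |t| * b ≤ 1) :
    ev (inClusterCostEstimate G ε C) (fun y => ENNReal.ofReal (Real.exp (t * (3 * y)))) ≤
      ENNReal.ofReal (Real.exp ((t + t ^ 2 * b) * (3 / 2 * nSum G C C))) := by
  classical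
  unfold inClusterCostEstimate
  have hb0 : 0 ≤ b := le_trans (by positivity) hb
  dsimp only
  split_ifs with h
  · rw [ev_bind]
    simp only [ev_pure]
    set τ : ℕ := ⌈5 * (C.card : ℝ) * Real.log n / ε ^ 3⌉₊ with hτ
    have hk : 1 < C.card := by
      obtain ⟨e, he⟩ := h
      rw [Finset.mem_offDiag] at he
      exact Finset.one_lt_card.2 ⟨e.1, he.1, e.2, he.2.1, he.2.2⟩
    have hk1 : (1 : ℝ) < C.card := by exact_mod_cast hk
    have hτ1 : 5 * (C.card : ℝ) * Real.log n / ε ^ 3 ≤ τ := Nat.le_ceil _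
    have hτ0 : (0 : ℝ) < τ := lt_of_lt_of_le (by positivity) hτ1
    have hch : (C.card.choose 2 : ℝ) = C.card * (C.card - 1) / 2 := Nat.cast_choose_two ℝ _
    have hoff : (C.offDiag.card : ℝ) = C.card * (C.card - 1) := by
      rw [Finset.offDiag_card, Nat.cast_sub (Nat.le_mul_self _)]; push_cast; ring
    set a : ℝ := 3 * (C.card.choose 2 : ℝ) / τ with ha
    have ha0 : 0 ≤ a := by positivity
    have hle : a ≤ b := by
      refine le_trans ?_ hb
      rw [ha, div_le_iff₀ hτ0, hch]
      have h1 : (1 : ℝ) = ε ^ 3 / (10 * Real.log n) * (2 * (5 * Real.log n / ε ^ 3)) := by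
        field_simp; norm_num
      have h2 : (C.card : ℝ) * (5 * Real.log n / ε ^ 3) ≤ τ := by
        refine le_trans (le_of_eq ?_) hτ1; ring
      calc 3 * ((C.card : ℝ) * (C.card - 1) / 2) ≤ 3 * (C.card * C.card / 2) := by gcongr; linarith
        _ = 3 * (C.card * C.card / 2) * 1 := (mul_one _).symm
        _ = 3 * C.card * (ε ^ 3 / (10 * Real.log n)) * (C.card * (5 * Real.log n / ε ^ 3)) := by
            rw [h1]; ring
        _ ≤ _ := by gcongr
    set g : Fin n × Fin n → ℝ := fun e => if ¬ G.Adj e.1 e.2 then (1 : ℝ) else 0 with hg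
    have hexp : ∀ l : List (Fin n × Fin n), t * (3 * ((l.countP
        (fun e => decide (¬ G.Adj e.1 e.2)) : ℝ) * (C.card.choose 2 : ℝ) / (τ : ℝ))) =
        (t * a) * (l.map g).sum := by
      intro l
      rw [countP_eq_sum, ha]; ring
    simp_rw [hexp]
    refine (ev_exp_sum_uniform_le _ h τ g (fun a _ => ?_) (fun a _ => ?_) _ ?_).trans ?_
    · simp only [hg]; split_ifs <;> norm_num
    · simp only [hg]; split_ifs <;> norm_num
    · rw [abs_mul, abs_of_nonneg ha0]
      exact (mul_le_mul_of_nonneg_left hle (abs_nonneg t)).trans ht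
    · have hs : ∑ e ∈ C.offDiag, g e = nSum G C C := sum_offDiag_nonadj C
      rw [hs]
      apply ENNReal.ofReal_le_ofReal
      apply Real.exp_le_exp.2
      have hm := nSum_nonneg (G := G) C C
      have h3 : (t * a + (t * a) ^ 2) * (τ * (nSum G C C / C.offDiag.card)) =
          (t + t ^ 2 * a) * (3 / 2 * nSum G C C) := by
        have h5 : a * (τ * (nSum G C C / C.offDiag.card)) = 3 / 2 * nSum G C C := by
          rw [hoff, ha, hch]
          have : (C.card : ℝ) - 1 ≠ 0 := by linarith
          field_simp
        calc (t * a + (t * a) ^ 2) * (τ * (nSum G C C / C.offDiag.card))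
            = (t + t ^ 2 * a) * (a * (τ * (nSum G C C / C.offDiag.card))) := by ring
          _ = _ := by rw [h5]
      rw [h3]
      gcongr
  · rw [ev_pure]
    rw [Finset.not_nonempty_iff_eq_empty] at h
    have hz : nSum G C C = 0 := by rw [← sum_offDiag_nonadj, h, Finset.sum_empty]
    rw [hz]; simp

/-- Bound on the exponential moment of a cost estimate. -/
theorem ev_exp_costEstimate_le (hB : ∀ x ∈ B, x ≤ i) (hC : C ⊆ B) {b t : ℝ}
    (hlog : 0 < Real.log n) (hε : 0 < ε) (hε' : ε < 1 / 1000)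
    (hb : 3 * C.card * (ε ^ 3 / (10 * Real.log n)) ≤ b)
    (hb' : ∀ w ∈ B \ C, deg G i w * (ε ^ 3 / (10 * Real.log n)) ≤ b) (ht : |t| * b ≤ 1) :
    ev (costEstimate G ε i B C)
        (fun x => ENNReal.ofReal (Real.exp (t * ((1 - 37 * ε) * x)))) ≤
      ENNReal.ofReal (Real.exp (t * penalizedCost G ε i B C + t ^ 2 * b * sampledMean G i B C)) := by
  classical
  -- Samples at different nodes are independent, so the exponential moments multiply along the fold
  -- and the exponents add.
  have hfold : ∀ (l : List (Fin n)) (acc : ℝ),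
      ev (l.foldlM (fun (acc : ℝ) (w : Fin n) =>
        if w ∈ B \ C then do
          let x ← singletonCostEstimate G ε i B C w
          pure (acc + x)
        else (pure acc : PMF ℝ)) acc) (fun z => ENNReal.ofReal (Real.exp (t * z))) ≤
      ENNReal.ofReal (Real.exp (t * acc + (t + t ^ 2 * b) *
        (l.map fun w => if w ∈ B \ C then singletonMean G i B C w else 0).sum)) := by
    intro l
    induction l with
    | nil => intro acc; simp [ev_pure]
    | cons w l ih =>
      intro acc
      rw [List.foldlM_cons, ev_bind, List.map_cons, List.sum_cons]
      by_cases hw : w ∈ B \ C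
      · simp only [if_pos hw]
        rw [ev_bind]
        simp only [ev_pure]
        refine (ev_mono fun x => ih (acc + x)).trans ?_
        have e1 : ∀ x : ℝ, ENNReal.ofReal (Real.exp (t * (acc + x) + (t + t ^ 2 * b) *
            (l.map fun w => if w ∈ B \ C then singletonMean G i B C w else 0).sum)) =
            ENNReal.ofReal (Real.exp (t * acc + (t + t ^ 2 * b) *
            (l.map fun w => if w ∈ B \ C then singletonMean G i B C w else 0).sum)) *
            ENNReal.ofReal (Real.exp (t * x)) := by
          intro x
          rw [← ENNReal.ofReal_mul (Real.exp_nonneg _), ← Real.exp_add]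
          congr 2; ring
        simp_rw [e1]
        rw [ev_mul_left]
        refine (mul_le_mul_right (ev_exp_singletonCostEstimate_le hB w hlog hε (hb' w hw) ht) _).trans ?_
        rw [← ENNReal.ofReal_mul (Real.exp_nonneg _), ← Real.exp_add]
        apply le_of_eq; congr 2; ring
      · simp only [if_neg hw]
        rw [ev_pure, zero_add]
        exact ih acc
  unfold costEstimate
  rw [ev_bind]
  simp only [ev_bind, ev_pure]
  set base : ℝ := ∑ w ∈ C, (deg G i w : ℝ) - 2 * (C.card.choose 2 : ℝ) + 9 * ε * C.card with hbase
  have h37 : (1 - 37 * ε) ≠ 0 := by linarith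
  have e2 : ∀ y z : ℝ, ENNReal.ofReal (Real.exp (t * ((1 - 37 * ε) * (((∑ w ∈ C, (deg G i w : ℝ))
      - 2 * (C.card.choose 2 : ℝ) + 3 * y + z + 9 * ε * (C.card : ℝ)) / (1 - 37 * ε))))) =
      ENNReal.ofReal (Real.exp (t * base)) * ENNReal.ofReal (Real.exp (t * (3 * y))) *
        ENNReal.ofReal (Real.exp (t * z)) := by
    intro y z
    rw [← ENNReal.ofReal_mul (Real.exp_nonneg _), ← Real.exp_add,
      ← ENNReal.ofReal_mul (Real.exp_nonneg _), ← Real.exp_add, mul_div_cancel₀ _ h37]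
    congr 2; rw [hbase]; ring
  simp_rw [e2, ev_mul_left]
  have h1 := hfold (List.finRange n) 0
  rw [← Fin.sum_univ_def, ← Finset.sum_filter] at h1
  have h2 : (Finset.univ.filter fun w => w ∈ B \ C) = B \ C := by ext; simp
  rw [h2] at h1
  refine (ev_mono fun y => mul_le_mul_right h1 _).trans ?_
  rw [ev_mul_right, ev_mul_left]
  refine (mul_le_mul_left (mul_le_mul_right
    (ev_exp_inClusterCostEstimate_le hlog hε hb ht) _) _).trans ?_
  rw [← ENNReal.ofReal_mul (Real.exp_nonneg _), ← Real.exp_add,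
      ← ENNReal.ofReal_mul (Real.exp_nonneg _), ← Real.exp_add]
  apply le_of_eq; congr 2
  have hch : (C.card.choose 2 : ℝ) = C.card * (C.card - 1) / 2 := Nat.cast_choose_two ℝ _
  rw [penalizedCost, breakCost_eq_estimate hC, hbase, hch]
  unfold sampledMean
  ring

end estimate


/-! ### Comparing two level sets -/

section comparison
variable {n : ℕ} {G : SimpleGraph (Fin n)} {ε : ℝ} {i : Fin n} {B C C' : Finset (Fin n)}

/-- `b` bounds the weight of every sample in the estimates of the costs of `C` and `C'`. -/
def SampleWeightLe (G : SimpleGraph (Fin n)) (ε : ℝ) (i : Fin n) (B C : Finset (Fin n)) (b : ℝ) :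
    Prop :=
  3 * C.card * (ε ^ 3 / (10 * Real.log n)) ≤ b ∧
    ∀ w ∈ B \ C, deg G i w * (ε ^ 3 / (10 * Real.log n)) ≤ b

/-- The probability that the estimate of the worse set comes out smaller. -/
theorem ev_estimates_reversed_le (hB : ∀ x ∈ B, x ≤ i) (hC : C ⊆ B) (hC' : C' ⊆ B)
    (hlog : 0 < Real.log n) (hε : 0 < ε) (hε' : ε < 1 / 1000) {b : ℝ} (hb0 : 0 < b)
    (hb : SampleWeightLe G ε i B C b) (hb' : SampleWeightLe G ε i B C' b)
    (h : penalizedCost G ε i B C < penalizedCost G ε i B C') :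
    ev (costEstimate G ε i B C) (fun x => ev (costEstimate G ε i B C')
      (fun x' => open Classical in if x' ≤ x then 1 else 0)) ≤
    ENNReal.ofReal (Real.exp (-((penalizedCost G ε i B C' - penalizedCost G ε i B C) ^ 2 /
      (12 * b * (penalizedCost G ε i B C + penalizedCost G ε i B C'))))) := by
  classical
  set F := penalizedCost G ε i B C with hF
  set F' := penalizedCost G ε i B C' with hF'
  have hFf : breakCost G i B C ≤ F := by
    rw [hF, penalizedCost]; have : 0 ≤ 9 * ε * C.card := by positivity
    linarith
  have hFf' : breakCost G i B C' ≤ F' := by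
    rw [hF', penalizedCost]; have : 0 ≤ 9 * ε * C'.card := by positivity
    linarith
  have hf0 := breakCost_nonneg (G := G) hB hC
  have hf0' := breakCost_nonneg (G := G) hB hC'
  have hM := sampledMean_le (G := G) hB hC
  have hM' := sampledMean_le (G := G) hB hC'
  have hT : 0 < F + F' := by linarith
  -- Chernoff parameter: it maximises `t (F' - F) - 3 t² b (F + F')`, where `3 (F + F')` bounds the
  -- two sampled means.
  set t := (F' - F) / (6 * b * (F + F')) with ht
  have ht0 : 0 ≤ t := div_nonneg (by linarith) (by positivity)
  have htb : t * b ≤ 1 := by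
    rw [ht, div_mul_eq_mul_div, div_le_one (by positivity)]
    nlinarith
  have htabs : |t| * b ≤ 1 := by rwa [abs_of_nonneg ht0]
  have htabs' : |(-t)| * b ≤ 1 := by rwa [abs_neg]
  have h37 : 0 < 1 - 37 * ε := by linarith
  have hind : ∀ x x' : ℝ, (if x' ≤ x then (1 : ℝ≥0∞) else 0) ≤
      ENNReal.ofReal (Real.exp (t * ((1 - 37 * ε) * x))) *
        ENNReal.ofReal (Real.exp ((-t) * ((1 - 37 * ε) * x'))) := by
    intro x x'
    split_ifs with hx
    · rw [← ENNReal.ofReal_mul (Real.exp_nonneg _), ← Real.exp_add]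
      rw [ENNReal.one_le_ofReal]
      apply Real.one_le_exp
      have : 0 ≤ t * ((1 - 37 * ε) * (x - x')) :=
        mul_nonneg ht0 (mul_nonneg h37.le (by linarith))
      linarith
    · exact zero_le
  refine (ev_mono fun x => ev_mono fun x' => hind x x').trans ?_
  simp_rw [ev_mul_left]
  rw [ev_mul_right]
  refine (mul_le_mul' (ev_exp_costEstimate_le hB hC hlog hε hε' hb.1 hb.2 htabs)
    (ev_exp_costEstimate_le hB hC' hlog hε hε' hb'.1 hb'.2 htabs')).trans ?_
  rw [← ENNReal.ofReal_mul (Real.exp_nonneg _), ← Real.exp_add]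
  apply ENNReal.ofReal_le_ofReal
  apply Real.exp_le_exp.2
  have e1 : (F' - F) ^ 2 / (12 * b * (F + F')) = t * (F' - F) - t ^ 2 * b * (3 * (F + F')) := by
    rw [ht]; field_simp; ring
  rw [e1]
  have e2 : t ^ 2 * b * sampledMean G i B C ≤ t ^ 2 * b * (3 * F) := by gcongr; linarith
  have e3 : t ^ 2 * b * sampledMean G i B C' ≤ t ^ 2 * b * (3 * F') := by gcongr; linarith
  rw [← hF, ← hF', neg_sq]
  linarith

theorem le_add_mul_ite {a b : ℝ≥0∞} (P : Prop) [Decidable P] :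
    (if P then a else b) ≤ b + (a - b) * (if P then 1 else 0) := by
  split_ifs
  · rw [mul_one]; exact le_add_tsub
  · simp

/-- Comparison in which the current set is the better one. -/
theorem ev_costComparison_le_current (hB : ∀ x ∈ B, x ≤ i) (hC : C ⊆ B) (hC' : C' ⊆ B)
    (hlog : 0 < Real.log n) (hε : 0 < ε) (hε' : ε < 1 / 1000) {b : ℝ} (hb0 : 0 < b)
    (hb : SampleWeightLe G ε i B C b) (hb' : SampleWeightLe G ε i B C' b)
    (h : penalizedCost G ε i B C < penalizedCost G ε i B C') (Φ : Finset (Fin n) → ℝ≥0∞) :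
    ev (costComparison G ε i B C' C) Φ ≤ Φ C + (Φ C' - Φ C) *
    ENNReal.ofReal (Real.exp (-((penalizedCost G ε i B C' - penalizedCost G ε i B C) ^ 2 /
      (12 * b * (penalizedCost G ε i B C + penalizedCost G ε i B C'))))) := by
  classical
  unfold costComparison
  simp only [ev_bind, ev_pure]
  have hswap : ev (costEstimate G ε i B C') (fun x' => ev (costEstimate G ε i B C) (fun x =>
      (if x' ≤ x then (1 : ℝ≥0∞) else 0))) = ev (costEstimate G ε i B C) (fun x =>
      ev (costEstimate G ε i B C') (fun x' => if x' ≤ x then 1 else 0)) := by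
    unfold ev
    simp_rw [← ENNReal.tsum_mul_left]
    rw [ENNReal.tsum_comm]
    congr 1; ext x; congr 1; ext x'; ring
  have hle := ev_estimates_reversed_le hB hC hC' hlog hε hε' hb0 hb hb' h
  calc _ ≤ ev (costEstimate G ε i B C') (fun x' => ev (costEstimate G ε i B C) (fun x =>
      Φ C + (Φ C' - Φ C) * (if x' ≤ x then 1 else 0))) := by
        refine ev_mono fun x' => ev_mono fun x => ?_
        rw [apply_ite Φ]
        refine (le_add_mul_ite _).trans ?_
        gcongr
        split_ifs with h1 h2
        · exact le_rfl
        · exact absurd h1.le h2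
        · exact zero_le
        · exact le_rfl
    _ ≤ _ := by
        simp_rw [ev_add, ev_const, ev_mul_left]
        rw [hswap]
        gcongr

/-- Comparison in which the new set is the better one. -/
theorem ev_costComparison_le_new (hB : ∀ x ∈ B, x ≤ i) (hC : C ⊆ B) (hC' : C' ⊆ B)
    (hlog : 0 < Real.log n) (hε : 0 < ε) (hε' : ε < 1 / 1000) {b : ℝ} (hb0 : 0 < b)
    (hb : SampleWeightLe G ε i B C b) (hb' : SampleWeightLe G ε i B C' b)
    (h : penalizedCost G ε i B C < penalizedCost G ε i B C') (Φ : Finset (Fin n) → ℝ≥0∞) :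
    ev (costComparison G ε i B C C') Φ ≤ Φ C + (Φ C' - Φ C) *
    ENNReal.ofReal (Real.exp (-((penalizedCost G ε i B C' - penalizedCost G ε i B C) ^ 2 /
      (12 * b * (penalizedCost G ε i B C + penalizedCost G ε i B C'))))) := by
  classical
  unfold costComparison
  simp only [ev_bind, ev_pure]
  have hle := ev_estimates_reversed_le hB hC hC' hlog hε hε' hb0 hb hb' h
  calc _ ≤ ev (costEstimate G ε i B C) (fun x => ev (costEstimate G ε i B C') (fun x' =>
      Φ C + (Φ C' - Φ C) * (if x' ≤ x then 1 else 0))) := by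
        refine ev_mono fun x => ev_mono fun x' => ?_
        by_cases h1 : x < x'
        · rw [if_pos h1, if_neg (not_le.2 h1)]; simp
        · rw [if_neg h1, if_pos (not_lt.1 h1), mul_one]; exact le_add_tsub
    _ ≤ _ := by
        simp_rw [ev_add, ev_const, ev_mul_left]
        gcongr

theorem mem_support_costComparison {D : Finset (Fin n)}
    (h : D ∈ (costComparison G ε i B C C').support) : D = C ∨ D = C' := by
  classical
  unfold costComparison at h
  obtain ⟨x, _, h⟩ := mem_support_bind h
  obtain ⟨x', _, h⟩ := mem_support_bind h
  rw [mem_support_pure h]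
  split_ifs <;> simp

theorem ev_costComparison_self (Φ : Finset (Fin n) → ℝ≥0∞) :
    ev (costComparison G ε i B C C) Φ = Φ C := by
  rw [ev_congr_support (g := fun _ => Φ C), ev_const]
  intro D hD
  rcases mem_support_costComparison hD with rfl | rfl <;> rfl

/-! ### The loop over the thresholds -/

theorem atLeast_subset (t : ℝ) : atLeast G i B t ⊆ B := Finset.filter_subset _ _

theorem atLeast_anti {s t : ℝ} (h : s ≤ t) : atLeast G i B t ⊆ atLeast G i B s := by
  intro x hx
  simp only [atLeast, Finset.mem_filter] at hx ⊢
  exact ⟨hx.1, h.trans hx.2⟩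

theorem atLeast_zero : atLeast G i B 0 = B := by
  simp [atLeast]

/-- `C` is a level set for a threshold that is not above the `j`-th one. -/
def IsLevel (G : SimpleGraph (Fin n)) (ε : ℝ) (i : Fin n) (B : Finset (Fin n)) (j : ℕ)
    (C : Finset (Fin n)) : Prop :=
  ∃ t ≤ (1 + ε) ^ j, C = atLeast G i B t

theorem IsLevel.subset {j : ℕ} (h : IsLevel G ε i B j C) : C ⊆ B := by
  obtain ⟨t, _, rfl⟩ := h; exact atLeast_subset t

/-- Thresholds increase along the loop, so the current set always has a threshold no larger than
that of the next candidate; a candidate is therefore contained in the current set. -/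
theorem isLevel_step (hε : 0 < ε) {j : ℕ} (h : IsLevel G ε i B j C) {D : Finset (Fin n)}
    (hD : D ∈ (costComparison G ε i B (atLeast G i B ((1 + ε) ^ j)) C).support) :
    IsLevel G ε i B (j + 1) D := by
  have hle : (1 + ε) ^ j ≤ (1 + ε) ^ (j + 1) := pow_le_pow_right₀ (by linarith) (Nat.le_succ j)
  rcases mem_support_costComparison hD with rfl | rfl
  · exact ⟨_, hle, rfl⟩
  · obtain ⟨t, ht, rfl⟩ := h
    exact ⟨t, ht.trans hle, rfl⟩

theorem isLevel_foldlM (hε : 0 < ε) (m : ℕ) : ∀ (a : ℕ) (C : Finset (Fin n)),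
    IsLevel G ε i B a C → ∀ D ∈ ((List.range' a m).foldlM
      (fun C j => costComparison G ε i B (atLeast G i B ((1 + ε) ^ j)) C) C).support,
    IsLevel G ε i B (a + m) D := by
  induction m with
  | zero => intro a C h D hD; rw [mem_support_pure hD]; exact h
  | succ m ih =>
    intro a C h D hD
    rw [List.range'_succ, List.foldlM_cons] at hD
    obtain ⟨C1, h1, hD⟩ := mem_support_bind hD
    have := ih (a + 1) C1 (isLevel_step hε h h1) D hD
    rwa [show a + (m + 1) = a + 1 + m by ring]

theorem ev_foldlM_range'_le (hε : 0 < ε) (Φ : Finset (Fin n) → ℝ≥0∞) (c : ℝ≥0∞)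
    (hstep : ∀ j C, IsLevel G ε i B j C →
      ev (costComparison G ε i B (atLeast G i B ((1 + ε) ^ j)) C) Φ ≤ c * Φ C) (m : ℕ) :
    ∀ (a : ℕ) (C : Finset (Fin n)), IsLevel G ε i B a C → ev ((List.range' a m).foldlM
      (fun C j => costComparison G ε i B (atLeast G i B ((1 + ε) ^ j)) C) C) Φ ≤ c ^ m * Φ C := by
  induction m with
  | zero => intro a C _; simp [ev_pure]
  | succ m ih =>
    intro a C h
    rw [List.range'_succ, List.foldlM_cons, ev_bind]
    refine (ev_mono_support fun C1 h1 => ih (a + 1) C1 (isLevel_step hε h h1)).trans ?_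
    rw [ev_mul_left, pow_succ, mul_assoc]
    gcongr
    exact hstep a C h

/-- A function that grows by a factor of at most `c` in every comparison, and is at most `β` after
one of the comparisons, is at most about `β` in the end. -/
theorem ev_breakCluster_le_of_step (hε : 0 < ε) (Φ : Finset (Fin n) → ℝ≥0∞) (c β : ℝ≥0∞)
    (hc : 1 ≤ c) (hstep : ∀ j C, IsLevel G ε i B j C →
      ev (costComparison G ε i B (atLeast G i B ((1 + ε) ^ j)) C) Φ ≤ c * Φ C)
    {j₀ : ℕ} (hj₀ : j₀ < ⌈Real.logb (1 + ε) n⌉₊ + 1) (hβ : ∀ C, IsLevel G ε i B j₀ C →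
      ev (costComparison G ε i B (atLeast G i B ((1 + ε) ^ j₀)) C) Φ ≤ β) :
    ev (breakCluster G ε i B) Φ ≤ c ^ (⌈Real.logb (1 + ε) n⌉₊ + 1) * β := by
  unfold breakCluster
  -- The loop is split at comparison `j₀`. What happened before is irrelevant, since `hβ` holds for
  -- every level set; afterwards each comparison costs a factor `c`.
  obtain ⟨m, hm⟩ : ∃ m, ⌈Real.logb (1 + ε) n⌉₊ + 1 = j₀ + (m + 1) :=
    ⟨⌈Real.logb (1 + ε) n⌉₊ - j₀, by omega⟩
  rw [hm, List.range_eq_range', ← List.range'_append_1, List.foldlM_append, ev_bind]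
  refine le_trans (ev_mono_support (g := fun _ => c ^ (j₀ + (m + 1)) * β) ?_) (ev_const _ _).le
  intro C hC
  have hC' := isLevel_foldlM hε j₀ 0 B
    ⟨0, by simp, atLeast_zero.symm⟩ C hC
  rw [zero_add] at hC' ⊢
  rw [List.range'_succ, List.foldlM_cons, ev_bind]
  refine (ev_mono_support fun C1 h1 => ev_foldlM_range'_le hε Φ c hstep m (j₀ + 1) C1
    (isLevel_step hε hC' h1)).trans ?_
  rw [ev_mul_left]
  refine mul_le_mul' (pow_le_pow_right₀ hc (by omega)) (hβ C hC')

end comparison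


/-! ### The expected cost after breaking a cluster: the general bound -/

section drift
variable {n : ℕ} {G : SimpleGraph (Fin n)} {ε : ℝ} {i v : Fin n} {B C C' : Finset (Fin n)}

/-- `B` consists of arrived nodes and is a star with centre `v`. -/
structure IsStar (G : SimpleGraph (Fin n)) (i v : Fin n) (B : Finset (Fin n)) : Prop where
  center_mem : v ∈ B
  le : ∀ x ∈ B, x ≤ i
  adj : ∀ z ∈ B, z = v ∨ G.Adj z v

/-- Total degree of the nodes of `B` outside `C`. -/
noncomputable def outerDeg (G : SimpleGraph (Fin n)) (i : Fin n) (B C : Finset (Fin n)) : ℝ :=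
  ∑ w ∈ B \ C, (deg G i w : ℝ)

theorem outerDeg_nonneg : 0 ≤ outerDeg G i B C := Finset.sum_nonneg fun _ _ => by positivity

theorem outerDeg_anti (h : C' ⊆ C) : outerDeg G i B C ≤ outerDeg G i B C' :=
  Finset.sum_le_sum_of_subset_of_nonneg (Finset.sdiff_subset_sdiff le_rfl h)
    fun _ _ _ => by positivity

theorem eSum_le_sum_deg {C : Finset (Fin n)} (hB : ∀ x ∈ C, x ≤ i) :
    eSum G C C ≤ ∑ w ∈ C, (deg G i w : ℝ) := Finset.sum_le_sum fun _ _ => sum_adjW_le_deg hB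

/-- A decomposition into terms that are nonnegative when `B` has arrived: edges leaving `B`, degrees
outside `C`, non-edges inside `C`, edges leaving `C`. The lower bounds on the cost come from
dropping some of them. -/
theorem two_mul_breakCost (hC : C ⊆ B) : 2 * breakCost G i B C =
    (∑ w ∈ B, (deg G i w : ℝ) - eSum G B B) + outerDeg G i B C + nSum G C C +
      ∑ w ∈ C, ((deg G i w : ℝ) - ∑ y ∈ C, adjW G w y) := by
  rw [Finset.sum_sub_distrib, breakCost, val, outerDeg]
  change _ = _ + _ + _ + (_ - eSum G C C)
  have := Finset.sum_sdiff (f := fun w => (deg G i w : ℝ)) hC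
  linarith

theorem deg_sub_nonneg (hB : ∀ x ∈ B, x ≤ i) (hC : C ⊆ B) (w : Fin n) :
    0 ≤ (deg G i w : ℝ) - ∑ y ∈ C, adjW G w y :=
  sub_nonneg.2 (sum_adjW_le_deg fun x hx => hB x (hC hx))

theorem outerDeg_add_le (hB : ∀ x ∈ B, x ≤ i) (hC : C ⊆ B) :
    outerDeg G i B C + nSum G C C ≤ 2 * breakCost G i B C := by
  have h1 := two_mul_breakCost (G := G) (i := i) hC
  have h2 := eSum_le_sum_deg (G := G) hB
  have h3 : 0 ≤ ∑ w ∈ C, ((deg G i w : ℝ) - ∑ y ∈ C, adjW G w y) :=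
    Finset.sum_nonneg fun w _ => deg_sub_nonneg hB hC w
  linarith

/-- For `w` in `C` the degree beyond `|C|` consists of edges leaving `C`; for `w` outside `C` the
whole degree is part of `outerDeg`. Both occur in `two_mul_breakCost`. -/
theorem deg_le_card_add (hB : ∀ x ∈ B, x ≤ i) (hC : C ⊆ B) {w : Fin n} (hw : w ∈ B) :
    (deg G i w : ℝ) ≤ C.card + 2 * breakCost G i B C := by
  have h1 := two_mul_breakCost (G := G) (i := i) hC
  have h2 := eSum_le_sum_deg (G := G) hB
  have h3 : 0 ≤ ∑ w ∈ C, ((deg G i w : ℝ) - ∑ y ∈ C, adjW G w y) :=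
    Finset.sum_nonneg fun w _ => deg_sub_nonneg hB hC w
  have h4 := nSum_nonneg (G := G) C C
  have h5 := outerDeg_nonneg (G := G) (i := i) (B := B) (C := C)
  by_cases hwC : w ∈ C
  · have h6 : (deg G i w : ℝ) - ∑ y ∈ C, adjW G w y ≤
        ∑ w ∈ C, ((deg G i w : ℝ) - ∑ y ∈ C, adjW G w y) :=
      Finset.single_le_sum (f := fun w => (deg G i w : ℝ) - ∑ y ∈ C, adjW G w y)
        (fun w _ => deg_sub_nonneg hB hC w) hwC
    have h7 : ∑ y ∈ C, adjW G w y ≤ C.card := by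
      calc ∑ y ∈ C, adjW G w y ≤ ∑ y ∈ C, (1 : ℝ) := Finset.sum_le_sum fun y _ => adjW_le_one w y
        _ = C.card := by simp
    linarith
  · have h6 : (deg G i w : ℝ) ≤ outerDeg G i B C :=
      Finset.single_le_sum (f := fun w => (deg G i w : ℝ)) (fun _ _ => by positivity)
        (Finset.mem_sdiff.2 ⟨hw, hwC⟩)
    have : (0 : ℝ) ≤ C.card := by positivity
    linarith

theorem one_le_deg (h : IsStar G i v B) (hcard : 2 ≤ B.card) {w : Fin n} (hw : w ∈ B) :
    (1 : ℝ) ≤ deg G i w := by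
  have key : ∃ y ∈ B, G.Adj w y := by
    rcases h.adj w hw with rfl | hadj
    · obtain ⟨y, hy, hne⟩ := Finset.exists_mem_ne hcard w
      exact ⟨y, hy, ((h.adj y hy).resolve_left hne).symm⟩
    · exact ⟨v, h.center_mem, hadj⟩
  obtain ⟨y, hy, hadj⟩ := key
  have h1 : 0 < (nbrs G i w).card := Finset.card_pos.2 ⟨y, by
    simp only [nbrs, Finset.mem_filter, Finset.mem_univ, true_and]
    exact ⟨h.le y hy, hadj⟩⟩
  exact_mod_cast h1

theorem card_le_card_add_outerDeg (h : IsStar G i v B) (hcard : 2 ≤ B.card) (hC : C ⊆ B) :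
    (B.card : ℝ) ≤ C.card + outerDeg G i B C := by
  have h1 : ((B \ C).card : ℝ) ≤ outerDeg G i B C := by
    calc ((B \ C).card : ℝ) = ∑ w ∈ B \ C, (1 : ℝ) := by simp
      _ ≤ _ := Finset.sum_le_sum fun w hw => one_le_deg h hcard (Finset.mem_sdiff.1 hw).1
  have h2 := Finset.card_sdiff_add_card_eq_card hC
  have h3 : ((B \ C).card : ℝ) + C.card = B.card := by exact_mod_cast h2
  linarith

theorem breakCost_le_penalizedCost (hε : 0 < ε) : breakCost G i B C ≤ penalizedCost G ε i B C := by
  have : 0 ≤ 9 * ε * C.card := by positivity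
  unfold penalizedCost; linarith

/-- This is what the penalty `9 ε |C|` is for: cluster size and degrees, hence the weight of each
sample, are at most `O(1/ε)` times the quantity being estimated. -/
theorem le_penalizedCost_div (hB : ∀ x ∈ B, x ≤ i) (hC : C ⊆ B) (hε : 0 < ε) (hε' : ε < 1 / 1000) :
    (C.card : ℝ) ≤ penalizedCost G ε i B C / (9 * ε) ∧
    ∀ w ∈ B, (deg G i w : ℝ) ≤ penalizedCost G ε i B C / (8 * ε) := by
  have hf := breakCost_nonneg (G := G) hB hC
  have h1 : (C.card : ℝ) * (9 * ε) ≤ penalizedCost G ε i B C := by unfold penalizedCost; linarith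
  refine ⟨by rwa [le_div_iff₀ (by positivity)], fun w hw => ?_⟩
  rw [le_div_iff₀ (by positivity)]
  have h2 := deg_le_card_add (G := G) hB hC hw
  have h3 := breakCost_le_penalizedCost (G := G) (i := i) (B := B) (C := C) hε
  have h4 : (deg G i w : ℝ) * (8 * ε) ≤ (C.card + 2 * breakCost G i B C) * (8 * ε) := by gcongr
  nlinarith

/-- From `x ≤ exp x` at `x = g² / y`. It bounds the expected loss, gap times probability, of a
comparison that goes wrong. -/
theorem mul_exp_neg_le {g y : ℝ} (hg : 0 < g) (hy : 0 < y) :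
    g * Real.exp (-(g ^ 2 / y)) ≤ y / g := by
  have hx : 0 < g ^ 2 / y := by positivity
  have h1 : g ^ 2 / y ≤ Real.exp (g ^ 2 / y) := by
    have := Real.add_one_le_exp (g ^ 2 / y); linarith
  rw [Real.exp_neg, ← div_eq_mul_inv, div_le_div_iff₀ (Real.exp_pos _) hg]
  have : g ^ 2 = y * (g ^ 2 / y) := by field_simp
  calc g * g = y * (g ^ 2 / y) := by rw [← this]; ring
    _ ≤ _ := by gcongr

/-- The potential that dominates the cost in the loop over the thresholds. -/
noncomputable def potential (G : SimpleGraph (Fin n)) (ε : ℝ) (i : Fin n) (B C : Finset (Fin n)) :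
    ℝ :=
  penalizedCost G ε i B C - ε * outerDeg G i B C + 5 * ε * nSum G C C

/-- Since `outerDeg + nSum` is at most twice the cost, the corrections in `potential` change the
penalized cost only by a factor `1 + O(ε)`. -/
theorem le_potential (hB : ∀ x ∈ B, x ≤ i) (hC : C ⊆ B) (hε : 0 < ε) :
    (1 - 2 * ε) * penalizedCost G ε i B C ≤ potential G ε i B C := by
  have h1 := outerDeg_add_le (G := G) hB hC
  have h2 := nSum_nonneg (G := G) C C
  have h3 := breakCost_le_penalizedCost (G := G) (i := i) (B := B) (C := C) hε
  have h4 : ε * outerDeg G i B C ≤ ε * (2 * penalizedCost G ε i B C) := by gcongr; linarith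
  have h5 : 0 ≤ 5 * ε * nSum G C C := by positivity
  unfold potential; linarith

theorem potential_le (hB : ∀ x ∈ B, x ≤ i) (hC : C ⊆ B) (hε : 0 < ε) :
    potential G ε i B C ≤ (1 + 10 * ε) * penalizedCost G ε i B C := by
  have h1 := outerDeg_add_le (G := G) hB hC
  have h2 := outerDeg_nonneg (G := G) (i := i) (B := B) (C := C)
  have h3 := breakCost_le_penalizedCost (G := G) (i := i) (B := B) (C := C) hε
  have h4 : ε * nSum G C C ≤ ε * (2 * penalizedCost G ε i B C) := by gcongr; linarith
  have h5 : 0 ≤ ε * outerDeg G i B C := by positivity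
  unfold potential; linarith

/-- If shrinking `C` to `C'` costs little, then `C` contains many more non-edges than `C'`. -/
theorem nSum_sub_ge (hC : C' ⊂ C) (hε : 0 < ε) (hε' : ε < 1 / 1000)
    (h1 : penalizedCost G ε i B C < penalizedCost G ε i B C')
    (h2 : penalizedCost G ε i B C' - penalizedCost G ε i B C ≤ ε * C.card) :
    (C.card : ℝ) / 5 ≤ nSum G C C - nSum G C' C' := by
  have hlt := Finset.card_lt_card hC
  have hv := val_eq (G := G) C
  have hv' := val_eq (G := G) C'
  have hk0 : (0 : ℝ) ≤ C'.card := by positivity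
  have hk : (C'.card : ℝ) + 1 ≤ C.card := by exact_mod_cast hlt
  unfold penalizedCost breakCost at h1 h2
  rw [hv, hv'] at h1 h2
  -- Dropping a single node saves its penalty and destroys no edge, which contradicts `h1`.
  by_cases hc1 : C.card = 1
  · have hc0 : C'.card = 0 := by omega
    have e0 : nSum G C' C' = 0 := by
      rw [Finset.card_eq_zero] at hc0; simp [hc0, nSum]
    have e1 : 0 ≤ nSum G C C := nSum_nonneg C C
    have e2 : nSum G C C = 0 := by
      obtain ⟨a, rfl⟩ := Finset.card_eq_one.1 hc1
      simp [nSum, nonW_self]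
    rw [hc1, hc0, e0, e2] at h1
    norm_num at h1
    linarith
  · have hk2 : (2 : ℝ) ≤ C.card := by
      have : 2 ≤ C.card := by omega
      exact_mod_cast this
    set k : ℝ := (C.card : ℝ)
    set k' : ℝ := (C'.card : ℝ)
    -- Shrinking a clique of size `k` loses at least `k - 1` edges, at least `k / 2` for `k ≥ 2`. As
    -- shrinking `C` costs at most `ε k`, lost non-edges must make up for it.
    have e3 : (k - 1) ≤ (k * (k - 1) - k' * (k' - 1)) / 2 := by
      have : 0 ≤ (k - k' - 1) * (k + k' - 2) := mul_nonneg (by linarith) (by linarith)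
      nlinarith
    nlinarith

theorem exists_max_deg_of_atLeast_ssubset {s t : ℝ} (h : atLeast G i B t ⊂ atLeast G i B s) :
    ∃ w₀ ∈ atLeast G i B s \ atLeast G i B t, ∀ w ∈ B \ atLeast G i B t, deg G i w ≤ deg G i w₀ := by
  have hne : (atLeast G i B s \ atLeast G i B t).Nonempty := Finset.sdiff_nonempty.2 h.2
  obtain ⟨w₀, hw₀, hmax⟩ := Finset.exists_max_image _ (fun w => deg G i w) hne
  refine ⟨w₀, hw₀, fun w hw => ?_⟩
  by_cases hws : w ∈ atLeast G i B s
  · exact hmax w (Finset.mem_sdiff.2 ⟨hws, (Finset.mem_sdiff.1 hw).2⟩)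
  · have h1 := (Finset.mem_sdiff.1 hw).1
    have h2 := (Finset.mem_sdiff.1 hw₀).1
    simp only [atLeast, Finset.mem_filter] at hws h2
    have h3 : (deg G i w : ℝ) < s := by
      by_contra h'; exact hws ⟨h1, not_lt.1 h'⟩
    exact_mod_cast (h3.le.trans h2.2)

theorem log_ge (hn : 2 ≤ n) : (0.69 : ℝ) ≤ Real.log n := by
  have h1 := Real.log_two_gt_d9
  have h2 : Real.log 2 ≤ Real.log n :=
    Real.log_le_log (by norm_num) (by exact_mod_cast hn)
  linarith

theorem sampleWeightLe_of_le {m q : ℝ} (hq : 0 ≤ q)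
    (hlog : 0 < Real.log n) (hQ : q = ε ^ 3 / Real.log n)
    (h1 : (C.card : ℝ) ≤ m) (h2 : ∀ w ∈ B \ C, (deg G i w : ℝ) ≤ m) (hm : 0 ≤ m) :
    SampleWeightLe G ε i B C (0.3 * q * m) := by
  have e : ε ^ 3 / (10 * Real.log n) = q / 10 := by rw [hQ]; field_simp
  refine ⟨?_, fun w hw => ?_⟩
  · rw [e]
    have : q * C.card ≤ q * m := by gcongr
    linarith
  · rw [e]
    have : q * deg G i w ≤ q * m := mul_le_mul_of_nonneg_left (h2 w hw) hq
    have : 0 ≤ q * m := by positivity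
    linarith

set_option maxHeartbeats 600000 in
/-- One comparison increases the potential by little. -/
theorem ev_potential_step (hB : ∀ x ∈ B, x ≤ i) (hn : 2 ≤ n) (hε : 0 < ε) (hε' : ε < 1 / 1000)
    {j : ℕ} (hC : IsLevel G ε i B j C) :
    ev (costComparison G ε i B (atLeast G i B ((1 + ε) ^ j)) C)
      (fun D => ENNReal.ofReal (potential G ε i B D)) ≤
    ENNReal.ofReal (1 + 9 * ε ^ 2 / Real.log n) * ENNReal.ofReal (potential G ε i B C) := by
  have hlog := log_ge hn
  have hlog0 : 0 < Real.log n := by linarith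
  have hCB := hC.subset
  obtain ⟨t, ht, rfl⟩ := hC
  set A := atLeast G i B ((1 + ε) ^ j) with hA
  set C := atLeast G i B t with hCdef
  have hAB : A ⊆ B := atLeast_subset _
  have hAC : A ⊆ C := atLeast_anti ht
  have hφ := le_potential (G := G) hB hCB hε
  set F := penalizedCost G ε i B C with hF
  set F' := penalizedCost G ε i B A with hF'
  have hfC := breakCost_nonneg (G := G) hB hCB
  have hF0 : 0 ≤ F := hfC.trans (breakCost_le_penalizedCost hε)
  have hφ0 : 0 ≤ potential G ε i B C := le_trans (mul_nonneg (by linarith) hF0) hφ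
  have hone : (1 : ℝ≥0∞) ≤ ENNReal.ofReal (1 + 9 * ε ^ 2 / Real.log n) := by
    rw [ENNReal.one_le_ofReal]
    have : 0 ≤ 9 * ε ^ 2 / Real.log n := by positivity
    linarith
  rcases eq_or_ne A C with heq | hne
  · rw [heq, ev_costComparison_self]
    exact le_mul_of_one_le_left zero_le hone
  have hss : A ⊂ C := lt_of_le_of_ne hAC hne
  have hns : nSum G A A ≤ nSum G C C := nSum_mono hAC hAC
  have hod : outerDeg G i B C ≤ outerDeg G i B A := outerDeg_anti hAC
  have hod' : ε * outerDeg G i B C ≤ ε * outerDeg G i B A := by gcongr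
  have hns' : ε * nSum G A A ≤ ε * nSum G C C := by gcongr
  have hpot : potential G ε i B A - potential G ε i B C = (F' - F) -
      ε * (outerDeg G i B A - outerDeg G i B C) - 5 * ε * (nSum G C C - nSum G A A) := by
    unfold potential; rw [← hF, ← hF']; ring
  -- If `A` is no worse, neither outcome raises the potential: passing to the smaller set also
  -- increases `outerDeg` and decreases `nSum`.
  rcases le_or_gt F' F with hle | hgt
  · refine le_trans (ev_mono_support (g := fun _ => ENNReal.ofReal (potential G ε i B C)) ?_) ?_
    · intro D hD
      rcases mem_support_costComparison hD with rfl | rfl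
      · apply ENNReal.ofReal_le_ofReal; linarith
      · exact le_rfl
    · rw [ev_const]; exact le_mul_of_one_le_left zero_le hone
  obtain ⟨w₀, hw₀, hmax⟩ := exists_max_deg_of_atLeast_ssubset hss
  set dm : ℝ := (deg G i w₀ : ℝ) with hdm
  set k : ℝ := (C.card : ℝ) with hk
  set m := max k dm with hm
  have hk1 : 1 ≤ k := by
    have : 0 < C.card := lt_of_le_of_lt (Nat.zero_le _) (Finset.card_lt_card hss)
    simp only [hk]; exact_mod_cast this
  have hm1 : 1 ≤ m := hk1.trans (le_max_left _ _)
  set q := ε ^ 3 / Real.log n with hq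
  have hq0 : 0 < q := by positivity
  have hcardA : (A.card : ℝ) ≤ k := by simp only [hk]; exact_mod_cast Finset.card_le_card hAC
  have hwA : ∀ w ∈ B \ A, (deg G i w : ℝ) ≤ m := fun w hw =>
    le_trans (by simp only [hdm]; exact_mod_cast hmax w hw) (le_max_right _ _)
  have hwtA : SampleWeightLe G ε i B A (0.3 * q * m) :=
    sampleWeightLe_of_le hq0.le hlog0 hq (hcardA.trans (le_max_left _ _)) hwA (by linarith)
  have hwtC : SampleWeightLe G ε i B C (0.3 * q * m) :=
    sampleWeightLe_of_le hq0.le hlog0 hq (le_max_left _ _)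
      (fun w hw => hwA w (Finset.sdiff_subset_sdiff le_rfl hAC hw)) (by linarith)
  refine (ev_costComparison_le_current hB hCB hAB hlog0 hε hε' (by positivity) hwtC hwtA hgt _).trans ?_
  rw [← ENNReal.ofReal_sub _ hφ0, ← hF, ← hF']
  have hgap : 0 < F' - F := by linarith
  -- A gap up to `ε m` is paid for by the potential: if the largest dropped degree is the maximum,
  -- `outerDeg` grows by it; if `|C|` is the maximum, `nSum` falls by `|C| / 5`, with coefficient `5
  -- ε`. A larger gap makes the error so unlikely that `mul_exp_neg_le` bounds the expected loss.
  by_cases hclose : F' - F ≤ ε * m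
  · have hzero : potential G ε i B A - potential G ε i B C ≤ 0 := by
      rcases le_total k dm with hkd | hkd
      · rw [max_eq_right hkd] at hm
        have h1 : dm ≤ outerDeg G i B A - outerDeg G i B C := by
          have hsub : B \ C ⊆ B \ A := Finset.sdiff_subset_sdiff le_rfl hAC
          unfold outerDeg
          rw [← Finset.sum_sdiff hsub, add_sub_cancel_right]
          refine Finset.single_le_sum (f := fun w => (deg G i w : ℝ)) (fun _ _ => by positivity) ?_
          rw [Finset.mem_sdiff] at hw₀ ⊢
          rw [Finset.mem_sdiff, Finset.mem_sdiff]
          exact ⟨⟨hCB hw₀.1, hw₀.2⟩, fun h => h.2 hw₀.1⟩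
        have h2 : ε * dm ≤ ε * (outerDeg G i B A - outerDeg G i B C) := by gcongr
        rw [hm] at hclose
        nlinarith
      · rw [max_eq_left hkd] at hm
        rw [hm] at hclose
        have h1 := nSum_sub_ge hss hε hε' hgt hclose
        have h2 : ε * (k / 5) ≤ ε * (nSum G C C - nSum G A A) := by gcongr
        nlinarith
    rw [ENNReal.ofReal_of_nonpos hzero, zero_mul, add_zero]
    exact le_mul_of_one_le_left zero_le hone
  · push Not at hclose
    have hy : 0 < 12 * (0.3 * q * m) * (F + F') := by
      apply mul_pos (by positivity); linarith
    have h1 := mul_exp_neg_le hgap hy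
    have hmF : m ≤ F / (8 * ε) := by
      obtain ⟨a1, a2⟩ := le_penalizedCost_div (G := G) hB hCB hε hε'
      refine max_le (a1.trans ?_) (a2 w₀ (hCB (Finset.mem_sdiff.1 hw₀).1))
      gcongr; norm_num
    have h2 : 12 * (0.3 * q * m) * (F + F') / (F' - F) ≤ 7.65 * (q / ε) * F := by
      have e1 : 12 * (0.3 * q * m) * (F + F') / (F' - F) =
          3.6 * q * m + 7.2 * q * F * (m / (F' - F)) := by field_simp; ring
      have e2 : m / (F' - F) ≤ 1 / ε := by
        rw [div_le_div_iff₀ hgap hε]; linarith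
      rw [e1]
      calc 3.6 * q * m + 7.2 * q * F * (m / (F' - F))
          ≤ 3.6 * q * (F / (8 * ε)) + 7.2 * q * F * (1 / ε) := by gcongr
        _ = _ := by field_simp; ring
    have h3 : q / ε = ε ^ 2 / Real.log n := by rw [hq]; field_simp
    have h4 : 7.65 * (q / ε) * F ≤ 9 * ε ^ 2 / Real.log n * potential G ε i B C := by
      rw [h3]
      have : 0 ≤ ε ^ 2 / Real.log n := by positivity
      have e3 : 7.65 * F ≤ 9 * potential G ε i B C := by nlinarith
      calc 7.65 * (ε ^ 2 / Real.log n) * F = (ε ^ 2 / Real.log n) * (7.65 * F) := by ring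
        _ ≤ (ε ^ 2 / Real.log n) * (9 * potential G ε i B C) := by gcongr
        _ = _ := by ring
    rw [← ENNReal.ofReal_mul' (Real.exp_nonneg _),
      ← ENNReal.ofReal_mul (p := 1 + 9 * ε ^ 2 / Real.log n) (by positivity), add_mul, one_mul,
      ENNReal.ofReal_add hφ0 (by positivity)]
    refine add_le_add le_rfl (ENNReal.ofReal_le_ofReal ?_)
    have h5 : potential G ε i B A - potential G ε i B C ≤ F' - F := by rw [hpot]; nlinarith
    have h6 := mul_le_mul_of_nonneg_right h5 (Real.exp_nonneg
      (-((F' - F) ^ 2 / (12 * (0.3 * q * m) * (F + F')))))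
    exact h6.trans (h1.trans (h2.trans h4))

set_option maxHeartbeats 600000 in
/-- After the comparison with `A` the potential is not much larger than the cost of `A`. -/
theorem ev_potential_at (h : IsStar G i v B) (hn : 2 ≤ n) (hε : 0 < ε) (hε' : ε < 1 / 1000)
    {j : ℕ} (hC : IsLevel G ε i B j C)
    (hpos : 0 < breakCost G i B (atLeast G i B ((1 + ε) ^ j))) (hcard : 2 ≤ B.card) :
    ev (costComparison G ε i B (atLeast G i B ((1 + ε) ^ j)) C)
      (fun D => ENNReal.ofReal (potential G ε i B D)) ≤
    ENNReal.ofReal ((1 + 13 * ε) * penalizedCost G ε i B (atLeast G i B ((1 + ε) ^ j))) := by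
  have hB := h.le
  have hlog := log_ge hn
  have hlog0 : 0 < Real.log n := by linarith
  have hCB := hC.subset
  have hstep := ev_potential_step hB hn hε hε' hC
  set A := atLeast G i B ((1 + ε) ^ j) with hA
  have hAB : A ⊆ B := atLeast_subset _
  set F := penalizedCost G ε i B A with hF
  have hF0 : 0 < F := hpos.trans_le (breakCost_le_penalizedCost hε)
  rcases eq_or_ne A C with heq | hne
  · rw [← heq, ev_costComparison_self]
    apply ENNReal.ofReal_le_ofReal
    refine (potential_le hB hAB hε).trans ?_
    rw [← hF]; gcongr; linarith
  have hinv : 1 / Real.log n ≤ 1.45 := by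
    rw [div_le_iff₀ hlog0]; linarith
  -- A current set that is already as good as `A` is covered by the one-step drift. Otherwise `A`
  -- ought to win, and only the expected loss of a wrong comparison has to be bounded.
  rcases le_or_gt (penalizedCost G ε i B C) F with hle | hgt
  · refine hstep.trans ?_
    rw [← ENNReal.ofReal_mul (by positivity)]
    apply ENNReal.ofReal_le_ofReal
    have h1 : 9 * ε ^ 2 / Real.log n ≤ ε := by
      have : 9 * ε ^ 2 / Real.log n = 9 * ε ^ 2 * (1 / Real.log n) := by ring
      rw [this]
      calc 9 * ε ^ 2 * (1 / Real.log n) ≤ 9 * ε ^ 2 * 1.45 := by gcongr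
        _ ≤ ε := by nlinarith
    calc (1 + 9 * ε ^ 2 / Real.log n) * potential G ε i B C
        ≤ (1 + 9 * ε ^ 2 / Real.log n) * ((1 + 10 * ε) * F) := by
          gcongr
          refine (potential_le hB hCB hε).trans ?_
          gcongr
      _ ≤ (1 + ε) * ((1 + 10 * ε) * F) := by gcongr
      _ ≤ (1 + 13 * ε) * F := by rw [← mul_assoc]; gcongr; nlinarith
  set F' := penalizedCost G ε i B C with hF'
  set q := ε ^ 3 / Real.log n with hq
  have hq0 : 0 < q := by positivity
  obtain ⟨a1, a2⟩ := le_penalizedCost_div (G := G) hB hAB hε hε'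
  -- The sample weights for the unknown worse set `C` must be bounded by the cost of `A` alone. This
  -- works because `C ⊆ B`, and the nodes of `B` outside `A` have degree at least 1 and so are
  -- counted in that cost.
  have hBF : (B.card : ℝ) ≤ F / (8 * ε) := by
    have h1 := card_le_card_add_outerDeg h hcard hAB
    have h2 := outerDeg_add_le (G := G) hB hAB
    have h3 := nSum_nonneg (G := G) A A
    have h4 := breakCost_le_penalizedCost (G := G) (i := i) (B := B) (C := A) hε
    rw [le_div_iff₀ (by positivity)] at a1 ⊢
    nlinarith
  have hcardle : ∀ {D : Finset (Fin n)}, D ⊆ B → (D.card : ℝ) ≤ F / (8 * ε) := fun hD =>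
    le_trans (by exact_mod_cast Finset.card_le_card hD) hBF
  have hwt : ∀ {D : Finset (Fin n)}, D ⊆ B → SampleWeightLe G ε i B D (0.3 * q * (F / (8 * ε))) :=
    fun {D} hD => sampleWeightLe_of_le hq0.le hlog0 hq (hcardle hD)
      (fun w hw => a2 w (Finset.mem_sdiff.1 hw).1) (by positivity)
  have hmono : ∀ D ∈ (costComparison G ε i B A C).support, ENNReal.ofReal (potential G ε i B D) ≤
      ENNReal.ofReal (1 + 10 * ε) * ENNReal.ofReal (penalizedCost G ε i B D) := by
    intro D hD
    rw [← ENNReal.ofReal_mul (by positivity)]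
    apply ENNReal.ofReal_le_ofReal
    rcases mem_support_costComparison hD with rfl | rfl
    · exact potential_le hB hAB hε
    · exact potential_le hB hCB hε
  refine (ev_mono_support hmono).trans ?_
  rw [ev_mul_left]
  have hnew := ev_costComparison_le_new hB hAB hCB hlog0 hε hε' (by positivity) (hwt hAB) (hwt hCB) hgt
    (fun D => ENNReal.ofReal (penalizedCost G ε i B D))
  rw [← hF, ← hF', ← ENNReal.ofReal_sub _ hF0.le, ← ENNReal.ofReal_mul' (Real.exp_nonneg _),
    ] at hnew
  have hgap : 0 < F' - F := by linarith
  have hloss : (F' - F) * Real.exp (-((F' - F) ^ 2 / (12 * (0.3 * q * (F / (8 * ε))) * (F + F')))) ≤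
      2 * ε * F := by
    by_cases hclose : F' - F ≤ ε * F
    · have : Real.exp (-((F' - F) ^ 2 / (12 * (0.3 * q * (F / (8 * ε))) * (F + F')))) ≤ 1 := by
        apply Real.exp_le_one_iff.2
        have : 0 ≤ (F' - F) ^ 2 / (12 * (0.3 * q * (F / (8 * ε))) * (F + F')) := by
          apply div_nonneg (by positivity); apply mul_nonneg (by positivity); linarith
        linarith
      have h5 : 0 ≤ ε * F := by positivity
      calc _ ≤ (F' - F) * 1 := by gcongr
        _ ≤ _ := by linarith
    · push Not at hclose
      have hy : 0 < 12 * (0.3 * q * (F / (8 * ε))) * (F + F') := by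
        apply mul_pos (by positivity); linarith
      refine (mul_exp_neg_le hgap hy).trans ?_
      have e1 : 12 * (0.3 * q * (F / (8 * ε))) * (F + F') / (F' - F) =
          (0.45 * (q / ε) * F) + 0.9 * (q / ε) * F * (F / (F' - F)) := by field_simp; ring
      have e2 : F / (F' - F) ≤ 1 / ε := by
        rw [div_le_div_iff₀ hgap hε]; linarith
      have e3 : q / ε = ε ^ 2 * (1 / Real.log n) := by rw [hq]; field_simp
      rw [e1]
      have e4 : q / ε ≤ ε ^ 2 * 1.45 := by rw [e3]; gcongr
      calc 0.45 * (q / ε) * F + 0.9 * (q / ε) * F * (F / (F' - F))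
          ≤ 0.45 * (q / ε) * F + 0.9 * (q / ε) * F * (1 / ε) := by gcongr
        _ ≤ 0.45 * (ε ^ 2 * 1.45) * F + 0.9 * (ε ^ 2 * 1.45) * F * (1 / ε) := by gcongr
        _ = (0.6525 * ε ^ 2 + 1.305 * ε) * F := by field_simp; ring
        _ ≤ 2 * ε * F := by gcongr; nlinarith
  calc ENNReal.ofReal (1 + 10 * ε) * _
      ≤ ENNReal.ofReal (1 + 10 * ε) * (ENNReal.ofReal F + ENNReal.ofReal (2 * ε * F)) := by
        gcongr
        refine hnew.trans ?_
        gcongr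
    _ = ENNReal.ofReal ((1 + 10 * ε) * (F + 2 * ε * F)) := by
        rw [← ENNReal.ofReal_add hF0.le (by positivity), ← ENNReal.ofReal_mul (by positivity)]
    _ ≤ _ := by
        apply ENNReal.ofReal_le_ofReal
        have : (1 + 10 * ε) * (F + 2 * ε * F) = ((1 + 10 * ε) * (1 + 2 * ε)) * F := by ring
        rw [this]; gcongr; nlinarith

/-- The number of comparisons. -/
theorem numComparisons_le (hn : 2 ≤ n) (hε : 0 < ε) (hε' : ε < 1 / 1000) :
    ((⌈Real.logb (1 + ε) n⌉₊ + 1 : ℕ) : ℝ) ≤ 1.1 * (Real.log n / ε) := by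
  have hlog := log_ge hn
  have h1 : Real.logb (1 + ε) n ≤ 1.001 * (Real.log n / ε) := by
    unfold Real.logb
    have h2 : ε / (1 + ε) ≤ Real.log (1 + ε) := by
      have := Real.one_sub_inv_le_log_of_pos (show 0 < 1 + ε by linarith)
      have e : ε / (1 + ε) = 1 - (1 + ε)⁻¹ := by field_simp; ring
      rw [e]; exact this
    have h3 : 0 < ε / (1 + ε) := by positivity
    calc Real.log n / Real.log (1 + ε) ≤ Real.log n / (ε / (1 + ε)) := by gcongr
      _ = (1 + ε) * (Real.log n / ε) := by field_simp
      _ ≤ _ := by gcongr; linarith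
  have h4 : (⌈Real.logb (1 + ε) n⌉₊ : ℝ) < Real.logb (1 + ε) n + 1 := by
    apply Nat.ceil_lt_add_one
    exact Real.logb_nonneg (by linarith) (by exact_mod_cast (by omega : 1 ≤ n))
  have h5 : 690 ≤ Real.log n / ε := by
    rw [le_div_iff₀ hε]; nlinarith
  push_cast
  linarith

theorem exp_le_of_le {x : ℝ} (hx0 : 0 ≤ x) (hx : x ≤ 1) : Real.exp x ≤ 1 + x + x ^ 2 := by
  have := (abs_le.1 (Real.abs_exp_sub_one_sub_id_le (x := x) (by rwa [abs_of_nonneg hx0]))).2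
  linarith

/-- At most `1.1 log n / ε` comparisons, each with factor `1 + 9ε² / log n`, amount to `exp (9.9 ε)
≤ 1 + 11 ε`, multiplied by the bound right after comparison `j`. -/
theorem ev_penalizedCost_le (h : IsStar G i v B) (hn : 2 ≤ n) (hε : 0 < ε) (hε' : ε < 1 / 1000)
    {j : ℕ} (hj : j < ⌈Real.logb (1 + ε) n⌉₊ + 1)
    (hpos : 0 < breakCost G i B (atLeast G i B ((1 + ε) ^ j))) (hcard : 2 ≤ B.card) :
    ev (breakCluster G ε i B) (fun D => ENNReal.ofReal (potential G ε i B D)) ≤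
      ENNReal.ofReal ((1 + 26 * ε) * penalizedCost G ε i B (atLeast G i B ((1 + ε) ^ j))) := by
  have hlog := log_ge hn
  have hlog0 : 0 < Real.log n := by linarith
  set F := penalizedCost G ε i B (atLeast G i B ((1 + ε) ^ j)) with hF
  have hF0 : 0 < F := hpos.trans_le (breakCost_le_penalizedCost hε)
  refine (ev_breakCluster_le_of_step hε (fun D => ENNReal.ofReal (potential G ε i B D))
    (ENNReal.ofReal (1 + 9 * ε ^ 2 / Real.log n)) (ENNReal.ofReal ((1 + 13 * ε) * F)) ?_
    (fun j C hC => ev_potential_step h.le hn hε hε' hC) hj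
    (fun C hC => ev_potential_at h hn hε hε' hC hpos hcard)).trans ?_
  · rw [ENNReal.one_le_ofReal]
    have : 0 ≤ 9 * ε ^ 2 / Real.log n := by positivity
    linarith
  · rw [← ENNReal.ofReal_pow (by positivity), ← ENNReal.ofReal_mul (by positivity)]
    apply ENNReal.ofReal_le_ofReal
    have h1 : (1 + 9 * ε ^ 2 / Real.log n) ^ (⌈Real.logb (1 + ε) n⌉₊ + 1) ≤ 1 + 11 * ε := by
      calc (1 + 9 * ε ^ 2 / Real.log n) ^ (⌈Real.logb (1 + ε) n⌉₊ + 1)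
          ≤ (Real.exp (9 * ε ^ 2 / Real.log n)) ^ (⌈Real.logb (1 + ε) n⌉₊ + 1) := by
            gcongr
            have := Real.add_one_le_exp (9 * ε ^ 2 / Real.log n); linarith
        _ = Real.exp (((⌈Real.logb (1 + ε) n⌉₊ + 1 : ℕ) : ℝ) * (9 * ε ^ 2 / Real.log n)) := by
            rw [Real.exp_nat_mul]
        _ ≤ Real.exp (9.9 * ε) := by
            apply Real.exp_le_exp.2
            calc ((⌈Real.logb (1 + ε) n⌉₊ + 1 : ℕ) : ℝ) * (9 * ε ^ 2 / Real.log n)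
                ≤ 1.1 * (Real.log n / ε) * (9 * ε ^ 2 / Real.log n) := by
                  gcongr; exact numComparisons_le hn hε hε'
              _ = _ := by field_simp; ring
        _ ≤ 1 + 9.9 * ε + (9.9 * ε) ^ 2 := exp_le_of_le (by positivity) (by linarith)
        _ ≤ _ := by nlinarith
    calc (1 + 9 * ε ^ 2 / Real.log n) ^ (⌈Real.logb (1 + ε) n⌉₊ + 1) * ((1 + 13 * ε) * F)
        ≤ (1 + 11 * ε) * ((1 + 13 * ε) * F) := by gcongr
      _ = ((1 + 11 * ε) * (1 + 13 * ε)) * F := by ring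
      _ ≤ _ := by gcongr; nlinarith

end drift


section nearlyPerfect
variable {n : ℕ} {G : SimpleGraph (Fin n)} {ε : ℝ} {i v : Fin n} {A B C : Finset (Fin n)}

/-! ### The expected cost after breaking a cluster: nearly perfect clusters -/

theorem exists_int_breakCost (C : Finset (Fin n)) : ∃ z : ℤ, 2 * breakCost G i B C = z := by
  have he : ∀ S T, ∃ m : ℤ, eSum G S T = m := by
    classical
    intro S T
    refine ⟨∑ x ∈ S, ∑ y ∈ T, if G.Adj x y then 1 else 0, ?_⟩
    unfold eSum adjW; push_cast; rfl
  have hn : ∀ S T, ∃ m : ℤ, nSum G S T = m := by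
    classical
    intro S T
    refine ⟨∑ x ∈ S, ∑ y ∈ T, if x ≠ y ∧ ¬ G.Adj x y then 1 else 0, ?_⟩
    unfold nSum nonW; push_cast; rfl
  obtain ⟨a, ha⟩ := he B B
  obtain ⟨b, hb⟩ := he C C
  obtain ⟨c, hc⟩ := hn C C
  refine ⟨2 * (∑ w ∈ B, (deg G i w : ℤ)) - a + (c - b), ?_⟩
  unfold breakCost val
  rw [ha, hb, hc]; push_cast; ring

/-- Twice the cost is an integer. This later converts additive errors into multiplicative ones. -/
theorem half_le_breakCost (h : 0 < breakCost G i B C) : 1 / 2 ≤ breakCost G i B C := by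
  obtain ⟨z, hz⟩ := exists_int_breakCost (G := G) (i := i) (B := B) C
  have h1 : (0 : ℝ) < z := by rw [← hz]; linarith
  have h2 : 0 < z := by exact_mod_cast h1
  have h3 : (1 : ℝ) ≤ z := by exact_mod_cast h2
  linarith

theorem breakCost_le_sq : breakCost G i B C ≤ 2 * (n : ℝ) ^ 2 := by
  have hcard : ∀ S : Finset (Fin n), (S.card : ℝ) ≤ n := fun S => by
    have := Finset.card_le_univ S
    rw [Fintype.card_fin] at this
    exact_mod_cast this
  have h1 : ∑ w ∈ B, (deg G i w : ℝ) ≤ (n : ℝ) ^ 2 := by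
    calc ∑ w ∈ B, (deg G i w : ℝ) ≤ ∑ w ∈ B, (n : ℝ) :=
          Finset.sum_le_sum fun w _ => by exact_mod_cast (deg_lt i w).le
      _ = B.card * n := by simp
      _ ≤ n * n := mul_le_mul_of_nonneg_right (hcard B) (Nat.cast_nonneg n)
      _ = _ := by ring
  have h2 := eSum_nonneg (G := G) B B
  have h3 := eSum_nonneg (G := G) C C
  have h4 : nSum G C C ≤ (n : ℝ) ^ 2 := by
    have e1 : nSum G C C ≤ (C.card : ℝ) * (C.card - 1) := by
      rw [← eSum_add_nSum_self (G := G)]; linarith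
    have e2 := hcard C
    have e3 : (0 : ℝ) ≤ C.card := by positivity
    nlinarith
  unfold breakCost val
  have h5 : (0 : ℝ) ≤ (n : ℝ) ^ 2 := by positivity
  linarith

/-- `A` is nearly a clique with few edges to the rest of `B`, and has more than 10 nodes since its
cost is at least 1/2. Removing a node loses almost `|A|` edges; adding one creates almost `|A|`
non-edges, the edges gained being bounded by `outerDeg`. -/
theorem breakCost_sub_ge (hB : ∀ x ∈ B, x ≤ i) (hA : A ⊆ B) (hC : C ⊆ B)
    (hpos : 0 < breakCost G i B A) (hnear : 20 * breakCost G i B A < A.card)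
    (hcomp : C ⊂ A ∨ A ⊂ C) : 0.8 * (A.card : ℝ) ≤ breakCost G i B C - breakCost G i B A := by
  have hhalf := half_le_breakCost hpos
  have hod := outerDeg_add_le (G := G) hB hA
  have hod0 := outerDeg_nonneg (G := G) (i := i) (B := B) (C := A)
  have hns0 := nSum_nonneg (G := G) A A
  set k : ℝ := (A.card : ℝ) with hk
  set k' : ℝ := (C.card : ℝ) with hk'
  have hk0' : 0 ≤ k' := by positivity
  have hdiff : breakCost G i B C - breakCost G i B A = (val G C - val G A) / 2 := by
    unfold breakCost; ring
  rw [hdiff]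
  rcases hcomp with h | h
  · have hlt : k' + 1 ≤ k := by
      simp only [hk, hk']; exact_mod_cast Finset.card_lt_card h
    rw [val_eq, val_eq, ← hk, ← hk']
    have h1 := nSum_nonneg (G := G) C C
    have h2 : 0 ≤ (k - k' - 1) * (k + k' - 2) := mul_nonneg (by linarith) (by linarith)
    nlinarith
  · have hlt : k + 1 ≤ k' := by
      simp only [hk, hk']; exact_mod_cast Finset.card_lt_card h
    rw [val_eq', val_eq', ← hk, ← hk', eSum_split h.1]
    have h1 : eSum G (C \ A) (C \ A) + eSum G (C \ A) A ≤ outerDeg G i B A := by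
      rw [← eSum_union_right Finset.sdiff_disjoint]
      refine (Finset.sum_le_sum fun w _ => sum_adjW_le_deg (i := i) fun x hx => ?_).trans
        (Finset.sum_le_sum_of_subset_of_nonneg (Finset.sdiff_subset_sdiff hC le_rfl)
          fun _ _ _ => by positivity)
      rcases Finset.mem_union.1 hx with hx | hx
      · exact hB x (hC (Finset.mem_sdiff.1 hx).1)
      · exact hB x (hA hx)
    have h2 := eSum_nonneg (G := G) (C \ A) (C \ A)
    nlinarith

/-- The probability that a comparison of a nearly perfect cluster with another set goes wrong. -/
theorem nearlyPerfect_gap (h : IsStar G i v B) (hcard : 2 ≤ B.card) (hn : 2 ≤ n) (hε : 0 < ε)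
    (hε' : ε < 1 / 1000) (hA : A ⊆ B) (hC : C ⊆ B)
    (hpos : 0 < breakCost G i B A) (hnear : 20 * breakCost G i B A < A.card)
    (hcomp : C ⊂ A ∨ A ⊂ C) :
    penalizedCost G ε i B A < penalizedCost G ε i B C ∧ ∃ b, 0 < b ∧ SampleWeightLe G ε i B A b ∧
      SampleWeightLe G ε i B C b ∧
      Real.exp (-((penalizedCost G ε i B C - penalizedCost G ε i B A) ^ 2 /
        (12 * b * (penalizedCost G ε i B A + penalizedCost G ε i B C)))) ≤
        Real.exp (-(Real.log n / (6 * ε ^ 3))) := by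
  have hB := h.le
  have hlog := log_ge hn
  have hlog0 : 0 < Real.log n := by linarith
  have hsub := breakCost_sub_ge hB hA hC hpos hnear hcomp
  have hod := outerDeg_add_le (G := G) hB hA
  have hns0 := nSum_nonneg (G := G) A A
  have hBc := card_le_card_add_outerDeg (G := G) h hcard hA
  have hdeg : ∀ w ∈ B, (deg G i w : ℝ) ≤ A.card + 2 * breakCost G i B A := fun w hw =>
    deg_le_card_add hB hA hw
  set k : ℝ := (A.card : ℝ) with hk
  have hk0 : 0 < k := by linarith
  set q := ε ^ 3 / Real.log n with hq
  have hq0 : 0 < q := by positivity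
  have hCk : (C.card : ℝ) ≤ 1.1 * k := by
    have : (C.card : ℝ) ≤ B.card := by exact_mod_cast Finset.card_le_card hC
    linarith
  have hgap : 0.79 * k ≤ penalizedCost G ε i B C - penalizedCost G ε i B A := by
    unfold penalizedCost
    have : 0 ≤ 9 * ε * (C.card : ℝ) := by positivity
    rw [← hk]; nlinarith
  have hFA : penalizedCost G ε i B A ≤ 0.059 * k := by
    unfold penalizedCost; rw [← hk]; nlinarith
  have hFA0 : 0 < penalizedCost G ε i B A := by
    unfold penalizedCost; rw [← hk]; positivity
  set F := penalizedCost G ε i B A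
  set F' := penalizedCost G ε i B C
  refine ⟨by linarith, 0.3 * q * (1.1 * k), by positivity,
    sampleWeightLe_of_le hq0.le hlog0 hq (by rw [← hk]; linarith)
      (fun w hw => (hdeg w (Finset.mem_sdiff.1 hw).1).trans (by linarith)) (by positivity),
    sampleWeightLe_of_le hq0.le hlog0 hq hCk
      (fun w hw => (hdeg w (Finset.mem_sdiff.1 hw).1).trans (by linarith)) (by positivity), ?_⟩
  apply Real.exp_le_exp.2
  apply neg_le_neg
  have e1 : Real.log n / (6 * ε ^ 3) = 1 / (6 * q) := by rw [hq]; field_simp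
  rw [e1, div_le_div_iff₀ (by positivity) (by apply mul_pos (by positivity); linarith)]
  -- The cost of `A` is at most `0.059 k` and the gap at least `0.79 k`. With sample weight `0.33 q
  -- k`, the constant `12 * 0.33 * 1.15 = 4.554` stays below `6 * 0.79`.
  have e2 : F + F' ≤ 1.15 * (F' - F) := by linarith
  have e3 : 0 < F' - F := by linarith
  have e4 : 4.554 * k ≤ 6 * (F' - F) := by linarith
  calc 1 * (12 * (0.3 * q * (1.1 * k)) * (F + F'))
      ≤ 1 * (12 * (0.3 * q * (1.1 * k)) * (1.15 * (F' - F))) := by gcongr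
    _ = (4.554 * k) * (F' - F) * q := by ring
    _ ≤ (6 * (F' - F)) * (F' - F) * q :=
        mul_le_mul_of_nonneg_right (mul_le_mul_of_nonneg_right e4 e3.le) hq0.le
    _ = _ := by ring

theorem isLevel_comparable {j j' : ℕ} (hA : IsLevel G ε i B j A) (hC : IsLevel G ε i B j' C)
    (hne : C ≠ A) : C ⊂ A ∨ A ⊂ C := by
  obtain ⟨s, _, rfl⟩ := hA
  obtain ⟨t, _, rfl⟩ := hC
  rcases le_total s t with h | h
  · left; exact lt_of_le_of_ne (atLeast_anti h) hne
  · right; exact lt_of_le_of_ne (atLeast_anti h) hne.symm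

/-- The failure probability is a power of `n` with exponent of order `-1 / ε³`. It beats `n²` for
the worst cost and a further `n` for the number of comparisons, and what remains is `O(ε³)`, enough
to absorb the division by `ε`. -/
theorem nearlyPerfect_arith (hn : 2 ≤ n) (hε : 0 < ε) (hε' : ε < 1 / 1000) :
    (1 + 4 * (n : ℝ) ^ 2 * Real.exp (-(Real.log n / (6 * ε ^ 3)))) ^
      (⌈Real.logb (1 + ε) n⌉₊ + 1 + 1) ≤ 1 + 2 * ε := by
  have hlog := log_ge hn
  have hn0 : (0 : ℝ) < n := by exact_mod_cast (by omega : 0 < n)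
  have hJ := numComparisons_le hn hε hε'
  set δ := Real.exp (-(Real.log n / (6 * ε ^ 3))) with hδ
  have hδ0 : 0 < δ := Real.exp_pos _
  have hlogn : Real.log n ≤ n := (Real.log_le_sub_one_of_pos hn0).trans (by linarith)
  have hJ2 : ((⌈Real.logb (1 + ε) n⌉₊ + 1 + 1 : ℕ) : ℝ) ≤ 2.2 * (n / ε) := by
    have h1 : 1.1 * (Real.log n / ε) ≤ 1.1 * (n / ε) := by gcongr
    have h2 : 1 ≤ 1.1 * (Real.log n / ε) := by
      have : 690 ≤ Real.log n / ε := by rw [le_div_iff₀ hε]; nlinarith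
      linarith
    push_cast at hJ ⊢; linarith
  have hδn : (n : ℝ) ^ 3 * δ ≤ 10.2 * ε ^ 3 := by
    have e1 : (n : ℝ) ^ 3 = Real.exp (3 * Real.log n) := by
      rw [show (3 : ℝ) * Real.log n = ((3 : ℕ) : ℝ) * Real.log n by norm_num, Real.exp_nat_mul,
        Real.exp_log hn0]
    rw [e1, hδ, ← Real.exp_add]
    have e2 : 3 * Real.log n + -(Real.log n / (6 * ε ^ 3)) ≤ -(0.69 / (7 * ε ^ 3)) := by
      have h3 : 126 * ε ^ 3 ≤ 1 := by
        have : ε ^ 3 ≤ (1 / 1000) ^ 3 := by gcongr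
        linarith
      have e3 : 3 * Real.log n + -(Real.log n / (6 * ε ^ 3)) =
          - (Real.log n / (7 * ε ^ 3)) - Real.log n * (1 - 126 * ε ^ 3) / (42 * ε ^ 3) := by
        field_simp; ring
      have e4 : 0 ≤ Real.log n * (1 - 126 * ε ^ 3) / (42 * ε ^ 3) := by
        apply div_nonneg _ (by positivity)
        apply mul_nonneg <;> linarith
      have e5 : 0.69 / (7 * ε ^ 3) ≤ Real.log n / (7 * ε ^ 3) := by gcongr
      linarith
    refine (Real.exp_le_exp.2 e2).trans ?_
    have h4 : 0 < 0.69 / (7 * ε ^ 3) := by positivity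
    have h5 : 0.69 / (7 * ε ^ 3) ≤ Real.exp (0.69 / (7 * ε ^ 3)) := by
      have := Real.add_one_le_exp (0.69 / (7 * ε ^ 3)); linarith
    rw [Real.exp_neg]
    calc (Real.exp (0.69 / (7 * ε ^ 3)))⁻¹ ≤ (0.69 / (7 * ε ^ 3))⁻¹ := by gcongr
      _ = 7 * ε ^ 3 / 0.69 := inv_div _ _
      _ ≤ _ := by rw [div_le_iff₀ (by norm_num)]; have : 0 < ε ^ 3 := by positivity
                  linarith
  calc (1 + 4 * (n : ℝ) ^ 2 * δ) ^ (⌈Real.logb (1 + ε) n⌉₊ + 1 + 1)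
      ≤ (Real.exp (4 * (n : ℝ) ^ 2 * δ)) ^ (⌈Real.logb (1 + ε) n⌉₊ + 1 + 1) := by
        gcongr
        have := Real.add_one_le_exp (4 * (n : ℝ) ^ 2 * δ); linarith
    _ = Real.exp (((⌈Real.logb (1 + ε) n⌉₊ + 1 + 1 : ℕ) : ℝ) * (4 * (n : ℝ) ^ 2 * δ)) := by
        rw [Real.exp_nat_mul]
    _ ≤ Real.exp ε := by
        apply Real.exp_le_exp.2
        calc ((⌈Real.logb (1 + ε) n⌉₊ + 1 + 1 : ℕ) : ℝ) * (4 * (n : ℝ) ^ 2 * δ)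
            ≤ 2.2 * (n / ε) * (4 * (n : ℝ) ^ 2 * δ) := by gcongr
          _ = 8.8 / ε * ((n : ℝ) ^ 3 * δ) := by ring
          _ ≤ 8.8 / ε * (10.2 * ε ^ 3) := by gcongr
          _ = 89.76 * ε ^ 2 := by field_simp; ring
          _ ≤ ε := by nlinarith
    _ ≤ 1 + ε + ε ^ 2 := exp_le_of_le hε.le (by linarith)
    _ ≤ _ := by nlinarith

/-- The function `Ψ` charges the trivial bound `2n²` for every set other than `A`, so one comparison
adds at most `2n²δ` in expectation. As the cost of `A` is at least 1/2, this is a factor `1 + 4n²δ`.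
-/
theorem ev_breakCost_nearlyPerfect (h : IsStar G i v B) (hcard : 2 ≤ B.card) (hn : 2 ≤ n)
    (hε : 0 < ε) (hε' : ε < 1 / 1000) {j : ℕ} (hj : j < ⌈Real.logb (1 + ε) n⌉₊ + 1)
    (hpos : 0 < breakCost G i B (atLeast G i B ((1 + ε) ^ j)))
    (hnear : 20 * breakCost G i B (atLeast G i B ((1 + ε) ^ j)) <
      (atLeast G i B ((1 + ε) ^ j)).card) :
    ev (breakCluster G ε i B) (fun D => ENNReal.ofReal (breakCost G i B (B ∩ D))) ≤
      ENNReal.ofReal ((1 + 2 * ε) * breakCost G i B (atLeast G i B ((1 + ε) ^ j))) := by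
  classical
  have hlog0 : 0 < Real.log n := by have := log_ge hn; linarith
  set A := atLeast G i B ((1 + ε) ^ j) with hA
  have hAB : A ⊆ B := atLeast_subset _
  have hAl : IsLevel G ε i B j A := ⟨_, le_rfl, rfl⟩
  set f := breakCost G i B A with hf
  have hhalf := half_le_breakCost hpos
  set δ := Real.exp (-(Real.log n / (6 * ε ^ 3))) with hδ
  have hδ0 : 0 < δ := Real.exp_pos _
  set W : ℝ := 2 * (n : ℝ) ^ 2 with hW
  have hW0 : 0 ≤ W := by positivity
  set Ψ : Finset (Fin n) → ℝ≥0∞ := fun D => ENNReal.ofReal f + if D = A then 0 else ENNReal.ofReal W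
    with hΨ
  have hΨA : Ψ A = ENNReal.ofReal f := by simp [hΨ]
  have hΨne : ∀ {D}, D ≠ A → Ψ D = ENNReal.ofReal f + ENNReal.ofReal W := fun hD => by simp [hΨ, hD]
  have hΨle : ∀ D, Ψ D ≤ ENNReal.ofReal f + ENNReal.ofReal W := fun D => by
    simp only [hΨ]; gcongr; split_ifs <;> simp
  have hsubW : ∀ D, Ψ D - Ψ A ≤ ENNReal.ofReal W := fun D => by
    rw [hΨA]; exact tsub_le_iff_left.2 (hΨle D)
  have hkey : ENNReal.ofReal f + ENNReal.ofReal W * ENNReal.ofReal δ ≤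
      ENNReal.ofReal (1 + 4 * (n : ℝ) ^ 2 * δ) * ENNReal.ofReal f := by
    rw [← ENNReal.ofReal_mul hW0, ← ENNReal.ofReal_add hpos.le (by positivity),
      ← ENNReal.ofReal_mul (by positivity)]
    apply ENNReal.ofReal_le_ofReal
    have : 0 ≤ (n : ℝ) ^ 2 * δ := by positivity
    rw [hW]; nlinarith
  have hc : (1 : ℝ≥0∞) ≤ ENNReal.ofReal (1 + 4 * (n : ℝ) ^ 2 * δ) := by
    rw [ENNReal.one_le_ofReal]; have : 0 ≤ 4 * (n : ℝ) ^ 2 * δ := by positivity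
    linarith
  have hmain := ev_breakCluster_le_of_step hε Ψ (ENNReal.ofReal (1 + 4 * (n : ℝ) ^ 2 * δ))
    (ENNReal.ofReal (1 + 4 * (n : ℝ) ^ 2 * δ) * ENNReal.ofReal f) hc (G := G) (i := i) (B := B) ?_ hj ?_
  · refine (ev_mono fun D => ?_).trans (hmain.trans ?_)
    · by_cases hD : D = A
      · rw [hD, hΨA, Finset.inter_eq_right.2 hAB]
      · rw [hΨne hD, ← ENNReal.ofReal_add hpos.le hW0]
        apply ENNReal.ofReal_le_ofReal
        have := breakCost_le_sq (G := G) (i := i) (B := B) (C := B ∩ D)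
        linarith
    · rw [← mul_assoc, ← pow_succ, ← ENNReal.ofReal_pow (by positivity),
        ← ENNReal.ofReal_mul (by positivity)]
      apply ENNReal.ofReal_le_ofReal
      gcongr
      exact nearlyPerfect_arith hn hε hε'
  · intro j' C hC
    by_cases hCA : C = A
    · subst hCA
      by_cases heq : atLeast G i B ((1 + ε) ^ j') = A
      · rw [heq, ev_costComparison_self]; exact le_mul_of_one_le_left zero_le hc
      · have hl : IsLevel G ε i B j' (atLeast G i B ((1 + ε) ^ j')) := ⟨_, le_rfl, rfl⟩
        obtain ⟨hlt, b, hb0, hb, hb', hexp⟩ := nearlyPerfect_gap h hcard hn hε hε' hAB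
          (atLeast_subset _) hpos hnear (isLevel_comparable hAl hl heq)
        refine (ev_costComparison_le_current h.le hAB (atLeast_subset _) hlog0 hε hε' hb0 hb hb' hlt
          Ψ).trans ?_
        rw [hΨA]
        refine le_trans ?_ hkey
        gcongr
        have := hsubW (atLeast G i B ((1 + ε) ^ j'))
        rwa [hΨA] at this
    · refine le_trans (ev_mono (g := fun _ => Ψ C) fun D => ?_) ?_
      · rw [hΨne hCA]; exact hΨle D
      · rw [ev_const]; exact le_mul_of_one_le_left zero_le hc
  · intro C hC
    by_cases hCA : C = A
    · rw [hCA, ev_costComparison_self, hΨA]; exact le_mul_of_one_le_left zero_le hc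
    · obtain ⟨hlt, b, hb0, hb, hb', hexp⟩ := nearlyPerfect_gap h hcard hn hε hε' hAB
        hC.subset hpos hnear (isLevel_comparable hAl hC hCA)
      refine (ev_costComparison_le_new h.le hAB hC.subset hlog0 hε hε' hb0 hb hb' hlt Ψ).trans ?_
      rw [hΨA]
      refine le_trans ?_ hkey
      gcongr
      have := hsubW C
      rwa [hΨA] at this

/-! ### Isolated cliques -/

/-- With `C` empty every sampled edge counts 1/2 or 1, according to whether it leads into `B` or out
of it. The bound thus holds for every outcome of the samples. -/
theorem singletonCostEstimate_ge (hlog : 0 < Real.log n) (hε : 0 < ε) {w : Fin n} {x : ℝ}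
    (hx : x ∈ (singletonCostEstimate G ε i B ∅ w).support) : (deg G i w : ℝ) / 2 ≤ x := by
  unfold singletonCostEstimate at hx
  split_ifs at hx with h
  · obtain ⟨l, hl, hx⟩ := mem_support_bind hx
    rw [mem_support_pure hx]
    set η : ℕ := ⌈10 * Real.log n / ε ^ 3⌉₊ with hη
    have hη0 : (0 : ℝ) < η := lt_of_lt_of_le (by positivity) (Nat.le_ceil _)
    have hlen := (mem_support_iid hl).1
    rw [mul_countP_add]
    have h1 : ∀ l : List (Fin n), (l.length : ℝ) / 2 ≤ (l.map fun x =>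
        (if x ∈ B \ ∅ then (1 : ℝ) else 0) / 2 + if x ∉ B then (1 : ℝ) else 0).sum := by
      intro l
      induction l with
      | nil => simp
      | cons a l ih =>
        rw [List.map_cons, List.sum_cons, List.length_cons]
        push_cast
        by_cases ha : a ∈ B <;> simp [ha] at ih ⊢ <;> linarith
    have h2 := h1 l
    rw [hlen] at h2
    calc (deg G i w : ℝ) / 2 = deg G i w / η * (η / 2) := by field_simp
      _ ≤ _ := by gcongr
  · rw [mem_support_pure hx]
    rw [Finset.not_nonempty_iff_eq_empty] at h
    simp [deg, h]

theorem costEstimate_empty_ge (hlog : 0 < Real.log n) (hε : 0 < ε) (hε' : ε < 1 / 1000) {x : ℝ}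
    (hx : x ∈ (costEstimate G ε i B ∅).support) :
    (∑ w ∈ B, (deg G i w : ℝ) / 2) / (1 - 37 * ε) ≤ x := by
  classical
  unfold costEstimate at hx
  obtain ⟨y, hy, hx⟩ := mem_support_bind hx
  obtain ⟨z, hz, hx⟩ := mem_support_bind hx
  rw [mem_support_pure hx]
  have hy0 : y = 0 := by
    unfold inClusterCostEstimate at hy
    simp only [Finset.offDiag_empty, Finset.not_nonempty_empty] at hy
    exact mem_support_pure hy
  have hfold : ∀ (l : List (Fin n)) (acc z : ℝ), z ∈ (l.foldlM (fun (acc : ℝ) (w : Fin n) =>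
        if w ∈ B \ ∅ then do
          let x ← singletonCostEstimate G ε i B ∅ w
          pure (acc + x)
        else (pure acc : PMF ℝ)) acc).support →
      acc + (l.map fun w => if w ∈ B \ ∅ then (deg G i w : ℝ) / 2 else 0).sum ≤ z := by
    intro l
    induction l with
    | nil => intro acc z hz; rw [mem_support_pure hz]; simp
    | cons w l ih =>
      intro acc z hz
      rw [List.foldlM_cons] at hz
      obtain ⟨acc', h1, hz⟩ := mem_support_bind hz
      have h2 := ih acc' z hz
      rw [List.map_cons, List.sum_cons]
      by_cases hw : w ∈ B \ ∅
      · rw [if_pos hw] at h1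
        obtain ⟨x, hx, h1⟩ := mem_support_bind h1
        rw [mem_support_pure h1] at h2
        have := singletonCostEstimate_ge hlog hε hx
        rw [if_pos hw]; linarith
      · rw [if_neg hw] at h1
        rw [mem_support_pure h1] at h2
        rw [if_neg hw]; linarith
  have h1 := hfold _ _ _ hz
  rw [← Fin.sum_univ_def, ← Finset.sum_filter] at h1
  have h2 : (Finset.univ.filter fun w => w ∈ B \ ∅) = B := by ext; simp
  rw [h2] at h1
  have h37 : 0 < 1 - 37 * ε := by linarith
  gcongr
  simp [hy0]
  linarith

/-- In a clique no sample sees a non-edge, and for `C = B` no singleton is estimated, so nothing is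
random. -/
theorem costEstimate_self_eq (hadj : ∀ x ∈ B, ∀ y ∈ B, x ≠ y → G.Adj x y) {x : ℝ}
    (hx : x ∈ (costEstimate G ε i B B).support) :
    x = (∑ w ∈ B, (deg G i w : ℝ) - B.card * (B.card - 1) + 9 * ε * B.card) / (1 - 37 * ε) := by
  classical
  unfold costEstimate at hx
  obtain ⟨y, hy, hx⟩ := mem_support_bind hx
  obtain ⟨z, hz, hx⟩ := mem_support_bind hx
  rw [mem_support_pure hx]
  have hy0 : y = 0 := by
    unfold inClusterCostEstimate at hy
    dsimp only at hy
    split_ifs at hy with h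
    · obtain ⟨l, hl, hy⟩ := mem_support_bind hy
      rw [mem_support_pure hy]
      have : (l.countP fun e => decide (¬ G.Adj e.1 e.2)) = 0 := by
        rw [List.countP_eq_zero]
        intro e he
        have h1 := (mem_support_iid hl).2 e he
        rw [PMF.mem_support_uniformOfFinset_iff, Finset.mem_offDiag] at h1
        simpa using hadj _ h1.1 _ h1.2.1 h1.2.2
      rw [this]; simp
    · exact mem_support_pure hy
  have hz0 : z = 0 := by
    have hfold : ∀ (l : List (Fin n)) (acc z : ℝ), z ∈ (l.foldlM (fun (acc : ℝ) (w : Fin n) =>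
        if w ∈ B \ B then do
          let x ← singletonCostEstimate G ε i B B w
          pure (acc + x)
        else (pure acc : PMF ℝ)) acc).support → z = acc := by
      intro l
      induction l with
      | nil => intro acc z hz; exact mem_support_pure hz
      | cons w l ih =>
        intro acc z hz
        rw [List.foldlM_cons] at hz
        obtain ⟨acc', h1, hz⟩ := mem_support_bind hz
        rw [if_neg (by simp)] at h1
        rw [ih acc' z hz, mem_support_pure h1]
    exact hfold _ _ _ hz
  rw [hy0, hz0, Nat.cast_choose_two]
  congr 1; ring

/-- Cost zero forces `B` to be an isolated clique. All its nodes have degree `|B| - 1`, so the only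
level sets are `B` and `∅`. The estimates never err: up to the common denominator, `9ε|B|` is
compared with at least `|B|(|B| - 1) / 2`. -/
theorem ev_breakCost_perfect (h : IsStar G i v B) (hcard : 2 ≤ B.card) (hn : 2 ≤ n)
    (hε : 0 < ε) (hε' : ε < 1 / 1000) {j : ℕ} (hj : j < ⌈Real.logb (1 + ε) n⌉₊ + 1)
    (hzero : breakCost G i B (atLeast G i B ((1 + ε) ^ j)) = 0) :
    ev (breakCluster G ε i B) (fun D => ENNReal.ofReal (breakCost G i B (B ∩ D))) ≤ 0 := by
  have hlog0 : 0 < Real.log n := by have := log_ge hn; linarith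
  set A := atLeast G i B ((1 + ε) ^ j) with hA
  have hAB : A ⊆ B := atLeast_subset _
  have hod := outerDeg_add_le (G := G) h.le hAB
  have hod0 := outerDeg_nonneg (G := G) (i := i) (B := B) (C := A)
  have hns0 := nSum_nonneg (G := G) A A
  rw [hzero] at hod
  have hAeq : A = B := by
    refine Finset.Subset.antisymm hAB fun w hw => ?_
    by_contra hwA
    have h1 := one_le_deg h hcard hw
    have h2 : (deg G i w : ℝ) ≤ outerDeg G i B A :=
      Finset.single_le_sum (f := fun w => (deg G i w : ℝ)) (fun _ _ => by positivity)
        (Finset.mem_sdiff.2 ⟨hw, hwA⟩)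
    linarith
  rw [hAeq] at hod hns0 hod0 hzero
  have hns : nSum G B B = 0 := by linarith
  have hadj : ∀ x ∈ B, ∀ y ∈ B, x ≠ y → G.Adj x y := by
    intro x hx y hy hxy
    by_contra hna
    have h1 : nonW G x y = 0 := by
      have h2 := (Finset.sum_eq_zero_iff_of_nonneg
        (fun x _ => Finset.sum_nonneg fun y _ => nonW_nonneg x y)).1 hns x hx
      exact (Finset.sum_eq_zero_iff_of_nonneg (fun y _ => nonW_nonneg x y)).1 h2 y hy
    simp [nonW, hxy, hna] at h1
  have hdeg : ∀ w ∈ B, (deg G i w : ℝ) = B.card - 1 := by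
    intro w hw
    have h1 := two_mul_breakCost (G := G) (i := i) (Finset.Subset.refl B)
    rw [hzero] at h1
    have h2 := eSum_le_sum_deg (G := G) h.le
    have h3 := deg_sub_nonneg (G := G) h.le (Finset.Subset.refl B)
    have h4 := Finset.single_le_sum (f := fun w => (deg G i w : ℝ) - ∑ y ∈ B, adjW G w y)
        (fun w _ => h3 w) hw
    have h5 : ∑ y ∈ B, nonW G w y = 0 := (Finset.sum_eq_zero_iff_of_nonneg
        (fun x _ => Finset.sum_nonneg fun y _ => nonW_nonneg x y)).1 hns w hw
    have h6 := eSum_singleton_add_nSum (G := G) hw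
    have h7 := h3 w
    beta_reduce at h4
    linarith
  have hlevel : ∀ t, atLeast G i B t = B ∨ atLeast G i B t = ∅ := by
    intro t
    by_cases ht : t ≤ (B.card : ℝ) - 1
    · left
      refine Finset.filter_true_of_mem fun w hw => ?_
      rw [hdeg w hw]; exact ht
    · right
      refine Finset.filter_eq_empty_iff.2 fun w hw => ?_
      rw [hdeg w hw]; exact ht
  have hcmp : ∀ x ∈ (costEstimate G ε i B B).support, ∀ x' ∈ (costEstimate G ε i B ∅).support,
      x < x' := by
    intro x hx x' hx'
    have h1 := costEstimate_empty_ge hlog0 hε hε' hx'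
    rw [costEstimate_self_eq hadj hx]
    refine lt_of_lt_of_le ?_ h1
    have h37 : 0 < 1 - 37 * ε := by linarith
    rw [← Finset.sum_div, Finset.sum_congr rfl hdeg, Finset.sum_const, nsmul_eq_mul]
    have h2 : (2 : ℝ) ≤ B.card := by exact_mod_cast hcard
    gcongr
    nlinarith
  set Φ : Finset (Fin n) → ℝ≥0∞ := fun D => ENNReal.ofReal (breakCost G i B (B ∩ D)) with hΦ
  have hΦB : Φ B = 0 := by simp [hΦ, hzero]
  have hBe : ev (costComparison G ε i B B ∅) Φ = 0 := by
    unfold costComparison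
    rw [ev_bind, ← ev_const (costEstimate G ε i B B) 0]
    refine ev_congr_support fun x hx => ?_
    rw [ev_bind, ← ev_const (costEstimate G ε i B ∅) 0]
    refine ev_congr_support fun x' hx' => ?_
    rw [ev_pure, if_pos (hcmp x hx x' hx'), hΦB]
  have heB : ev (costComparison G ε i B ∅ B) Φ = 0 := by
    unfold costComparison
    rw [ev_bind, ← ev_const (costEstimate G ε i B ∅) 0]
    refine ev_congr_support fun x' hx' => ?_
    rw [ev_bind, ← ev_const (costEstimate G ε i B B) 0]
    refine ev_congr_support fun x hx => ?_
    rw [ev_pure, if_neg (not_lt.2 (hcmp x hx x' hx').le), hΦB]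
  have hmain := ev_breakCluster_le_of_step hε Φ 1 0 le_rfl (G := G) (i := i) (B := B) ?_ hj ?_
  · simpa using hmain
  · rintro j' C ⟨t, _, rfl⟩
    rw [one_mul]
    rcases hlevel t with h1 | h1 <;> rcases hlevel ((1 + ε) ^ j') with h2 | h2 <;> rw [h1, h2]
    · rw [ev_costComparison_self]
    · rw [heB]; exact zero_le
    · rw [hBe]; exact zero_le
    · rw [ev_costComparison_self]
  · rintro C ⟨t, _, rfl⟩
    rw [← hA, hAeq]
    rcases hlevel t with h1 | h1 <;> rw [h1]
    · rw [ev_costComparison_self, hΦB]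
    · rw [hBe]

/-! ### The combined guarantee for breaking one cluster. -/

theorem breakCluster_support_subset (hε : 0 < ε) {D : Finset (Fin n)}
    (hD : D ∈ (breakCluster G ε i B).support) : D ⊆ B := by
  unfold breakCluster at hD
  rw [List.range_eq_range'] at hD
  exact (isLevel_foldlM hε _ 0 B ⟨0, by simp, atLeast_zero.symm⟩ D hD).subset

/-- Breaking a cluster is, in expectation, nearly as good as the best threshold. -/
theorem ev_breakCost_le (h : IsStar G i v B) (hn : 2 ≤ n)
    (hε : 0 < ε) (hε' : ε < 1 / 1000) {j : ℕ} (hj : j < ⌈Real.logb (1 + ε) n⌉₊ + 1) :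
    ev (breakCluster G ε i B) (fun D => ENNReal.ofReal (breakCost G i B (B ∩ D))) ≤
      ENNReal.ofReal ((1 + 300 * ε) * breakCost G i B (atLeast G i B ((1 + ε) ^ j))) := by
  set A := atLeast G i B ((1 + ε) ^ j) with hA
  have hAB : A ⊆ B := atLeast_subset _
  have hf0 := breakCost_nonneg (G := G) h.le hAB
  by_cases hcard : 2 ≤ B.card
  · rcases hf0.eq_or_lt with hz | hpos
    · rw [← hz, mul_zero, ENNReal.ofReal_zero]
      exact ev_breakCost_perfect h hcard hn hε hε' hj hz.symm
    by_cases hnear : 20 * breakCost G i B A < A.card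
    · refine (ev_breakCost_nearlyPerfect h hcard hn hε hε' hj hpos hnear).trans ?_
      apply ENNReal.ofReal_le_ofReal
      rw [← hA]; gcongr; linarith
    -- Here `|A|` is at most 20 times the cost of `A`, so the penalty `9 ε |A|` adds at most a
    -- factor `1 + 180 ε`.
    · push Not at hnear
      have h1 := ev_penalizedCost_le h hn hε hε' hj hpos hcard
      rw [← hA] at h1
      have hF : penalizedCost G ε i B A ≤ (1 + 180 * ε) * breakCost G i B A := by
        unfold penalizedCost
        have : ε * A.card ≤ ε * (20 * breakCost G i B A) := by gcongr
        linarith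
      calc ev (breakCluster G ε i B) (fun D => ENNReal.ofReal (breakCost G i B (B ∩ D)))
          ≤ ev (breakCluster G ε i B) (fun D => ENNReal.ofReal (1 + 3 * ε) *
              ENNReal.ofReal (potential G ε i B D)) := by
            refine ev_mono_support fun D hD => ?_
            have hDB := breakCluster_support_subset hε hD
            rw [Finset.inter_eq_right.2 hDB, ← ENNReal.ofReal_mul (by positivity)]
            apply ENNReal.ofReal_le_ofReal
            have e1 := le_potential (G := G) h.le hDB hε
            have e2 := breakCost_nonneg (G := G) h.le hDB
            have e3 := breakCost_le_penalizedCost (G := G) (i := i) (B := B) (C := D) hε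
            have e4 : (1 + 3 * ε) * ((1 - 2 * ε) * penalizedCost G ε i B D) ≤
              (1 + 3 * ε) * potential G ε i B D := by gcongr
            have e5 : 1 ≤ (1 + 3 * ε) * (1 - 2 * ε) := by nlinarith
            nlinarith
        _ ≤ ENNReal.ofReal (1 + 3 * ε) *
            ENNReal.ofReal ((1 + 26 * ε) * penalizedCost G ε i B A) := by
            rw [ev_mul_left]; gcongr
        _ ≤ _ := by
            rw [← ENNReal.ofReal_mul (by positivity)]
            apply ENNReal.ofReal_le_ofReal
            calc (1 + 3 * ε) * ((1 + 26 * ε) * penalizedCost G ε i B A)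
                ≤ (1 + 3 * ε) * ((1 + 26 * ε) * ((1 + 180 * ε) * breakCost G i B A)) := by gcongr
              _ = ((1 + 3 * ε) * (1 + 26 * ε) * (1 + 180 * ε)) * breakCost G i B A := by ring
              _ ≤ _ := by
                gcongr
                nlinarith [mul_pos hε hε, mul_pos (mul_pos hε hε) hε]
  · have hval : ∀ D ⊆ B, val G D = 0 := by
      intro D hD
      have h1 : D.card ≤ 1 := (Finset.card_le_card hD).trans (by omega)
      have : Nonempty (Fin n) := ⟨v⟩
      rcases Finset.card_le_one_iff_subset_singleton.1 h1 with ⟨a, ha⟩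
      rcases Finset.subset_singleton_iff.1 ha with rfl | rfl
      · exact val_empty
      · simp [val, nSum, eSum, nonW_self, adjW_self]
    have hle : breakCost G i B A ≤ (1 + 300 * ε) * breakCost G i B A := by
      have : 0 ≤ ε * breakCost G i B A := by positivity
      linarith
    refine le_trans (ev_mono (g := fun _ => ENNReal.ofReal (breakCost G i B A)) fun D => ?_) ?_
    · apply ENNReal.ofReal_le_ofReal
      unfold breakCost
      rw [hval _ Finset.inter_subset_left, hval _ hAB]
    · rw [ev_const]; exact ENNReal.ofReal_le_ofReal hle

/-- Breaking a cluster is, in expectation, a nearly `4`-approximation of any way to keep one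
sub-cluster. -/
theorem ev_breakCluster_le (h : IsStar G i v B) (hn : 2 ≤ n)
    (hε : 0 < ε) (hε' : ε < 1 / 1000) (hC : C ⊆ B) :
    ev (breakCluster G ε i B)
      (fun D => ENNReal.ofReal (∑ u ∈ B, (deg G i u : ℝ) + val G (B ∩ D))) ≤
      ENNReal.ofReal ((4 + 3000 * ε) * (∑ u ∈ B, (deg G i u : ℝ) + val G C)) := by
  have hthr := exists_threshold (G := G) hε hε' (by omega : 0 < n) (fun u => deg G i u)
    (fun u => deg_lt i u) B C hC (fun u _ => sum_adjW_le_deg fun x hx => h.le x (hC hx))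
  obtain ⟨j, hj, hle⟩ := hthr
  rw [Finset.mem_range] at hj
  have hbreak := ev_breakCost_le h hn hε hε' hj
  change ∑ u ∈ B, (deg G i u : ℝ) + val G (atLeast G i B ((1 + ε) ^ j)) ≤ _ at hle
  set A := atLeast G i B ((1 + ε) ^ j) with hA
  have hAB : A ⊆ B := atLeast_subset _
  -- `κ` counts the edges leaving `B`. The threshold bound concerns `∑ deg + val`, the breaking
  -- bound `∑ deg + val + κ`. As `κ ≤ ∑ deg + val D` for every `D ⊆ B`, passing from one to the
  -- other costs only `O(ε)`.
  set κ := ∑ u ∈ B, (deg G i u : ℝ) - eSum G B B with hκ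
  have hκ0 : 0 ≤ κ := sub_nonneg.2 (eSum_le_sum_deg h.le)
  have hform : ∀ D, 2 * breakCost G i B D = (∑ u ∈ B, (deg G i u : ℝ) + val G D) + κ := by
    intro D; rw [hκ, breakCost]; ring
  have hge : ∀ D ⊆ B, κ ≤ ∑ u ∈ B, (deg G i u : ℝ) + val G D := by
    intro D hD
    have h1 := neg_eSum_le_val (G := G) D
    have h2 : eSum G D D ≤ eSum G B B := eSum_mono hD hD
    rw [hκ]; linarith
  have h1 : ev (breakCluster G ε i B)
      (fun D => ENNReal.ofReal (∑ u ∈ B, (deg G i u : ℝ) + val G (B ∩ D))) + ENNReal.ofReal κ ≤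
      ENNReal.ofReal (2 * ((1 + 300 * ε) * breakCost G i B A)) := by
    rw [← ev_const (breakCluster G ε i B) (ENNReal.ofReal κ), ← ev_add,
      ENNReal.ofReal_mul (by norm_num : (0 : ℝ) ≤ 2)]
    refine le_trans (le_of_eq ?_) (mul_le_mul_right hbreak _)
    rw [← ev_mul_left]
    congr 1; ext D
    rw [← ENNReal.ofReal_add (hκ0.trans (hge _ Finset.inter_subset_left)) hκ0, ← hform,
      ENNReal.ofReal_mul (by norm_num)]
  have h2 : 2 * ((1 + 300 * ε) * breakCost G i B A) ≤
      (4 + 3000 * ε) * (∑ u ∈ B, (deg G i u : ℝ) + val G C) + κ := by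
    have e1 := hform A
    have e2 := hge A hAB
    have e3 : 2 * breakCost G i B A ≤ 2 * (∑ u ∈ B, (deg G i u : ℝ) + val G A) := by linarith
    have e4 : ε * (2 * breakCost G i B A) ≤
      ε * (2 * (∑ u ∈ B, (deg G i u : ℝ) + val G A)) := by gcongr
    have e5 : (1 + 600 * ε) * (∑ u ∈ B, (deg G i u : ℝ) + val G A) ≤
      (1 + 600 * ε) * ((4 + 10 * ε) * (∑ u ∈ B, (deg G i u : ℝ) + val G C)) := by gcongr
    have e6 := hge C hC
    have e7 : (1 + 600 * ε) * (4 + 10 * ε) ≤ 4 + 3000 * ε := by nlinarith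
    have e8 : (1 + 600 * ε) * (4 + 10 * ε) * (∑ u ∈ B, (deg G i u : ℝ) + val G C) ≤
      (4 + 3000 * ε) * (∑ u ∈ B, (deg G i u : ℝ) + val G C) :=
      mul_le_mul_of_nonneg_right e7 (by linarith)
    linarith
  have h3 := h1.trans (ENNReal.ofReal_le_ofReal h2)
  have h4 : 0 ≤ (4 + 3000 * ε) * (∑ u ∈ B, (deg G i u : ℝ) + val G C) :=
    mul_nonneg (by positivity) (hκ0.trans (hge C hC))
  rw [ENNReal.ofReal_add h4 hκ0] at h3
  exact (ENNReal.add_le_add_iff_right ENNReal.ofReal_ne_top).1 h3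

end nearlyPerfect


/-! ### The law of the clusters given the pivots -/

section process
variable {n : ℕ} {G : SimpleGraph (Fin n)} {ε L : ℝ} {s : ℕ} {π : Fin n → unitInterval}

/-- The result of folding over the first `k` nodes. -/
noncomputable def foldPrefix {α : Type} (f : α → Fin n → PMF α) (a : α) (k : ℕ) : PMF α :=
  ((List.finRange n).take k).foldlM f a

theorem foldPrefix_zero {α : Type} (f : α → Fin n → PMF α) (a : α) :
    foldPrefix f a 0 = pure a := rfl

theorem foldPrefix_succ {α : Type} (f : α → Fin n → PMF α) (a : α) {k : ℕ} (hk : k < n) :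
    foldPrefix f a (k + 1) = foldPrefix f a k >>= fun b => f b ⟨k, hk⟩ := by
  unfold foldPrefix
  rw [List.take_succ_eq_append_getElem (by simpa using hk), List.foldlM_append]
  simp

theorem foldPrefix_self {α : Type} (f : α → Fin n → PMF α) (a : α) :
    foldPrefix f a n = (List.finRange n).foldlM f a := by
  unfold foldPrefix
  rw [List.take_of_length_le (by simp)]

theorem foldPrefix_invariant {α : Type} {f : α → Fin n → PMF α} {a : α} (I : ℕ → α → Prop)
    (h0 : I 0 a) (hstep : ∀ (i : Fin n) b, I i b → ∀ b' ∈ (f b i).support, I (i + 1) b') :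
    ∀ k ≤ n, ∀ b ∈ (foldPrefix f a k).support, I k b := by
  intro k
  induction k with
  | zero => intro _ b hb; rw [mem_support_pure hb]; exact h0
  | succ k ih =>
    intro hk b hb
    rw [foldPrefix_succ f a hk] at hb
    obtain ⟨c, hc, hb⟩ := mem_support_bind hb
    exact hstep ⟨k, hk⟩ c (ih (by omega) c hc) b hb

/-- Every node with a pivot is one of the first `k` nodes, its pivot is in its closed neighbourhood
and is its own pivot. -/
def IsPivotArray (G : SimpleGraph (Fin n)) (k : ℕ) (p : Fin n → Option (Fin n)) : Prop :=
  ∀ z w, p z = some w → (z : ℕ) < k ∧ (z = w ∨ G.Adj z w) ∧ p w = some w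

variable {i v : Fin n} {p q : Fin n → Option (Fin n)}

theorem IsPivotArray.eq_none (h : IsPivotArray G i p) : p i = none := by
  by_contra hne
  obtain ⟨w, hw⟩ := Option.ne_none_iff_exists'.1 hne
  exact absurd (h i w hw).1 (lt_irrefl _)

theorem IsPivotArray.mono {k l : ℕ} (h : IsPivotArray G k p) (hkl : k ≤ l) :
    IsPivotArray G l p :=
  fun z w hz => ⟨(h z w hz).1.trans_le hkl, (h z w hz).2⟩

theorem IsPivotArray.update_none (h : IsPivotArray G i p) :
    IsPivotArray G (i + 1) (Function.update p i none) := by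
  rw [← h.eq_none, Function.update_eq_self]
  exact h.mono (Nat.le_succ _)

theorem IsPivotArray.update_some (h : IsPivotArray G i p)
    (hv : v = i ∨ (G.Adj v i ∧ p v = some v)) :
    IsPivotArray G (i + 1) (Function.update p i (some v)) := by
  have hvv : Function.update p i (some v) v = some v := by
    by_cases hvi : v = i
    · rw [hvi]; simp
    · rw [Function.update_of_ne hvi]; exact (hv.resolve_left hvi).2
  intro z w hz
  by_cases hzi : z = i
  · subst hzi
    rw [Function.update_self] at hz
    obtain rfl := Option.some_injective _ hz
    refine ⟨Nat.lt_succ_self _, ?_, hvv⟩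
    rcases hv with h1 | h1
    · exact Or.inl h1.symm
    · exact Or.inr h1.1.symm
  · rw [Function.update_of_ne hzi] at hz
    obtain ⟨h1, h2, h3⟩ := h z w hz
    refine ⟨h1.trans (Nat.lt_succ_self _), h2, ?_⟩
    rw [Function.update_of_ne ?_, h3]
    rintro rfl
    rw [h.eq_none] at h3; cases h3

theorem explore_self (hv : q v = some v) : explore G π i v q v = some v := by
  classical
  unfold explore
  rw [if_neg, if_neg, hv]
  · rintro ⟨w, _, _, h2, h3⟩
    rw [hv] at h3
    obtain rfl := Option.some_injective _ h3
    exact lt_irrefl _ h2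
  · rintro ⟨_, h⟩
    exact lt_irrefl _ (h v hv)

theorem mem_closedNbrs {u z : Fin n} :
    z ∈ closedNbrs G i u ↔ z = u ∨ (z ≤ i ∧ G.Adj u z) := by
  simp [closedNbrs, nbrs]

/-- A node keeps an old pivot `w` only if `w` itself is not displaced; otherwise the second branch
of `explore` has reset it. -/
theorem IsPivotArray.explore (h : IsPivotArray G (i + 1) q) (hv : q v = some v) :
    IsPivotArray G (i + 1) (explore G π i v q) := by
  classical
  intro z w hz
  by_cases h1 : z ∈ closedNbrs G i v ∧ ∀ w, q z = some w → π v < π w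
  · have : CorrelationClustering.explore G π i v q z = some v := by
      unfold CorrelationClustering.explore; rw [if_pos h1]
    rw [this] at hz
    obtain rfl := Option.some_injective _ hz
    rcases mem_closedNbrs.1 h1.1 with h2 | h2
    · subst h2
      exact ⟨(h z z hv).1, Or.inl rfl, explore_self hv⟩
    · exact ⟨Nat.lt_succ_of_le h2.1, Or.inr h2.2.symm, explore_self hv⟩
  · by_cases h2 : ∃ w ∈ closedNbrs G i v, q w = some w ∧ π v < π w ∧ q z = some w
    · unfold CorrelationClustering.explore at hz
      rw [if_neg h1, if_pos h2] at hz
      cases hz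
    · have hz' := hz
      unfold CorrelationClustering.explore at hz'
      rw [if_neg h1, if_neg h2] at hz'
      obtain ⟨e1, e2, e3⟩ := h z w hz'
      refine ⟨e1, e2, ?_⟩
      unfold CorrelationClustering.explore
      rw [if_neg, if_neg, e3]
      · rintro ⟨w', f1, f2, f3, f4⟩
        rw [e3] at f4
        obtain rfl := Option.some_injective _ f4
        exact h2 ⟨w, f1, f2, f3, hz'⟩
      · rintro ⟨f1, f2⟩
        exact h2 ⟨w, f1, e3, f2 w e3, hz'⟩

theorem argminRank_mem {S : Finset (Fin n)} (h : argminRank π S = some v) :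
    v ∈ S ∧ ∀ w ∈ S, π v ≤ π w := by
  classical
  unfold argminRank at h
  split_ifs at h with hne
  have := Finset.min'_mem _ hne
  rw [Option.some_injective _ h, Finset.mem_filter] at this
  exact this

theorem IsPivotArray.insertPivot (h : IsPivotArray G i p) :
    ∀ p' ∈ (insertPivot G L s π i p).support, IsPivotArray G (i + 1) p' := by
  classical
  intro p' hp'
  unfold CorrelationClustering.insertPivot at hp'
  split_ifs at hp' with hcase
  · have hp'' := mem_support_pure hp'
    rw [hp'']
    cases hv : argminRank π (closedNbrs G i i) with
    | none => exact h.mono (Nat.le_succ _)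
    | some v =>
      have hmem := (argminRank_mem hv).1
      dsimp only
      split_ifs with h1 h2 h3
      · subst h1
        exact (h.update_some (Or.inl rfl)).explore (by simp)
      · have hadj := ((mem_closedNbrs.1 hmem).resolve_left h1).2.symm
        exact (h.update_some (Or.inr ⟨hadj, h2⟩)).explore (by rwa [Function.update_of_ne h1])
      · have hadj := ((mem_closedNbrs.1 hmem).resolve_left h1).2.symm
        exact h.update_some (Or.inr ⟨hadj, h2⟩)
      · exact h.update_none
  · obtain ⟨S, _, hp'⟩ := mem_support_bind hp'
    rw [mem_support_pure hp']
    split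
    · exact h.update_none
    · rename_i v hv
      have hmem := (argminRank_mem hv).1
      split_ifs with h1
      · rw [Finset.mem_filter] at hmem
        obtain ⟨_, hadj, x, _, _, hx⟩ := hmem
        exact h.update_some (Or.inr ⟨hadj, (h x v hx).2.2⟩)
      · exact h.update_none

variable (G L s π) in
/-- The law of the pivot array after the first `k` insertions. -/
noncomputable def pivotProcess (k : ℕ) : PMF (Fin n → Option (Fin n)) :=
  foldPrefix (fun p i => insertPivot G L s π i p) (fun _ => none) k

variable (G ε L s π) in
/-- The law of the state after the first `k` insertions. -/
noncomputable def stateProcess (k : ℕ) : PMF (State n) :=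
  foldPrefix (insertNode G ε L s π) ⟨fun _ => none, fun _ => ∅⟩ k

theorem mem_support_insertNode {σ τ : State n} (h : τ ∈ (insertNode G ε L s π σ i).support) :
    τ.pivot ∈ (insertPivot G L s π i σ.pivot).support := by
  classical
  unfold insertNode at h
  obtain ⟨p', hp', h⟩ := mem_support_bind h
  obtain ⟨K, _, h⟩ := mem_support_bind h
  rw [mem_support_pure h]
  exact hp'

theorem isPivotArray_stateProcess {k : ℕ} (hk : k ≤ n) :
    ∀ σ ∈ (stateProcess G ε L s π k).support, IsPivotArray G k σ.pivot := by
  refine foldPrefix_invariant (f := insertNode G ε L s π) (a := ⟨fun _ => none, fun _ => ∅⟩)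
    (fun k (σ : State n) => IsPivotArray G k σ.pivot) (fun z w h => ?_) (fun i σ h τ hτ => ?_) k hk
  · cases h
  · exact h.insertPivot _ (mem_support_insertNode hτ)

/-- The recomputation of the set `C_v`. -/
theorem ev_kept (p p' : Fin n → Option (Fin n)) (v : Fin n)
    (g : Finset (Fin n) → ℝ≥0∞) (l : List (Fin n)) (hl : l.Nodup) :
    ∀ K : Fin n → Finset (Fin n), ev (l.foldlM
      (fun (K : Fin n → Finset (Fin n)) (v : Fin n) =>
        if assigned p' v ≠ assigned p v then do
          let C ← breakCluster G ε i (assigned p' v)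
          pure (Function.update K v C)
        else (pure K : PMF (Fin n → Finset (Fin n)))) K) (fun K => g (K v)) =
      if v ∈ l ∧ assigned p' v ≠ assigned p v then ev (breakCluster G ε i (assigned p' v)) g
      else g (K v) := by
  induction l with
  | nil => intro K; simp [ev_pure]
  | cons a l ih =>
    intro K
    rw [List.nodup_cons] at hl
    rw [List.foldlM_cons, ev_bind]
    simp_rw [ih hl.2]
    by_cases ha : assigned p' a ≠ assigned p a
    · rw [if_pos ha, ev_bind]
      simp_rw [ev_pure]
      by_cases hva : v = a
      · subst hva
        simp [hl.1, ha]
      · by_cases hvl : v ∈ l ∧ assigned p' v ≠ assigned p v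
        · simp only [if_pos hvl, ev_const]
          rw [if_pos ⟨List.mem_cons_of_mem _ hvl.1, hvl.2⟩]
        · simp only [if_neg hvl, Function.update_of_ne hva, ev_const]
          rw [if_neg]
          rintro ⟨h1, h2⟩
          exact hvl ⟨(List.mem_cons.1 h1).resolve_left hva, h2⟩
    · rw [if_neg ha, ev_pure]
      by_cases hva : v = a
      · subst hva
        simp [hl.1, ha]
      · simp [hva]

/-! ### Costs charged to pivots, and the comparison of the kept sets with arbitrary subsets. -/

/-- Cost charged to the nodes of `B` when `C ⊆ B` is a cluster and the others are singletons. -/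
noncomputable def charge (G : SimpleGraph (Fin n)) (B C : Finset (Fin n)) : ℝ≥0∞ :=
  ENNReal.ofReal (∑ u ∈ B, fdeg G u + val G C)

theorem charge_nonneg {B C : Finset (Fin n)} (h : C ⊆ B) : 0 ≤ ∑ u ∈ B, fdeg G u + val G C := by
  have h1 := neg_eSum_le_val (G := G) C
  have h2 : eSum G C C ≤ ∑ u ∈ B, fdeg G u :=
    (Finset.sum_le_sum fun u _ => Finset.sum_le_sum_of_subset_of_nonneg (Finset.subset_univ _)
      fun y _ _ => adjW_nonneg u y).trans
      (Finset.sum_le_sum_of_subset_of_nonneg h fun u _ _ => fdeg_nonneg u)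
  linarith

/-- The algorithm sees the degrees at step `i`, the cost uses the final ones. Their difference over
`B` does not depend on the kept set, and adding a common nonnegative amount to both sides preserves
an approximation ratio above 1. -/
theorem ev_breakCluster_charge_le (hn : 2 ≤ n) (hε : 0 < ε) (hε' : ε < 1 / 1000)
    (h : IsPivotArray G (i + 1) p) {C : Finset (Fin n)} (hC : C ⊆ assigned p v) :
    ev (breakCluster G ε i (assigned p v)) (fun D => charge G (assigned p v) (assigned p v ∩ D)) ≤
      ENNReal.ofReal (4 + 3000 * ε) * charge G (assigned p v) C := by
  rcases (assigned p v).eq_empty_or_nonempty with he | ⟨z, hz⟩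
  · rw [he] at hC ⊢
    simp [charge, ev_const]
  have hpz : p z = some v := by simpa [assigned] using hz
  have hstar : IsStar G i v (assigned p v) := by
    refine ⟨?_, fun x hx => ?_, fun x hx => ?_⟩
    · simpa [assigned] using (h z v hpz).2.2
    · have := (h x v (by simpa [assigned] using hx)).1
      exact Fin.le_def.2 (by omega)
    · exact (h x v (by simpa [assigned] using hx)).2.1
  set B := assigned p v
  set κ := ∑ u ∈ B, (fdeg G u - deg G i u) with hκ
  have hκ0 : 0 ≤ κ := Finset.sum_nonneg fun u _ => sub_nonneg.2 (deg_le_fdeg i u)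
  have hsum : ∑ u ∈ B, fdeg G u = ∑ u ∈ B, (deg G i u : ℝ) + κ := by
    rw [hκ, ← Finset.sum_add_distrib]; congr 1; ext u; ring
  have hnn : ∀ D ⊆ B, 0 ≤ ∑ u ∈ B, (deg G i u : ℝ) + val G D := by
    intro D hD
    have h1 := neg_eSum_le_val (G := G) D
    have h2 : eSum G D D ≤ ∑ u ∈ B, (deg G i u : ℝ) :=
      (Finset.sum_le_sum fun u _ => sum_adjW_le_deg fun x hx => hstar.le x (hD hx)).trans
      (Finset.sum_le_sum_of_subset_of_nonneg hD fun u _ _ => Nat.cast_nonneg _)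
    linarith
  have key := ev_breakCluster_le hstar hn hε hε' hC
  unfold charge
  calc _ = ev (breakCluster G ε i B) (fun D =>
          ENNReal.ofReal (∑ u ∈ B, (deg G i u : ℝ) + val G (B ∩ D)) + ENNReal.ofReal κ) := by
        congr 1; ext D
        rw [← ENNReal.ofReal_add (hnn _ Finset.inter_subset_left) hκ0, hsum]
        congr 1; ring
    _ ≤ ENNReal.ofReal ((4 + 3000 * ε) * (∑ u ∈ B, (deg G i u : ℝ) + val G C)) +
          ENNReal.ofReal κ := by
        rw [ev_add, ev_const]; gcongr
    _ ≤ _ := by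
        have h0 := hnn C hC
        rw [← ENNReal.ofReal_mul (by positivity),
          ← ENNReal.ofReal_add (mul_nonneg (by positivity) h0) hκ0]
        apply ENNReal.ofReal_le_ofReal
        rw [hsum]
        have : 0 ≤ (3 + 3000 * ε) * κ := by positivity
        linarith

theorem ev_insertNode (σ : State n) (h : (Fin n → Option (Fin n)) → ℝ≥0∞)
    (g : (Fin n → Option (Fin n)) → Finset (Fin n) → ℝ≥0∞) (v : Fin n) :
    ev (insertNode G ε L s π σ i) (fun τ => h τ.pivot * g τ.pivot (τ.kept v)) =
      ev (insertPivot G L s π i σ.pivot) (fun p' => h p' *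
        if assigned p' v ≠ assigned σ.pivot v then ev (breakCluster G ε i (assigned p' v)) (g p')
        else g p' (σ.kept v)) := by
  unfold insertNode
  simp only [ev_bind, ev_pure]
  congr 1; ext p'
  rw [ev_mul_left, ev_kept σ.pivot p' v (g p') _ (List.nodup_finRange n)]
  simp

/-- The pivots are chosen without looking at the kept sets, so these can be integrated out. -/
theorem ev_stateProcess_pivot (h : (Fin n → Option (Fin n)) → ℝ≥0∞) :
    ∀ k ≤ n, ev (stateProcess G ε L s π k) (fun σ => h σ.pivot) =
      ev (pivotProcess G L s π k) h := by
  intro k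
  induction k generalizing h with
  | zero => intro _; simp [stateProcess, pivotProcess, foldPrefix_zero, ev_pure]
  | succ k ih =>
    intro hk
    have ih' := ih (fun p => ev (insertPivot G L s π ⟨k, hk⟩ p) h) (by omega)
    unfold stateProcess pivotProcess at ih' ⊢
    rw [foldPrefix_succ _ _ hk, foldPrefix_succ _ _ hk, ev_bind, ev_bind, ← ih']
    congr 1; ext σ
    unfold insertNode
    simp only [ev_bind, ev_pure, ev_const]

/-- The sets kept by the algorithm compared with any rule that selects a subset of `B_v`. -/
theorem ev_charge_kept_le (hn : 2 ≤ n) (hε : 0 < ε) (hε' : ε < 1 / 1000) (v : Fin n)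
    (sel : Finset (Fin n) → Finset (Fin n)) (hsel : ∀ B, sel B ⊆ B) :
    ∀ k ≤ n, ∀ h : (Fin n → Option (Fin n)) → ℝ≥0∞,
      ev (stateProcess G ε L s π k) (fun σ => h σ.pivot *
        charge G (assigned σ.pivot v) (assigned σ.pivot v ∩ σ.kept v)) ≤
      ENNReal.ofReal (4 + 3000 * ε) * ev (pivotProcess G L s π k) (fun p => h p *
        charge G (assigned p v) (sel (assigned p v))) := by
  classical
  intro k
  induction k with
  | zero =>
    intro _ h
    simp [stateProcess, foldPrefix_zero, ev_pure, charge, assigned]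
  | succ k ih =>
    intro hk h
    set c := ENNReal.ofReal (4 + 3000 * ε)
    set i : Fin n := ⟨k, hk⟩ with hi
    set g : (Fin n → Option (Fin n)) → Finset (Fin n) → ℝ≥0∞ :=
      fun p K => charge G (assigned p v) (assigned p v ∩ K) with hg
    set t : (Fin n → Option (Fin n)) → ℝ≥0∞ :=
      fun p => charge G (assigned p v) (sel (assigned p v)) with ht
    -- If `B_v` changes, its set is recomputed with fresh samples and the bound for one cluster
    -- applies. If not, the probability of this is moved into the weight `h`, and the induction
    -- hypothesis is used with the new weight; this is why the statement quantifies over all `h`.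
    have hstep : ∀ σ ∈ (stateProcess G ε L s π k).support,
        ev (insertNode G ε L s π σ i) (fun τ => h τ.pivot * g τ.pivot (τ.kept v)) ≤
        ev (insertPivot G L s π i σ.pivot) (fun p' => c * (h p' *
          (if assigned p' v ≠ assigned σ.pivot v then t p' else 0))) +
        ev (insertPivot G L s π i σ.pivot) (fun p' => h p' *
          (if assigned p' v ≠ assigned σ.pivot v then 0 else 1)) * g σ.pivot (σ.kept v) := by
      intro σ hσ
      rw [ev_insertNode, ← ev_mul_right, ← ev_add]
      refine ev_mono_support fun p' hp' => ?_
      have hval := (isPivotArray_stateProcess (by omega) σ hσ).insertPivot (i := i) p' hp'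
      by_cases hne : assigned p' v ≠ assigned σ.pivot v
      · simp only [if_pos hne, mul_zero, zero_mul, add_zero]
        rw [← mul_assoc, mul_comm c, mul_assoc]
        gcongr
        exact ev_breakCluster_charge_le hn hε hε' hval (hsel _)
      · simp only [if_neg hne, mul_zero, mul_one, zero_add]
        rw [not_not] at hne
        simp only [hg, hne, le_refl]
    have hL : stateProcess G ε L s π (k + 1) =
        stateProcess G ε L s π k >>= fun σ => insertNode G ε L s π σ i := foldPrefix_succ _ _ hk
    have hR : pivotProcess G L s π (k + 1) =
        pivotProcess G L s π k >>= fun p => insertPivot G L s π i p := foldPrefix_succ _ _ hk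
    rw [hL, hR, ev_bind, ev_bind]
    refine (ev_mono_support hstep).trans ?_
    rw [ev_add]
    have h1 := ev_stateProcess_pivot (G := G) (ε := ε) (L := L) (s := s) (π := π)
      (fun p => ev (insertPivot G L s π i p) (fun p' => c * (h p' *
          (if assigned p' v ≠ assigned p v then t p' else 0)))) k (by omega)
    have h2 := ih (by omega) (fun p => ev (insertPivot G L s π i p) (fun p' => h p' *
          (if assigned p' v ≠ assigned p v then 0 else 1)))
    rw [h1]
    refine (add_le_add_right h2 _).trans ?_
    rw [← ev_mul_left, ← ev_mul_left, ← ev_add]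
    refine ev_mono fun p => ?_
    rw [← ev_mul_right, ← ev_mul_left, ← ev_add, ← ev_mul_left]
    refine ev_mono fun p' => ?_
    by_cases hne : assigned p' v ≠ assigned p v
    · simp [if_pos hne, ht]
    · rw [not_not] at hne
      simp [hne]

/-- The clusters of the reference clustering, restricted to the nodes that have the right pivot. -/
noncomputable def comparator (G : SimpleGraph (Fin n)) (π : Fin n → unitInterval)
    (p : Fin n → Option (Fin n)) (u : Fin n) : Fin n ⊕ Fin n :=
  match p u with
  | some v => if refClustering G π u = Sum.inl v then Sum.inl v else Sum.inr u
  | none => Sum.inr u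

theorem sum_fdeg_eq (p : Fin n → Option (Fin n)) : ∑ x, fdeg G x =
    ∑ x ∈ Finset.univ.filter (fun x => p x = none), fdeg G x + ∑ v, ∑ u ∈ assigned p v, fdeg G u := by
  classical
  unfold assigned
  simp_rw [Finset.sum_filter]
  rw [Finset.sum_comm, ← Finset.sum_add_distrib]
  refine Finset.sum_congr rfl fun x _ => ?_
  cases p x <;> simp

theorem two_mul_cost_eq_charge (f : Fin n → Fin n ⊕ Fin n) (p : Fin n → Option (Fin n))
    (C : Fin n → Finset (Fin n)) (hC : ∀ v, C v ⊆ assigned p v)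
    (hl : ∀ u v, f u = Sum.inl v ↔ u ∈ C v) (hr : ∀ u w, f u = Sum.inr w → w = u) :
    2 * (cost G f : ℝ≥0∞) = ENNReal.ofReal (∑ x ∈ Finset.univ.filter (fun x => p x = none),
      fdeg G x) + ∑ v, charge G (assigned p v) (C v) := by
  classical
  have h1 := two_mul_cost_eq (G := G) f hr
  have h2 : ∀ v, (Finset.univ.filter fun u => f u = Sum.inl v) = C v := by
    intro v; ext u; simp [hl]
  simp_rw [h2] at h1
  rw [sum_fdeg_eq p, add_assoc, ← Finset.sum_add_distrib] at h1
  unfold charge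
  rw [← ENNReal.ofReal_sum_of_nonneg fun v _ => charge_nonneg (hC v),
    ← ENNReal.ofReal_add (Finset.sum_nonneg fun x _ => fdeg_nonneg x)
      (Finset.sum_nonneg fun v _ => charge_nonneg (hC v)), ← h1,
    ENNReal.ofReal_mul (by norm_num), ENNReal.ofReal_natCast]
  norm_num

/-- For fixed ranks, the algorithm nearly `4`-approximates the comparator in expectation. -/
theorem ev_cost_sparsePivot_le (hn : 2 ≤ n) (hε : 0 < ε) (hε' : ε < 1 / 1000) :
    ev (sparsePivot G ε L s π) (fun σ => (cost G σ.clustering : ℝ≥0∞)) ≤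
      ENNReal.ofReal (4 + 3000 * ε) *
        ev (pivotProcess G L s π n) (fun p => (cost G (comparator G π p) : ℝ≥0∞)) := by
  classical
  have hrun : sparsePivot G ε L s π = stateProcess G ε L s π n := (foldPrefix_self _ _).symm
  have h1 : ∀ σ : State n, 2 * (cost G σ.clustering : ℝ≥0∞) =
      ENNReal.ofReal (∑ x ∈ Finset.univ.filter (fun x => σ.pivot x = none), fdeg G x) +
      ∑ v, charge G (assigned σ.pivot v) (assigned σ.pivot v ∩ σ.kept v) := by
    intro σ
    apply two_mul_cost_eq_charge
    · intro v; exact Finset.inter_subset_left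
    · intro u v
      unfold State.clustering assigned
      cases hu : σ.pivot u with
      | none => simp [hu]
      | some w =>
        by_cases hk : u ∈ σ.kept w
        · simp only [hk, if_true, Sum.inl.injEq, Finset.mem_inter, Finset.mem_filter,
            Finset.mem_univ, true_and, hu, Option.some.injEq]
          constructor
          · rintro rfl; exact ⟨rfl, hk⟩
          · exact fun h => h.1
        · simp only [hk, if_false, Finset.mem_inter, Finset.mem_filter,
            Finset.mem_univ, true_and, hu, Option.some.injEq]
          constructor
          · intro h; cases h
          · rintro ⟨rfl, h⟩; exact absurd h hk
    · intro u w h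
      unfold State.clustering at h
      cases hu : σ.pivot u with
      | none => simp only [hu] at h; exact (Sum.inr_injective h).symm
      | some w =>
        simp only [hu] at h
        split_ifs at h
        exact (Sum.inr_injective h).symm
  set sel : Fin n → Finset (Fin n) → Finset (Fin n) :=
    fun v B => B.filter fun u => refClustering G π u = Sum.inl v with hsel
  have h2 : ∀ p : Fin n → Option (Fin n), 2 * (cost G (comparator G π p) : ℝ≥0∞) =
      ENNReal.ofReal (∑ x ∈ Finset.univ.filter (fun x => p x = none), fdeg G x) +
      ∑ v, charge G (assigned p v) (sel v (assigned p v)) := by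
    intro p
    apply two_mul_cost_eq_charge
    · intro v; exact Finset.filter_subset _ _
    · intro u v
      unfold comparator
      simp only [hsel, assigned, Finset.mem_filter, Finset.mem_univ, true_and]
      cases hu : p u with
      | none => simp
      | some w =>
        dsimp only
        split_ifs with h
        · rw [h]; simp
        · constructor
          · intro h'; cases h'
          · rintro ⟨h1, h2⟩
            obtain rfl := Option.some_injective _ h1
            exact absurd h2 h
    · intro u w h
      unfold comparator at h
      cases hu : p u with
      | none => simp only [hu] at h; exact (Sum.inr_injective h).symm
      | some w =>
        simp only [hu] at h
        split_ifs at h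
        exact (Sum.inr_injective h).symm
  have hc : (1 : ℝ≥0∞) ≤ ENNReal.ofReal (4 + 3000 * ε) := by
    rw [ENNReal.one_le_ofReal]; linarith
  -- Algorithm and comparator split the nodes by the same pivot array, so the terms of the nodes
  -- without a pivot coincide and the other terms are compared pivot by pivot.
  have key : 2 * ev (stateProcess G ε L s π n) (fun σ => (cost G σ.clustering : ℝ≥0∞)) ≤
      2 * (ENNReal.ofReal (4 + 3000 * ε) *
        ev (pivotProcess G L s π n) (fun p => (cost G (comparator G π p) : ℝ≥0∞))) := by
    rw [mul_left_comm, ← ev_mul_left, ← ev_mul_left]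
    simp_rw [h1, h2, ev_add, ev_sum]
    rw [mul_add, Finset.mul_sum]
    refine add_le_add ?_ (Finset.sum_le_sum fun v _ => ?_)
    · rw [ev_stateProcess_pivot (fun p => ENNReal.ofReal
        (∑ x ∈ Finset.univ.filter (fun x => p x = none), fdeg G x)) n le_rfl]
      exact le_mul_of_one_le_left' hc
    · have := ev_charge_kept_le (G := G) (L := L) (s := s) (π := π) hn hε hε' v (sel v)
        (fun B => Finset.filter_subset _ _) n le_rfl (fun _ => 1)
      simpa only [one_mul] using this
  rw [hrun]
  exact (ENNReal.mul_le_mul_iff_right (by norm_num) (by norm_num)).1 key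

end process


/-! ### The pivots that the algorithm finds -/

section pivots
variable {n : ℕ} {G : SimpleGraph (Fin n)} {ε L : ℝ} {s : ℕ} {π : Fin n → unitInterval}
  {i u v w : Fin n} {p q : Fin n → Option (Fin n)}

/-- `v` has the smallest rank in the closed neighbourhood of `u`. -/
def IsPiv (G : SimpleGraph (Fin n)) (π : Fin n → unitInterval) (v u : Fin n) : Prop :=
  (v = u ∨ G.Adj u v) ∧ ∀ x, (x = u ∨ G.Adj u x) → π v ≤ π x

/-- `u` belongs to the cluster of `v` in the reference clustering. -/
def IsRef (G : SimpleGraph (Fin n)) (π : Fin n → unitInterval) (v u : Fin n) : Prop :=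
  IsPiv G π v u ∧ IsPiv G π v v

theorem IsPiv.isRef (h : IsPiv G π v v) : IsRef G π v v := ⟨h, h⟩

theorem IsPiv.eq (hπ : Function.Injective π) (h : IsPiv G π v u) (h' : IsPiv G π w u) : v = w :=
  hπ (le_antisymm (h.2 w h'.1) (h'.2 v h.1))

theorem argminRank_eq (hπ : Function.Injective π) {S : Finset (Fin n)} (hv : v ∈ S)
    (hmin : ∀ w ∈ S, π v ≤ π w) : argminRank π S = some v := by
  classical
  have hne : (S.filter fun v => ∀ w ∈ S, π v ≤ π w).Nonempty :=
    ⟨v, Finset.mem_filter.2 ⟨hv, hmin⟩⟩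
  unfold argminRank
  rw [dif_pos hne]
  have := Finset.mem_filter.1 (Finset.min'_mem _ hne)
  exact congrArg some (hπ (le_antisymm (this.2 v hv) (hmin _ this.1)))

theorem refPivot_eq_some_iff (hπ : Function.Injective π) :
    refPivot G π u = some v ↔ IsPiv G π v u := by
  classical
  unfold refPivot
  constructor
  · intro h
    obtain ⟨h1, h2⟩ := argminRank_mem h
    refine ⟨by simpa using h1, fun x hx => h2 x (by simpa using hx)⟩
  · intro h
    exact argminRank_eq hπ (by simpa using h.1) fun w hw => h.2 w (by simpa using hw)

theorem refClustering_eq_inl_iff (hπ : Function.Injective π) :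
    refClustering G π u = Sum.inl v ↔ IsRef G π v u := by
  unfold refClustering IsRef
  rw [← refPivot_eq_some_iff hπ, ← refPivot_eq_some_iff hπ]
  cases h : refPivot G π u with
  | none => simp
  | some w =>
    dsimp only
    split_ifs with h'
    · constructor
      · intro e; obtain rfl := Sum.inl_injective e; exact ⟨rfl, h'⟩
      · rintro ⟨e, -⟩; rw [Option.some_injective _ e]
    · constructor
      · intro e; cases e
      · rintro ⟨e, h2⟩; obtain rfl := Option.some_injective _ e; exact absurd h2 h'

theorem refClustering_eq_inr (h : refClustering G π u = Sum.inr w) : w = u := by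
  unfold refClustering at h
  split at h
  · split_ifs at h; exact (Sum.inr_injective h).symm
  · exact (Sum.inr_injective h).symm

/-- To take `u` away from `v`, an explorer would need a rank below that of `v` and lie in `N[u]` or
in `N[v]`; `v` has the smallest rank in both. -/
theorem IsRef.explore_eq (h : IsRef G π v u) (hq : q u = some v) :
    explore G π i w q u = some v := by
  classical
  unfold explore
  rw [if_neg, if_neg, hq]
  · rintro ⟨w', h1, _, h2, h3⟩
    rw [hq] at h3
    obtain rfl := Option.some_injective _ h3
    refine absurd (h.2.2 w ?_) (not_le.2 h2)
    rcases mem_closedNbrs.1 h1 with rfl | h1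
    · exact Or.inl rfl
    · exact Or.inr h1.2.symm
  · rintro ⟨h1, h2⟩
    refine absurd (h.1.2 w ?_) (not_le.2 (h2 v hq))
    rcases mem_closedNbrs.1 h1 with rfl | h1
    · exact Or.inl rfl
    · exact Or.inr h1.2.symm

theorem eq_of_explore_eq (h : explore G π i w q u = some v) : q u = some v ∨ w = v := by
  classical
  unfold explore at h
  split_ifs at h
  · exact Or.inr (Option.some_injective _ h)
  · exact Or.inl h

/-- Only a current pivot of `u` with rank at most that of `v` could resist. It lies in `N[u]`, where
`v` is minimal, so it would be `v`. -/
theorem IsRef.explore_pivot (hπ : Function.Injective π) (h : IsRef G π v u) (hu : u ≤ i)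
    (hq : IsPivotArray G (i + 1) q) : explore G π i v q u = some v := by
  classical
  by_cases hquv : q u = some v
  · exact h.explore_eq hquv
  · unfold explore
    rw [if_pos]
    refine ⟨mem_closedNbrs.2 ?_, fun w hw => ?_⟩
    · rcases h.1.1 with h1 | h1
      · exact Or.inl h1.symm
      · exact Or.inr ⟨hu, h1.symm⟩
    · have h1 := (hq u w hw).2.1
      refine lt_of_le_of_ne (h.1.2 w (h1.imp Eq.symm id)) fun e => hquv ?_
      rw [hπ e, hw]

theorem insertPivot_cases (h : IsPivotArray G i p) {p' : Fin n → Option (Fin n)}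
    (hp' : p' ∈ (insertPivot G L s π i p).support) :
    (∃ w, (w = i ∨ (G.Adj w i ∧ p w = some w)) ∧
      p' = explore G π i w (Function.update p i (some w))) ∨
    ∃ x, p' = Function.update p i x := by
  classical
  unfold insertPivot at hp'
  split_ifs at hp' with hcase
  · have hp'' := mem_support_pure hp'
    rw [hp'']
    cases hv : argminRank π (closedNbrs G i i) with
    | none => exact Or.inr ⟨p i, (Function.update_eq_self i p).symm⟩
    | some v =>
      have hmem := (argminRank_mem hv).1
      dsimp only
      split_ifs with h1 h2 h3
      · subst h1; exact Or.inl ⟨_, Or.inl rfl, rfl⟩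
      · have hadj := ((mem_closedNbrs.1 hmem).resolve_left h1).2.symm
        exact Or.inl ⟨v, Or.inr ⟨hadj, h2⟩, rfl⟩
      · exact Or.inr ⟨_, rfl⟩
      · exact Or.inr ⟨_, rfl⟩
  · obtain ⟨S, _, hp'⟩ := mem_support_bind hp'
    rw [mem_support_pure hp']
    split
    · exact Or.inr ⟨_, rfl⟩
    · split_ifs
      · exact Or.inr ⟨_, rfl⟩
      · exact Or.inr ⟨_, rfl⟩

/-- Pivots of the reference clustering are not lost. -/
theorem insertPivot_eq_of_isRef (h : IsPivotArray G i p) (hr : IsRef G π v u) (hp : p u = some v)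
    {p' : Fin n → Option (Fin n)} (hp' : p' ∈ (insertPivot G L s π i p).support) :
    p' u = some v := by
  have hui : u ≠ i := by rintro rfl; rw [h.eq_none] at hp; cases hp
  rcases insertPivot_cases h hp' with ⟨w, _, rfl⟩ | ⟨x, rfl⟩
  · exact hr.explore_eq (by rwa [Function.update_of_ne hui])
  · rwa [Function.update_of_ne hui]

/-- A node arriving in the light case finds its pivot in the reference clustering. -/
theorem insertPivot_light (hπ : Function.Injective π) (h : IsPivotArray G i p)
    (hr : IsRef G π v i) (hvi : v ≤ i) (hpv : v ≠ i → p v = some v)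
    (hlight : (π i : ℝ) * deg G i i ≤ L)
    {p' : Fin n → Option (Fin n)} (hp' : p' ∈ (insertPivot G L s π i p).support) :
    p' i = some v ∧ (v = i ∨ (π i : ℝ) * deg G i v ≤ L →
      ∀ u ≤ i, IsRef G π v u → p' u = some v) := by
  classical
  unfold insertPivot at hp'
  rw [if_pos hlight] at hp'
  have hp'' := mem_support_pure hp'
  have harg : argminRank π (closedNbrs G i i) = some v := by
    refine argminRank_eq hπ (mem_closedNbrs.2 ?_) fun w hw => hr.1.2 w ?_
    · exact hr.1.1.imp id fun h => ⟨hvi, h⟩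
    · exact (mem_closedNbrs.1 hw).imp id fun h => h.2
  rw [harg] at hp''
  dsimp only at hp''
  have harr : IsPivotArray G (i + 1) (Function.update p i (some v)) :=
    h.update_some (or_iff_not_imp_left.2 fun hne =>
      ⟨(hr.1.1.resolve_left hne).symm, hpv hne⟩)
  have hself : Function.update p i (some v) i = some v := Function.update_self ..
  by_cases hvi' : v = i
  · rw [if_pos hvi'] at hp''
    subst hvi'
    rw [hp'']
    exact ⟨hr.explore_eq hself, fun _ u hu hru => hru.explore_pivot hπ hu harr⟩
  · rw [if_neg hvi', if_pos (hpv hvi')] at hp''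
    by_cases hl : (π i : ℝ) * deg G i v ≤ L
    · rw [if_pos hl] at hp''
      rw [hp'']
      exact ⟨hr.explore_eq hself, fun _ u hu hru => hru.explore_pivot hπ hu harr⟩
    · rw [if_neg hl] at hp''
      rw [hp'']
      refine ⟨hself, fun h => ?_⟩
      rcases h with h | h
      · exact absurd h hvi'
      · exact absurd h hl

/-- The earlier neighbours of `u` that have the pivot `v`. -/
noncomputable def earlierWith (G : SimpleGraph (Fin n)) (p : Fin n → Option (Fin n))
    (v u : Fin n) : Finset (Fin n) :=
  open Classical in Finset.univ.filter fun w => w < u ∧ G.Adj u w ∧ p w = some v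

/-- What the pivot array after `k` insertions knows of the reference clustering. -/
structure IsFaithful (G : SimpleGraph (Fin n)) (ε L : ℝ) (π : Fin n → unitInterval) (k : ℕ)
    (p : Fin n → Option (Fin n)) : Prop where
  isPivotArray : IsPivotArray G k p
  pivot : ∀ v : Fin n, (v : ℕ) < k → IsPiv G π v v → p v = some v
  of_lt : ∀ u v : Fin n, (v : ℕ) < k → u < v → IsRef G π v u → p u = some v
  of_light : ∀ u v w : Fin n, (w : ℕ) < k → u < w → v < w → IsRef G π v u → IsRef G π v w →
    (π w : ℝ) * deg G w w ≤ L → (π w : ℝ) * deg G w v ≤ L → p u = some v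
  few : ∀ u v : Fin n, (u : ℕ) < k → v < u → IsRef G π v u → p u ≠ some v →
    ((earlierWith G p v u).card : ℝ) < ε / 4 * deg G u u

/-- By `hL`, a reference pivot is light when it arrives, so it becomes a pivot and its exploration
reaches all earlier nodes of its cluster. Light arrivals find their pivot deterministically. All
randomness sits in `hnew`, about a heavy arrival. -/
theorem isFaithful_insertPivot (hπ : Function.Injective π)
    (hL : ∀ v, IsPiv G π v v → (π v : ℝ) * fdeg G v ≤ L)
    (h : IsFaithful G ε L π i p) {p' : Fin n → Option (Fin n)}
    (hp' : p' ∈ (insertPivot G L s π i p).support)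
    (hnew : ∀ v < i, IsRef G π v i → L < (π i : ℝ) * deg G i i → p' i ≠ some v →
      ((earlierWith G p v i).card : ℝ) < ε / 4 * deg G i i) :
    IsFaithful G ε L π (i + 1) p' := by
  classical
  have hearly : ∀ (k : Fin n), (k : ℕ) < i + 1 → k ≠ i → (k : ℕ) < i := fun k h1 h2 => by
    have : (k : ℕ) ≠ i := fun e => h2 (Fin.ext e)
    omega
  have hpiv : IsPiv G π i i → ∀ u ≤ i, IsRef G π i u → p' u = some i := by
    intro hi u hu hru
    refine (insertPivot_light hπ h.isPivotArray hi.isRef le_rfl (fun h => absurd rfl h) ?_ hp').2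
      (Or.inl rfl) u hu hru
    refine le_trans ?_ (hL i hi)
    exact mul_le_mul_of_nonneg_left (deg_le_fdeg i i) (π i).2.1
  have hnewlight : ∀ v < i, IsRef G π v i → (π i : ℝ) * deg G i i ≤ L → p' i = some v ∧
      ((π i : ℝ) * deg G i v ≤ L → ∀ u ≤ i, IsRef G π v u → p' u = some v) := by
    intro v hv hr hl
    have := insertPivot_light hπ h.isPivotArray hr hv.le (fun _ => h.pivot v hv hr.2) hl hp'
    exact ⟨this.1, fun h => this.2 (Or.inr h)⟩
  refine ⟨h.isPivotArray.insertPivot p' hp', ?_, ?_, ?_, ?_⟩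
  · intro v hv hvv
    by_cases hvi : v = i
    · subst hvi; exact hpiv hvv v le_rfl hvv.isRef
    · exact insertPivot_eq_of_isRef h.isPivotArray hvv.isRef (h.pivot v (hearly v hv hvi) hvv) hp'
  · intro u v hv huv hr
    by_cases hvi : v = i
    · subst hvi; exact hpiv hr.2 u huv.le hr
    · exact insertPivot_eq_of_isRef h.isPivotArray hr (h.of_lt u v (hearly v hv hvi) huv hr) hp'
  · intro u v w hw huw hvw hr hrw hl hl'
    by_cases hwi : w = i
    · subst hwi; exact (hnewlight v hvw hrw hl).2 hl' u huw.le hr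
    · exact insertPivot_eq_of_isRef h.isPivotArray hr
        (h.of_light u v w (hearly w hw hwi) huw hvw hr hrw hl hl') hp'
  · intro u v hu hvu hr hne
    -- The bound `few` persists: an earlier node newly receives `v` only through an exploration from
    -- `v`, and that would give `v` to `u` as well.
    have hsub : ∀ w < u, p' w = some v → p w = some v := by
      intro w hwu hw
      have hwi : w ≠ i := by
        rintro rfl
        have := Fin.lt_def.1 hwu
        omega
      rcases insertPivot_cases h.isPivotArray hp' with ⟨w', hw', rfl⟩ | ⟨x, rfl⟩
      · rcases eq_of_explore_eq hw with h1 | rfl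
        · rwa [Function.update_of_ne hwi] at h1
        · exact absurd (hr.explore_pivot hπ (Fin.le_def.2 (by omega))
            (h.isPivotArray.update_some hw')) hne
      · rwa [Function.update_of_ne hwi] at hw
    have hcard : (earlierWith G p' v u).card ≤ (earlierWith G p v u).card := by
      apply Finset.card_le_card
      intro w hw
      simp only [earlierWith, Finset.mem_filter, Finset.mem_univ, true_and] at hw ⊢
      exact ⟨hw.1, hw.2.1, hsub w hw.1 hw.2.2⟩
    refine lt_of_le_of_lt (Nat.cast_le.2 hcard) ?_
    by_cases hui : u = i
    · subst hui
      by_cases hl : (π u : ℝ) * deg G u u ≤ L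
      · exact absurd (hnewlight v hvu hr hl).1 hne
      · exact hnew v hvu hr (not_le.1 hl) hne
    · exact h.few u v (hearly u hu hui) hvu hr
        fun h' => hne (insertPivot_eq_of_isRef h.isPivotArray hr h' hp')

theorem card_closedNbrs (i u : Fin n) : (closedNbrs G i u).card = deg G i u + 1 := by
  classical
  unfold closedNbrs deg
  rw [Finset.card_insert_of_notMem]
  simp [nbrs]

/-- Failure requires a heavy arrival with at least `ε d / 4` earlier neighbours holding the right
pivot. As the samples come from `d + 1 ≤ 2d` nodes, each hits such a neighbour with probability at
least `ε / 8`. One hit suffices: `v` then has the smallest rank among the candidates. -/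
theorem ev_insertPivot_not_faithful (hπ : Function.Injective π)
    (hL : ∀ v, IsPiv G π v v → (π v : ℝ) * fdeg G v ≤ L) (hε : 0 < ε)
    (h : IsFaithful G ε L π i p) :
    open Classical in
    ev (insertPivot G L s π i p) (fun p' => if IsFaithful G ε L π (i + 1) p' then 0 else 1) ≤
      ENNReal.ofReal (Real.exp (-(ε * s / 8))) := by
  classical
  by_cases hex : ∃ v < i, IsRef G π v i ∧ L < (π i : ℝ) * deg G i i ∧
      ε / 4 * deg G i i ≤ (earlierWith G p v i).card
  swap
  · have : ev (insertPivot G L s π i p)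
        (fun p' => if IsFaithful G ε L π (i + 1) p' then (0 : ℝ≥0∞) else 1) = 0 := by
      rw [ev_congr_support (g := fun _ => 0), ev_const]
      intro p' hp'
      rw [if_pos]
      refine isFaithful_insertPivot hπ hL h hp' fun v hv hr hl _ => ?_
      by_contra hcon
      exact hex ⟨v, hv, hr, hl, not_lt.1 hcon⟩
    rw [this]; exact zero_le
  obtain ⟨v, hv, hr, hl, hcard⟩ := hex
  have hadj : G.Adj i v := hr.1.1.resolve_left hv.ne
  have hpv := h.pivot v hv hr.2
  set W := earlierWith G p v i with hW
  have hWN : W ⊆ closedNbrs G i i := by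
    intro w hw
    simp only [hW, earlierWith, Finset.mem_filter, Finset.mem_univ, true_and] at hw
    exact mem_closedNbrs.2 (Or.inr ⟨hw.1.le, hw.2.1⟩)
  have hgood : ∀ p' ∈ (insertPivot G L s π i p).support, p' i = some v →
      IsFaithful G ε L π (i + 1) p' := by
    intro p' hp' hpi
    refine isFaithful_insertPivot hπ hL h hp' fun v' _ hr' _ hne => ?_
    rw [hr'.1.eq hπ hr.1] at hne
    exact absurd hpi hne
  have h1 : ev (insertPivot G L s π i p)
      (fun p' => if IsFaithful G ε L π (i + 1) p' then (0 : ℝ≥0∞) else 1) ≤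
      ev (insertPivot G L s π i p) (fun p' => if p' i = some v then 0 else 1) := by
    refine ev_mono_support fun p' hp' => ?_
    by_cases hpi : p' i = some v
    · rw [if_pos hpi, if_pos (hgood p' hp' hpi)]
    · rw [if_neg hpi]; split_ifs <;> simp
  refine h1.trans ?_
  unfold insertPivot
  rw [if_neg (not_le.2 hl)]
  simp only [ev_bind, ev_pure]
  have hd : 1 ≤ deg G i i := Finset.card_pos.2 ⟨v, by simp [nbrs, hv.le, hadj]⟩
  have hne : (closedNbrs G i i).Nonempty := Finset.insert_nonempty _ _
  have h2 : ev (iid (PMF.uniformOfFinset (closedNbrs G i i) hne) s)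
      (fun S => (S.map fun x => ENNReal.ofReal (if x ∈ W then 0 else 1)).prod) ≤
      ENNReal.ofReal (Real.exp (-(ε * s / 8))) := by
    rw [ev_iid_prod, ev_uniform_ofReal _ _ _ (fun a _ => by split_ifs <;> norm_num)]
    have hsum : (∑ a ∈ closedNbrs G i i, if a ∈ W then (0 : ℝ) else 1) =
        (deg G i i + 1) - W.card := by
      have e1 : ∀ a ∈ closedNbrs G i i, (if a ∈ W then (0 : ℝ) else 1) =
          1 - if a ∈ W then 1 else 0 := fun a _ => by split_ifs <;> norm_num
      rw [Finset.sum_congr rfl e1, Finset.sum_sub_distrib, Finset.sum_boole,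
        Finset.filter_mem_eq_inter, Finset.inter_eq_right.2 hWN]
      simp [card_closedNbrs]
    rw [hsum, card_closedNbrs, ← ENNReal.ofReal_pow]
    · apply ENNReal.ofReal_le_ofReal
      have hd' : (1 : ℝ) ≤ deg G i i := by exact_mod_cast hd
      have hbase : ((deg G i i + 1 : ℝ) - W.card) / ((deg G i i + 1 : ℕ) : ℝ) ≤
          Real.exp (-(ε / 8)) := by
        refine le_trans ?_ (Real.one_sub_le_exp_neg _)
        push_cast
        rw [div_le_iff₀ (by positivity)]
        nlinarith
      calc _ ≤ (Real.exp (-(ε / 8))) ^ s := by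
            gcongr
            · apply div_nonneg _ (Nat.cast_nonneg _)
              rw [← hsum]; exact Finset.sum_nonneg fun a _ => by split_ifs <;> norm_num
        _ = _ := by rw [← Real.exp_nat_mul]; congr 1; ring
    · apply div_nonneg _ (Nat.cast_nonneg _)
      rw [← hsum]; exact Finset.sum_nonneg fun a _ => by split_ifs <;> norm_num
  refine le_trans (ev_mono_support fun S hS => ?_) h2
  by_cases hhit : ∃ x ∈ S, x ∈ W
  · obtain ⟨x, hxS, hxW⟩ := hhit
    have hxW' := hxW
    simp only [hW, earlierWith, Finset.mem_filter, Finset.mem_univ, true_and] at hxW'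
    have harg : argminRank π (Finset.univ.filter fun v => G.Adj v i ∧
        ∃ x ∈ S, x ≠ i ∧ p x = some v) = some v := by
      refine argminRank_eq hπ ?_ fun w hw => ?_
      · rw [Finset.mem_filter]
        exact ⟨Finset.mem_univ _, hadj.symm, x, hxS, hxW'.1.ne, hxW'.2.2⟩
      · rw [Finset.mem_filter] at hw
        exact hr.1.2 w (Or.inr hw.2.1.symm)
    have hlt : π v < π i := lt_of_le_of_ne (hr.1.2 i (Or.inl rfl)) fun e => hv.ne (hπ e)
    rw [harg]
    dsimp only
    simp [hlt]
  · have hone : (S.map fun x => ENNReal.ofReal (if x ∈ W then 0 else 1)).prod = 1 := by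
      apply List.prod_eq_one
      intro a ha
      obtain ⟨x, hx, rfl⟩ := List.mem_map.1 ha
      rw [if_neg fun hxW => hhit ⟨x, hx, hxW⟩, ENNReal.ofReal_one]
    rw [hone]
    split_ifs <;> simp

/-- The pivot array is faithful with high probability. -/
theorem ev_pivotProcess_not_faithful (hπ : Function.Injective π)
    (hL : ∀ v, IsPiv G π v v → (π v : ℝ) * fdeg G v ≤ L) (hε : 0 < ε) :
    ∀ k ≤ n, open Classical in
    ev (pivotProcess G L s π k) (fun p => if IsFaithful G ε L π k p then 0 else 1) ≤
      k * ENNReal.ofReal (Real.exp (-(ε * s / 8))) := by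
  classical
  intro k
  induction k with
  | zero =>
    intro _
    have : IsFaithful G ε L π 0 (fun _ => none) :=
      ⟨fun z w h => (by cases h), fun v h => absurd h (Nat.not_lt_zero _),
        fun u v h => absurd h (Nat.not_lt_zero _), fun u v w h => absurd h (Nat.not_lt_zero _),
        fun u v h => absurd h (Nat.not_lt_zero _)⟩
    simp [pivotProcess, foldPrefix_zero, ev_pure, this]
  | succ k ih =>
    intro hk
    have hR : pivotProcess G L s π (k + 1) =
        pivotProcess G L s π k >>= fun p => insertPivot G L s π ⟨k, hk⟩ p := foldPrefix_succ _ _ hk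
    rw [hR, ev_bind]
    push_cast
    rw [add_mul, one_mul]
    refine le_trans (ev_mono (g := fun p => (if IsFaithful G ε L π k p then 0 else 1) +
      ENNReal.ofReal (Real.exp (-(ε * s / 8)))) fun p => ?_) ?_
    · by_cases hp : IsFaithful G ε L π k p
      · rw [if_pos hp, zero_add]
        exact ev_insertPivot_not_faithful hπ hL hε (i := ⟨k, hk⟩) hp
      · rw [if_neg hp]
        refine le_trans (ev_mono (g := fun _ => 1) fun p' => ?_) ?_
        · split_ifs <;> simp
        · rw [ev_const]; exact le_self_add
    · rw [ev_add, ev_const]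
      gcongr
      exact ih (by omega)

end pivots


/-! ### The cost of the nodes that miss their pivot -/

section poor
variable {n : ℕ} {G : SimpleGraph (Fin n)} {ε L : ℝ} {π : Fin n → unitInterval}
  {u v w : Fin n} {p : Fin n → Option (Fin n)}

/-- The cluster of `v` in the reference clustering. -/
noncomputable def refCluster (G : SimpleGraph (Fin n)) (π : Fin n → unitInterval) (v : Fin n) :
    Finset (Fin n) :=
  open Classical in Finset.univ.filter fun u => IsRef G π v u

/-- The nodes of the cluster of `v` that do not have the pivot `v`. -/
noncomputable def poorNodes (G : SimpleGraph (Fin n)) (π : Fin n → unitInterval)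
    (p : Fin n → Option (Fin n)) (v : Fin n) : Finset (Fin n) :=
  open Classical in (refCluster G π v).filter fun u => p u ≠ some v

/-- The later neighbours of `u` in the cluster of `v`. -/
noncomputable def laterIn (G : SimpleGraph (Fin n)) (π : Fin n → unitInterval) (v u : Fin n) :
    Finset (Fin n) :=
  open Classical in Finset.univ.filter fun w => u < w ∧ G.Adj u w ∧ IsRef G π v w

/-- Those nodes of `laterIn` at whose arrival the degrees are small. -/
noncomputable def laterLow (G : SimpleGraph (Fin n)) (ε : ℝ) (π : Fin n → unitInterval)
    (v u : Fin n) : Finset (Fin n) :=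
  open Classical in (laterIn G π v u).filter fun w =>
    ε ^ 2 * deg G w w ≤ (laterIn G π v u).card ∧ ε ^ 2 * deg G w v ≤ (laterIn G π v u).card

/-- The earlier neighbours of `u` that miss their pivot `v`. -/
noncomputable def earlierPoor (G : SimpleGraph (Fin n)) (π : Fin n → unitInterval)
    (p : Fin n → Option (Fin n)) (v u : Fin n) : Finset (Fin n) :=
  open Classical in Finset.univ.filter fun w => w < u ∧ G.Adj u w ∧ w ∈ poorNodes G π p v

/-- Number of edges from `u` to other clusters, for `u` in the cluster of `v`. -/
noncomputable def cutDeg (G : SimpleGraph (Fin n)) (π : Fin n → unitInterval) (v u : Fin n) : ℝ :=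
  ∑ y ∈ Finset.univ \ refCluster G π v, adjW G u y

/-- Number of non-edges from `u` inside the cluster of `v`. -/
noncomputable def nonDeg (G : SimpleGraph (Fin n)) (π : Fin n → unitInterval) (v u : Fin n) : ℝ :=
  ∑ y ∈ refCluster G π v, nonW G u y

theorem mem_refCluster : u ∈ refCluster G π v ↔ IsRef G π v u := by simp [refCluster]

theorem mem_poorNodes : u ∈ poorNodes G π p v ↔ IsRef G π v u ∧ p u ≠ some v := by
  simp [poorNodes, mem_refCluster]

theorem poorNodes_subset : poorNodes G π p v ⊆ refCluster G π v := Finset.filter_subset _ _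

theorem cutDeg_nonneg (v u : Fin n) : 0 ≤ cutDeg G π v u :=
  Finset.sum_nonneg fun y _ => adjW_nonneg u y

theorem nonDeg_nonneg (v u : Fin n) : 0 ≤ nonDeg G π v u :=
  Finset.sum_nonneg fun y _ => nonW_nonneg u y

open Classical in
theorem card_filter_adj (P : Fin n → Prop) [DecidablePred P] (u : Fin n) :
    ((Finset.univ.filter fun w => P w ∧ G.Adj u w).card : ℝ) =
      ∑ w, if P w then adjW G u w else 0 := by
  rw [Finset.card_filter, Nat.cast_sum]
  refine Finset.sum_congr rfl fun w _ => ?_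
  unfold adjW
  by_cases h : P w <;> by_cases h' : G.Adj u w <;> simp [h, h']

open Classical in
theorem card_laterIn : ((laterIn G π v u).card : ℝ) =
    ∑ w, if u < w ∧ w ∈ refCluster G π v then adjW G u w else 0 := by
  refine Eq.trans ?_ (card_filter_adj (fun w => u < w ∧ w ∈ refCluster G π v) u)
  congr 2; ext w; simp [laterIn, mem_refCluster]; tauto

open Classical in
theorem card_earlierWith : ((earlierWith G p v u).card : ℝ) =
    ∑ w, if w < u ∧ p w = some v then adjW G u w else 0 := by
  refine Eq.trans ?_ (card_filter_adj (fun w => w < u ∧ p w = some v) u)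
  congr 2; ext w; simp [earlierWith]; tauto

open Classical in
theorem card_earlierPoor : ((earlierPoor G π p v u).card : ℝ) =
    ∑ w, if w < u ∧ w ∈ poorNodes G π p v then adjW G u w else 0 := by
  refine Eq.trans ?_ (card_filter_adj (fun w => w < u ∧ w ∈ poorNodes G π p v) u)
  congr 2; ext w; simp [earlierPoor]; tauto

open Classical in
theorem cutDeg_eq : cutDeg G π v u = ∑ w, if w ∈ refCluster G π v then 0 else adjW G u w := by
  unfold cutDeg
  rw [← Finset.compl_eq_univ_sdiff, ← Finset.sum_filter_not_add_sum_filter (s := Finset.univ)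
    (p := fun w => w ∈ refCluster G π v)]
  rw [Finset.sum_ite_of_false, Finset.sum_ite_of_true, Finset.sum_const_zero, add_zero]
  · congr 1; ext w; simp
  · intro w hw; exact (Finset.mem_filter.1 hw).2
  · intro w hw; exact (Finset.mem_filter.1 hw).2

/-- Making the poor nodes singletons. -/
theorem val_sdiff_poorNodes_le : val G (refCluster G π v \ poorNodes G π p v) ≤
    val G (refCluster G π v) + 2 * ∑ u ∈ poorNodes G π p v,
      (((laterIn G π v u).card : ℝ) + (earlierWith G p v u).card) := by
  classical
  set R := refCluster G π v with hR
  set P := poorNodes G π p v with hP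
  have h1 : nSum G (R \ P) (R \ P) ≤ nSum G R R := nSum_mono Finset.sdiff_subset Finset.sdiff_subset
  have hsum : ∀ S : Finset (Fin n), eSum G S S = ∑ x, ∑ y, if x ∈ S ∧ y ∈ S then adjW G x y else 0 := by
    intro S
    unfold eSum
    rw [← Finset.sum_filter_add_sum_filter_not (s := Finset.univ) (p := fun x => x ∈ S)]
    rw [Finset.sum_eq_zero (s := Finset.univ.filter fun x => x ∉ S), add_zero]
    · rw [Finset.filter_mem_eq_inter, Finset.univ_inter]
      refine Finset.sum_congr rfl fun x hx => ?_
      rw [← Finset.sum_filter]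
      congr 1; ext y; simp [hx]
    · intro x hx
      exact Finset.sum_eq_zero fun y _ => by simp [(Finset.mem_filter.1 hx).2]
  -- Each inner edge that is lost is charged to a poor endpoint: to the earlier endpoint if that is
  -- poor, as an edge to a later node of the cluster; otherwise to the later endpoint, as an edge to
  -- an earlier node with pivot `v`.
  set t : Fin n → Fin n → ℝ := fun x y => if x ∈ P then
      ((if x < y ∧ y ∈ R then adjW G x y else 0) +
        if y < x ∧ p y = some v then adjW G x y else 0) else 0 with ht
  have ht0 : ∀ x y, 0 ≤ t x y := by
    intro x y
    have := adjW_nonneg (G := G) x y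
    simp only [ht]
    split_ifs <;> linarith
  have hpt : ∀ x y, (if x ∈ R ∧ y ∈ R then adjW G x y else 0) ≤
      (if x ∈ R \ P ∧ y ∈ R \ P then adjW G x y else 0) + (t x y + t y x) := by
    intro x y
    by_cases hxy : x ∈ R ∧ y ∈ R
    swap
    · rw [if_neg hxy, if_neg]
      · linarith [ht0 x y, ht0 y x]
      · rintro ⟨h1, h2⟩; exact hxy ⟨(Finset.mem_sdiff.1 h1).1, (Finset.mem_sdiff.1 h2).1⟩
    obtain ⟨hx, hy⟩ := hxy
    rw [if_pos ⟨hx, hy⟩]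
    have hpx : x ∉ P → p x = some v := fun h => by
      by_contra h'; exact h (mem_poorNodes.2 ⟨mem_refCluster.1 hx, h'⟩)
    have hpy : y ∉ P → p y = some v := fun h => by
      by_contra h'; exact h (mem_poorNodes.2 ⟨mem_refCluster.1 hy, h'⟩)
    have ha := adjW_nonneg (G := G) x y
    have hc := adjW_comm (G := G) x y
    rcases lt_trichotomy x y with h | h | h
    · by_cases hxP : x ∈ P
      · have : adjW G x y ≤ t x y := by simp only [ht]; simp [hxP, h, hy, h.not_gt]
        have := ht0 y x
        split_ifs <;> linarith
      · by_cases hyP : y ∈ P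
        · have : adjW G x y ≤ t y x := by
            simp only [ht]; simp [hyP, h, h.not_gt, hpx hxP, hc]
          have := ht0 x y
          split_ifs <;> linarith
        · rw [if_pos ⟨Finset.mem_sdiff.2 ⟨hx, hxP⟩, Finset.mem_sdiff.2 ⟨hy, hyP⟩⟩]
          linarith [ht0 x y, ht0 y x]
    · subst h
      rw [adjW_self]
      have := ht0 x x
      split_ifs <;> linarith
    · by_cases hyP : y ∈ P
      · have : adjW G x y ≤ t y x := by simp only [ht]; simp [hyP, h, hx, h.not_gt, hc]
        have := ht0 x y
        split_ifs <;> linarith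
      · by_cases hxP : x ∈ P
        · have : adjW G x y ≤ t x y := by
            simp only [ht]; simp [hxP, h, h.not_gt, hpy hyP]
          have := ht0 y x
          split_ifs <;> linarith
        · rw [if_pos ⟨Finset.mem_sdiff.2 ⟨hx, hxP⟩, Finset.mem_sdiff.2 ⟨hy, hyP⟩⟩]
          linarith [ht0 x y, ht0 y x]
  have h2 : eSum G R R ≤ eSum G (R \ P) (R \ P) + 2 * ∑ x, ∑ y, t x y := by
    rw [hsum R, hsum (R \ P), two_mul]
    nth_rw 4 [Finset.sum_comm]
    rw [← Finset.sum_add_distrib, ← Finset.sum_add_distrib]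
    refine Finset.sum_le_sum fun x _ => ?_
    rw [← Finset.sum_add_distrib, ← Finset.sum_add_distrib]
    exact Finset.sum_le_sum fun y _ => hpt x y
  have h3 : ∑ x, ∑ y, t x y = ∑ u ∈ P,
      (((laterIn G π v u).card : ℝ) + (earlierWith G p v u).card) := by
    rw [← Finset.sum_filter_add_sum_filter_not (s := Finset.univ) (p := fun x => x ∈ P)]
    rw [Finset.sum_eq_zero (s := Finset.univ.filter fun x => x ∉ P), add_zero]
    · rw [Finset.filter_mem_eq_inter, Finset.univ_inter]
      refine Finset.sum_congr rfl fun x hx => ?_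
      rw [card_laterIn, card_earlierWith, ← Finset.sum_add_distrib]
      exact Finset.sum_congr rfl fun y _ => by simp only [ht]; rw [if_pos hx]
    · intro x hx
      exact Finset.sum_eq_zero fun y _ => by simp only [ht]; rw [if_neg (Finset.mem_filter.1 hx).2]
  rw [h3] at h2
  unfold val
  linarith

/-- An earlier neighbour lies outside the cluster, or is itself poor, or has the pivot `v`. -/
theorem deg_self_le (u : Fin n) : (deg G u u : ℝ) ≤
    cutDeg G π v u + (earlierPoor G π p v u).card + (earlierWith G p v u).card := by
  classical
  rw [deg_eq_sum, cutDeg_eq, card_earlierPoor, card_earlierWith, ← Finset.sum_add_distrib,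
    ← Finset.sum_add_distrib, ← Finset.sum_filter_add_sum_filter_not (s := Finset.univ)
    (p := fun y => y ≤ u)]
  have h0 : ∀ y, 0 ≤ adjW G u y := fun y => adjW_nonneg u y
  refine le_add_of_le_of_nonneg ?_ (Finset.sum_nonneg fun y _ => ?_)
  · rw [show Finset.univ.filter (fun y => y ≤ u) = Finset.Iic u by ext; simp]
    refine Finset.sum_le_sum fun y hy => ?_
    have := h0 y
    by_cases hyu : y = u
    · subst hyu; simp [adjW_self]
    have hlt : y < u := lt_of_le_of_ne (Finset.mem_Iic.1 hy) hyu
    by_cases hR : y ∈ refCluster G π v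
    · by_cases hp : p y = some v
      · simp only [hR, hlt, hp, and_self, if_true]
        split_ifs <;> linarith
      · have hP : y ∈ poorNodes G π p v := mem_poorNodes.2 ⟨mem_refCluster.1 hR, hp⟩
        simp only [hR, hlt, hP, hp, and_self, and_false, if_true, if_false]
        linarith
    · simp only [hR, if_false]
      split_ifs <;> linarith
  · have := h0 y
    split_ifs <;> linarith

theorem card_refCluster_le (hu : u ∈ refCluster G π v) : ((refCluster G π v).card : ℝ) - 1 ≤
    (laterIn G π v u).card + (earlierPoor G π p v u).card + (earlierWith G p v u).card +
      nonDeg G π v u := by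
  classical
  rw [← eSum_singleton_add_nSum (G := G) hu]
  unfold nonDeg
  refine add_le_add ?_ le_rfl
  rw [card_laterIn, card_earlierPoor, card_earlierWith, ← Finset.sum_add_distrib,
    ← Finset.sum_add_distrib]
  have h0 : ∀ y, 0 ≤ adjW G u y := fun y => adjW_nonneg u y
  refine (Finset.sum_le_sum fun y hy => ?_).trans
    (Finset.sum_le_sum_of_subset_of_nonneg (Finset.subset_univ _) fun y _ _ => ?_)
  · have := h0 y
    rcases lt_trichotomy y u with h | h | h
    · by_cases hp : p y = some v
      · simp only [h, h.not_gt, hp, and_self, if_true, false_and, if_false]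
        split_ifs <;> linarith
      · have hP : y ∈ poorNodes G π p v := mem_poorNodes.2 ⟨mem_refCluster.1 hy, hp⟩
        simp only [h, h.not_gt, hP, hp, and_self, and_false, if_true, if_false, false_and]
        linarith
    · subst h; simp [adjW_self]
    · simp [h, h.not_gt, hy]
  · have := h0 y
    split_ifs <;> linarith

/-- Double counting: if `w` is an earlier poor neighbour of the poor node `u`, then `u` is a later
neighbour of `w` in the same cluster. -/
theorem sum_earlierPoor_le : ∑ u ∈ poorNodes G π p v, ((earlierPoor G π p v u).card : ℝ) ≤
    ∑ u ∈ poorNodes G π p v, ((laterIn G π v u).card : ℝ) := by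
  classical
  have h1 : ∀ u, ((earlierPoor G π p v u).card : ℝ) =
      ∑ w ∈ poorNodes G π p v, if w < u then adjW G u w else 0 := by
    intro u
    rw [card_earlierPoor]
    rw [← Finset.sum_filter_add_sum_filter_not (s := Finset.univ)
      (p := fun w => w ∈ poorNodes G π p v)]
    rw [Finset.sum_eq_zero (s := Finset.univ.filter fun w => w ∉ poorNodes G π p v), add_zero]
    · rw [Finset.filter_mem_eq_inter, Finset.univ_inter]
      exact Finset.sum_congr rfl fun w hw => by simp [hw]
    · intro w hw; simp [(Finset.mem_filter.1 hw).2]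
  simp_rw [h1]
  rw [Finset.sum_comm]
  refine Finset.sum_le_sum fun w _ => ?_
  rw [card_laterIn]
  refine (Finset.sum_le_sum fun u hu => ?_).trans
    (Finset.sum_le_sum_of_subset_of_nonneg (Finset.subset_univ _) fun y _ _ => ?_)
  · rw [adjW_comm]
    simp [poorNodes_subset hu]
  · have := adjW_nonneg (G := G) w y
    split_ifs <;> linarith

theorem poorNodes_lt (hf : IsFaithful G ε L π n p) (hu : u ∈ poorNodes G π p v) : v < u := by
  obtain ⟨h1, h2⟩ := mem_poorNodes.1 hu
  rcases lt_trichotomy u v with h | h | h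
  · exact absurd (hf.of_lt u v v.2 h h1) h2
  · subst h; exact absurd (hf.pivot u u.2 h1.2) h2
  · exact h

/-- Combine `few` with `deg_self_le` and solve for the number of earlier neighbours with pivot `v`,
which occurs on both sides. -/
theorem card_earlierWith_le (hε : 0 < ε) (hε' : ε < 1 / 1000) (hf : IsFaithful G ε L π n p)
    (hu : u ∈ poorNodes G π p v) : ((earlierWith G p v u).card : ℝ) ≤
      ε / 2 * (cutDeg G π v u + (earlierPoor G π p v u).card) := by
  have h1 := hf.few u v u.2 (poorNodes_lt hf hu) (mem_poorNodes.1 hu).1 (mem_poorNodes.1 hu).2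
  have h2 := deg_self_le (G := G) (π := π) (p := p) (v := v) u
  have h3 := cutDeg_nonneg (G := G) (π := π) v u
  have h4 : ε / 4 * deg G u u ≤ ε / 4 * (cutDeg G π v u + (earlierPoor G π p v u).card +
    (earlierWith G p v u).card) := by gcongr
  set X := cutDeg G π v u + (earlierPoor G π p v u).card with hX
  have h5 : 0 ≤ X := by positivity
  set b : ℝ := ((earlierWith G p v u).card : ℝ) with hb
  have h6 : 0 ≤ b := Nat.cast_nonneg _
  have : ε * b ≤ 1 / 1000 * b := by gcongr
  have : 0 ≤ ε * X := by positivity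
  nlinarith

/-- The condition on the ranks under which the light arrivals repair the pivots. -/
def HasLightNodes (G : SimpleGraph (Fin n)) (ε L : ℝ) (π : Fin n → unitInterval) : Prop :=
  ∀ u v, v < u → IsRef G π v u → 1 ≤ (laterIn G π v u).card →
    (laterIn G π v u).card ≤ 2 * (laterLow G ε π v u).card →
      ∃ w ∈ laterLow G ε π v u, (π w : ℝ) * (laterIn G π v u).card ≤ ε ^ 2 * L

/-- A light low node would have caused an exploration from `v` and repaired `u`, so fewer than half
of the later neighbours are low. Either the degree of `v` was large at some such arrival, or each
node that is not low had large degree at its own arrival. -/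
theorem laterIn_cases (hε : 0 < ε) (hf : IsFaithful G ε L π n p) (hH : HasLightNodes G ε L π)
    (hu : u ∈ poorNodes G π p v) (hα : 1 ≤ (laterIn G π v u).card) :
    ((laterIn G π v u).card : ℝ) < ε ^ 2 * fdeg G v ∨ ∃ S ⊆ refCluster G π v,
      (laterIn G π v u).card ≤ 2 * S.card ∧
      ∀ w ∈ S, ((laterIn G π v u).card : ℝ) ≤ ε ^ 2 * fdeg G w := by
  classical
  have hvu := poorNodes_lt hf hu
  obtain ⟨hr, hne⟩ := mem_poorNodes.1 hu
  have hcard : 2 * (laterLow G ε π v u).card < (laterIn G π v u).card := by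
    by_contra hcon
    obtain ⟨w, hw, hlight⟩ := hH u v hvu hr hα (not_lt.1 hcon)
    unfold laterLow at hw
    rw [Finset.mem_filter] at hw
    obtain ⟨hw1, hw2, hw3⟩ := hw
    simp only [laterIn, Finset.mem_filter, Finset.mem_univ, true_and] at hw1
    have hπw := (π w).2.1
    have hε2 : 0 < ε ^ 2 := by positivity
    have key : ∀ d : ℝ, ε ^ 2 * d ≤ (laterIn G π v u).card → (π w : ℝ) * d ≤ L := by
      intro d hd
      have h1 : (π w : ℝ) * (ε ^ 2 * d) ≤ (π w : ℝ) * (laterIn G π v u).card := by gcongr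
      have h2 : ε ^ 2 * ((π w : ℝ) * d) ≤ ε ^ 2 * L := by linarith
      exact le_of_mul_le_mul_left h2 hε2
    exact hne (hf.of_light u v w w.2 hw1.1 (hvu.trans hw1.1) hr hw1.2.2 (key _ hw2) (key _ hw3))
  by_cases hex : ∃ w ∈ laterIn G π v u, ((laterIn G π v u).card : ℝ) < ε ^ 2 * deg G w v
  · obtain ⟨w, _, hw⟩ := hex
    left
    refine hw.trans_le ?_
    gcongr
    exact deg_le_fdeg w v
  · push Not at hex
    right
    refine ⟨laterIn G π v u \ laterLow G ε π v u, ?_, ?_, ?_⟩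
    · intro w hw
      have := (Finset.mem_sdiff.1 hw).1
      simp only [laterIn, Finset.mem_filter, Finset.mem_univ, true_and] at this
      exact mem_refCluster.2 this.2.2
    · have hsub : laterLow G ε π v u ⊆ laterIn G π v u := Finset.filter_subset _ _
      have := Finset.card_sdiff_add_card_eq_card hsub
      omega
    · intro w hw
      obtain ⟨hw1, hw2⟩ := Finset.mem_sdiff.1 hw
      have h1 : ((laterIn G π v u).card : ℝ) ≤ ε ^ 2 * deg G w w := by
        by_contra hcon
        exact hw2 (Finset.mem_filter.2 ⟨hw1, (not_le.1 hcon).le, hex w hw1⟩)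
      refine h1.trans ?_
      gcongr
      exact deg_le_fdeg w w

theorem fdeg_le (w : Fin n) : fdeg G w ≤ cutDeg G π v w + (refCluster G π v).card := by
  classical
  have h1 : fdeg G w = cutDeg G π v w + ∑ y ∈ refCluster G π v, adjW G w y := by
    unfold fdeg cutDeg
    rw [Finset.sum_sdiff (Finset.subset_univ _)]
  rw [h1]
  gcongr
  calc _ ≤ ∑ y ∈ refCluster G π v, (1 : ℝ) := Finset.sum_le_sum fun y _ => adjW_le_one w y
    _ = _ := by simp

/-- If few nodes of the cluster are later neighbours of `u`, and few are earlier neighbours with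
pivot `v`, then nearly all are non-neighbours or earlier poor neighbours. Together with the cut
edges at `u` these bound the cluster size, hence `ε` times it. -/
theorem card_laterIn_le_of_small (hε : 0 < ε) (hε' : ε < 1 / 1000) (hf : IsFaithful G ε L π n p)
    (hu : u ∈ poorNodes G π p v) (hα : 1 ≤ (laterIn G π v u).card)
    (hsmall : ((laterIn G π v u).card : ℝ) < ε * (refCluster G π v).card) :
    ((laterIn G π v u).card : ℝ) ≤
      2 * ε * (cutDeg G π v u + nonDeg G π v u + (earlierPoor G π p v u).card) := by
  have h1 := card_earlierWith_le hε hε' hf hu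
  have h2 := card_refCluster_le (p := p) (poorNodes_subset hu)
  have h3 : (1 : ℝ) ≤ (laterIn G π v u).card := by exact_mod_cast hα
  have h4 := cutDeg_nonneg (G := G) (π := π) v u
  have h5 := nonDeg_nonneg (G := G) (π := π) v u
  set a : ℝ := ((laterIn G π v u).card : ℝ)
  set r : ℝ := ((refCluster G π v).card : ℝ)
  set c := cutDeg G π v u
  set m := nonDeg G π v u
  set g : ℝ := ((earlierPoor G π p v u).card : ℝ)
  set b : ℝ := ((earlierWith G p v u).card : ℝ)
  have h6 : 0 ≤ g := Nat.cast_nonneg _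
  have h7 : ε / 2 * (c + g) ≤ 1 / 2 * (c + g) := by gcongr; linarith
  have h8 : 0 ≤ r := Nat.cast_nonneg _
  have h9 : ε * r ≤ 1 / 1000 * r := by gcongr
  have h10 : r ≤ 2 * (c + m + g) := by nlinarith
  nlinarith

/-- The total number of later neighbours of the poor nodes. -/
theorem sum_laterIn_le (hε : 0 < ε) (hε' : ε < 1 / 1000) (hf : IsFaithful G ε L π n p)
    (hH : HasLightNodes G ε L π) : open Classical in
    ∑ u ∈ poorNodes G π p v, ((laterIn G π v u).card : ℝ) ≤
      5 * ε * ∑ u ∈ refCluster G π v, (cutDeg G π v u + nonDeg G π v u) +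
      2 * ε ^ 3 * if IsPiv G π v v ∧ ((refCluster G π v).card : ℝ) < ε * fdeg G v
        then fdeg G v ^ 2 else 0 := by
  classical
  set R := refCluster G π v with hR
  set P := poorNodes G π p v with hP
  set α : Fin n → ℝ := fun u => ((laterIn G π v u).card : ℝ) with hα
  set I := if IsPiv G π v v ∧ (R.card : ℝ) < ε * fdeg G v then fdeg G v ^ 2 else 0 with hI
  set cst : Fin n → ℝ := fun u => cutDeg G π v u + nonDeg G π v u with hcst
  have hcst0 : ∀ u, 0 ≤ cst u := fun u => add_nonneg (cutDeg_nonneg _ _) (nonDeg_nonneg _ _)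
  have hI0 : 0 ≤ I := by rw [hI]; split_ifs <;> positivity
  have hPR : P ⊆ R := poorNodes_subset
  set T := ∑ u ∈ R, cst u with hT
  have hT0 : 0 ≤ T := Finset.sum_nonneg fun u _ => hcst0 u
  set big := P.filter fun u => 1 ≤ (laterIn G π v u).card ∧ ε * R.card ≤ α u with hbig
  -- Even `|R|` copies of `u` are affordable. If the degree of `v` is large, `|R| < ε d(v)` and the
  -- product is at most `ε³ d(v)²`. Otherwise at least `α / 2` nodes of the cluster have cut degree
  -- at least `(1 - ε) α / ε²`, so `(1 - ε) α² ≤ 2ε² T`, and `ε |R| ≤ α` finishes.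
  have hbigcase : ∀ u ∈ big, (R.card : ℝ) * α u ≤ 2.1 * ε * T + ε ^ 3 * I := by
    intro u hu
    obtain ⟨huP, hu1, hu2⟩ := Finset.mem_filter.1 hu
    have hαpos : (1 : ℝ) ≤ α u := by simp only [hα]; exact_mod_cast hu1
    have hr0 : (0 : ℝ) ≤ R.card := Nat.cast_nonneg _
    rcases laterIn_cases hε hf hH huP hu1 with h | ⟨S, hS, hScard, hdeg⟩
    · have hlt : (R.card : ℝ) < ε * fdeg G v := by
        have : ε * R.card < ε * (ε * fdeg G v) := by
          calc ε * R.card ≤ α u := hu2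
            _ < ε ^ 2 * fdeg G v := h
            _ = _ := by ring
        exact lt_of_mul_lt_mul_left this hε.le
      have hpiv : IsPiv G π v v := (mem_poorNodes.1 huP).1.2
      rw [hI, if_pos ⟨hpiv, hlt⟩]
      have hf0 := fdeg_nonneg (G := G) v
      have : (R.card : ℝ) * α u ≤ (ε * fdeg G v) * (ε ^ 2 * fdeg G v) :=
        mul_le_mul hlt.le h.le (by linarith) (by positivity)
      have : 0 ≤ 2.1 * ε * T := by positivity
      calc _ ≤ (ε * fdeg G v) * (ε ^ 2 * fdeg G v) := by assumption
        _ ≤ _ := by nlinarith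
    · have hSα : α u ≤ 2 * (S.card : ℝ) := by simp only [hα]; exact_mod_cast hScard
      have hcut : ∀ w ∈ S, α u * (1 - ε) ≤ ε ^ 2 * cst w := by
        intro w hw
        have h1 := hdeg w hw
        have h2 := fdeg_le (G := G) (π := π) (v := v) w
        have h3 : ε ^ 2 * fdeg G w ≤ ε ^ 2 * (cutDeg G π v w + R.card) := by gcongr
        have h4 : ε ^ 2 * (R.card : ℝ) ≤ ε * α u := by
          calc ε ^ 2 * (R.card : ℝ) = ε * (ε * R.card) := by ring
            _ ≤ ε * α u := by gcongr
        have h5 : ε ^ 2 * cutDeg G π v w ≤ ε ^ 2 * cst w := by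
          gcongr; simp only [hcst]; linarith [nonDeg_nonneg (G := G) (π := π) v w]
        have : α u ≤ ε ^ 2 * fdeg G w := h1
        linarith
      have hsum : (S.card : ℝ) * (α u * (1 - ε)) ≤ ε ^ 2 * T := by
        calc (S.card : ℝ) * (α u * (1 - ε)) = ∑ w ∈ S, α u * (1 - ε) := by simp
          _ ≤ ∑ w ∈ S, ε ^ 2 * cst w := Finset.sum_le_sum hcut
          _ = ε ^ 2 * ∑ w ∈ S, cst w := by rw [Finset.mul_sum]
          _ ≤ ε ^ 2 * T := by
            gcongr
            exact Finset.sum_le_sum_of_subset_of_nonneg hS fun w _ _ => hcst0 w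
      have h1 : 0 ≤ ε ^ 3 * I := by positivity
      have h2 : (1 - ε) * (α u * α u) ≤ 2 * (ε ^ 2 * T) := by
        have : α u * (α u * (1 - ε)) ≤ 2 * (S.card : ℝ) * (α u * (1 - ε)) := by
          gcongr
          apply mul_nonneg <;> linarith
        linarith
      have h3 : ε * ((R.card : ℝ) * α u) ≤ α u * α u := by
        rw [← mul_assoc]; gcongr
      have h4 : (1 - ε) * (ε * ((R.card : ℝ) * α u)) ≤ (1 - ε) * (α u * α u) := by
        gcongr; linarith
      have h5 : ε * ((1 - ε) * ((R.card : ℝ) * α u)) ≤ ε * (2 * (ε * T)) := by linarith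
      have h6 := le_of_mul_le_mul_left h5 hε
      have h7 : 0 ≤ (R.card : ℝ) * α u := by positivity
      have h8 : (1 - 1 / 1000) * ((R.card : ℝ) * α u) ≤ (1 - ε) * ((R.card : ℝ) * α u) := by gcongr
      have h9 : 0 ≤ ε * T := by positivity
      linarith
  -- At most `|R|` nodes are big, so `|R|` times the largest `α` bounds the sum.
  have hbigsum : ∑ u ∈ big, α u ≤ 2.1 * ε * T + ε ^ 3 * I := by
    rcases big.eq_empty_or_nonempty with he | hne
    · rw [he, Finset.sum_empty]; positivity
    · obtain ⟨m, hm, hmax⟩ := Finset.exists_max_image big α hne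
      refine le_trans ?_ (hbigcase m hm)
      calc ∑ u ∈ big, α u ≤ ∑ u ∈ big, α m := Finset.sum_le_sum hmax
        _ = (big.card : ℝ) * α m := by simp
        _ ≤ _ := by
          have : big.card ≤ R.card := Finset.card_le_card ((Finset.filter_subset _ _).trans hPR)
          have h' : (0 : ℝ) ≤ α m := Nat.cast_nonneg _
          gcongr
  have hpt : ∀ u ∈ P, α u ≤ 2 * ε * (cst u + (earlierPoor G π p v u).card) +
      if u ∈ big then α u else 0 := by
    intro u hu
    have h0 : 0 ≤ 2 * ε * (cst u + (earlierPoor G π p v u).card) := by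
      have := hcst0 u; positivity
    by_cases hub : u ∈ big
    · rw [if_pos hub]; linarith
    · rw [if_neg hub, add_zero]
      by_cases h1 : 1 ≤ (laterIn G π v u).card
      · have h2 : α u < ε * R.card := by
          by_contra hcon
          exact hub (Finset.mem_filter.2 ⟨hu, h1, not_lt.1 hcon⟩)
        exact card_laterIn_le_of_small hε hε' hf hu h1 h2
      · have : α u = 0 := by simp only [hα]; exact_mod_cast (by omega : (laterIn G π v u).card = 0)
        rw [this]; exact h0
  have hsum := Finset.sum_le_sum hpt
  rw [Finset.sum_add_distrib, ← Finset.mul_sum, Finset.sum_add_distrib] at hsum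
  have e1 : ∑ u ∈ P, (if u ∈ big then α u else 0) = ∑ u ∈ big, α u := by
    rw [← Finset.sum_filter]
    congr 1
    ext u
    simp only [Finset.mem_filter]
    exact ⟨fun h => h.2, fun h => ⟨(Finset.mem_filter.1 h).1, h⟩⟩
  have e2 : ∑ u ∈ P, cst u ≤ T :=
    Finset.sum_le_sum_of_subset_of_nonneg hPR fun u _ _ => hcst0 u
  have e3 := sum_earlierPoor_le (G := G) (π := π) (p := p) (v := v)
  rw [e1] at hsum
  have e4 : 2 * ε * (∑ u ∈ P, cst u + ∑ u ∈ P, ((earlierPoor G π p v u).card : ℝ)) ≤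
      2 * ε * (T + ∑ u ∈ P, α u) := by gcongr
  set X := ∑ u ∈ P, α u
  have hX0 : 0 ≤ X := Finset.sum_nonneg fun u _ => Nat.cast_nonneg _
  -- The earlier poor neighbours bring back `2 ε X`, which is absorbed on the left.
  have e5 : ε * X ≤ 1 / 1000 * X := mul_le_mul_of_nonneg_right hε'.le hX0
  have e6 : 0 ≤ ε * T := mul_nonneg hε.le hT0
  have e7 : 0 ≤ ε ^ 3 * I := mul_nonneg (pow_nonneg hε.le 3) hI0
  linarith

theorem val_sdiff_poorNodes_le' (hε : 0 < ε) (hε' : ε < 1 / 1000) (hf : IsFaithful G ε L π n p)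
    (hH : HasLightNodes G ε L π) : open Classical in
    val G (refCluster G π v \ poorNodes G π p v) ≤ val G (refCluster G π v) +
      12 * ε * ∑ u ∈ refCluster G π v, (cutDeg G π v u + nonDeg G π v u) +
      5 * ε ^ 3 * if IsPiv G π v v ∧ ((refCluster G π v).card : ℝ) < ε * fdeg G v
        then fdeg G v ^ 2 else 0 := by
  classical
  have h1 := val_sdiff_poorNodes_le (G := G) (π := π) (p := p) (v := v)
  have h2 := sum_laterIn_le (v := v) hε hε' hf hH
  have h3 : ∑ u ∈ poorNodes G π p v, ((earlierWith G p v u).card : ℝ) ≤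
      ε / 2 * (∑ u ∈ refCluster G π v, (cutDeg G π v u + nonDeg G π v u) +
        ∑ u ∈ poorNodes G π p v, ((laterIn G π v u).card : ℝ)) := by
    refine (Finset.sum_le_sum fun u hu => card_earlierWith_le hε hε' hf hu).trans ?_
    rw [← Finset.mul_sum, Finset.sum_add_distrib]
    gcongr ε / 2 * (?_ + ?_)
    · refine (Finset.sum_le_sum_of_subset_of_nonneg poorNodes_subset
        fun u _ _ => cutDeg_nonneg _ _).trans (Finset.sum_le_sum fun u _ => ?_)
      linarith [nonDeg_nonneg (G := G) (π := π) v u]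
    · exact sum_earlierPoor_le
  have hT0 : 0 ≤ ∑ u ∈ refCluster G π v, (cutDeg G π v u + nonDeg G π v u) :=
    Finset.sum_nonneg fun u _ => add_nonneg (cutDeg_nonneg _ _) (nonDeg_nonneg _ _)
  rw [Finset.sum_add_distrib] at h1
  have hI0 : (0 : ℝ) ≤ if IsPiv G π v v ∧ ((refCluster G π v).card : ℝ) < ε * fdeg G v
        then fdeg G v ^ 2 else 0 := by split_ifs <;> positivity
  set I : ℝ := if IsPiv G π v v ∧ ((refCluster G π v).card : ℝ) < ε * fdeg G v
        then fdeg G v ^ 2 else 0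
  set T := ∑ u ∈ refCluster G π v, (cutDeg G π v u + nonDeg G π v u)
  set X := ∑ u ∈ poorNodes G π p v, ((laterIn G π v u).card : ℝ)
  have hX0 : 0 ≤ X := Finset.sum_nonneg fun u _ => Nat.cast_nonneg _
  have h4 : ε * X ≤ 1 / 1000 * X := mul_le_mul_of_nonneg_right hε'.le hX0
  have e6 : 0 ≤ ε * T := mul_nonneg hε.le hT0
  have e7 : 0 ≤ ε ^ 3 * I := mul_nonneg (pow_nonneg hε.le 3) hI0
  linarith

/-- At a node of a cluster, cut edges and inner non-edges are exactly its disagreements. Clusters of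
distinct pivots are disjoint; the inequality comes from omitting the singletons. -/
theorem sum_cutDeg_add_nonDeg_le (hπ : Function.Injective π) :
    ∑ v, ∑ u ∈ refCluster G π v, (cutDeg G π v u + nonDeg G π v u) ≤
      2 * (cost G (refClustering G π) : ℝ) := by
  classical
  have h0 : ∀ x y, 0 ≤ (if refClustering G π x = refClustering G π y then nonW G x y
      else adjW G x y) := fun x y => by
    split_ifs
    · exact nonW_nonneg x y
    · exact adjW_nonneg x y
  have hconv : 2 * (cost G (refClustering G π) : ℝ) = ∑ x, ∑ y,
      (if refClustering G π x = refClustering G π y then nonW G x y else adjW G x y) := by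
    convert two_mul_cost_eq_sum (G := G) (refClustering G π)
  rw [hconv]
  have hdisj : ((Finset.univ : Finset (Fin n)) : Set (Fin n)).PairwiseDisjoint
      (refCluster G π) := by
    intro v _ w _ hvw
    refine Finset.disjoint_left.2 fun u hu hu' => hvw ?_
    exact (mem_refCluster.1 hu).1.eq hπ (mem_refCluster.1 hu').1
  have hterm : ∀ v, ∀ u ∈ refCluster G π v, cutDeg G π v u + nonDeg G π v u =
      ∑ y, if refClustering G π u = refClustering G π y then nonW G u y else adjW G u y := by
    intro v u hu
    rw [(refClustering_eq_inl_iff hπ).2 (mem_refCluster.1 hu), add_comm,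
      ← Finset.sum_filter_add_sum_filter_not (s := Finset.univ)
      (p := fun y => y ∈ refCluster G π v)]
    have hiff : ∀ y, Sum.inl v = refClustering G π y ↔ y ∈ refCluster G π v := fun y => by
      rw [mem_refCluster, ← refClustering_eq_inl_iff hπ, eq_comm]
    simp_rw [hiff]
    congr 1
    · rw [Finset.filter_mem_eq_inter, Finset.univ_inter]
      exact Finset.sum_congr rfl fun y hy => (if_pos hy).symm
    · unfold cutDeg
      rw [show Finset.univ \ refCluster G π v =
        Finset.univ.filter fun y => y ∉ refCluster G π v by ext; simp]
      exact Finset.sum_congr rfl fun y hy => (if_neg (Finset.mem_filter.1 hy).2).symm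
  rw [Finset.sum_congr rfl fun v _ => Finset.sum_congr rfl (hterm v), ← Finset.sum_biUnion hdisj]
  exact Finset.sum_le_sum_of_subset_of_nonneg (Finset.subset_univ _) fun x _ _ =>
    Finset.sum_nonneg fun y _ => h0 x y

/-- The comparator costs hardly more than the reference clustering, up to the clusters that are
small compared to the degree of their pivot. -/
theorem two_mul_cost_comparator_le (hπ : Function.Injective π) (hε : 0 < ε) (hε' : ε < 1 / 1000)
    (hf : IsFaithful G ε L π n p) (hH : HasLightNodes G ε L π) : open Classical in
    2 * (cost G (comparator G π p) : ℝ) ≤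
      (1 + 12 * ε) * (2 * (cost G (refClustering G π) : ℝ)) +
      5 * ε ^ 3 * ∑ v, if IsPiv G π v v ∧ ((refCluster G π v).card : ℝ) < ε * fdeg G v
        then fdeg G v ^ 2 else 0 := by
  classical
  have hcl : ∀ u v, comparator G π p u = Sum.inl v ↔ p u = some v ∧ IsRef G π v u := by
    intro u v
    rw [← refClustering_eq_inl_iff hπ]
    unfold comparator
    cases hu : p u with
    | none => simp
    | some w =>
      dsimp only
      split_ifs with h
      · rw [h]; simp
      · constructor
        · intro h'; cases h'
        · rintro ⟨h1, h2⟩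
          obtain rfl := Option.some_injective _ h1
          exact absurd h2 h
  have hr : ∀ u w, comparator G π p u = Sum.inr w → w = u := by
    intro u w h
    unfold comparator at h
    split at h
    · split_ifs at h; exact (Sum.inr_injective h).symm
    · exact (Sum.inr_injective h).symm
  have h1 := two_mul_cost_eq (G := G) (comparator G π p) hr
  have h2 := two_mul_cost_eq (G := G) (refClustering G π) fun u w => refClustering_eq_inr
  have h3 := sum_cutDeg_add_nonDeg_le (G := G) hπ
  have e1 : ∀ v, (Finset.univ.filter fun u => comparator G π p u = Sum.inl v) =
      refCluster G π v \ poorNodes G π p v := by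
    intro v; ext u
    simp only [Finset.mem_filter, Finset.mem_univ, true_and, hcl, Finset.mem_sdiff,
      mem_refCluster, mem_poorNodes]
    tauto
  have e2 : ∀ v, (Finset.univ.filter fun u => refClustering G π u = Sum.inl v) =
      refCluster G π v := by
    intro v; ext u
    simp only [Finset.mem_filter, Finset.mem_univ, true_and, mem_refCluster,
      refClustering_eq_inl_iff hπ]
  simp_rw [e1] at h1
  simp_rw [e2] at h2
  have h4 := Finset.sum_le_sum fun v (_ : v ∈ (Finset.univ : Finset (Fin n))) =>
    val_sdiff_poorNodes_le' (v := v) hε hε' hf hH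
  rw [Finset.sum_add_distrib, Finset.sum_add_distrib, ← Finset.mul_sum, ← Finset.mul_sum] at h4
  have h5 := mul_le_mul_of_nonneg_left h3 (by positivity : 0 ≤ 12 * ε)
  rw [h1]
  linarith

end poor


/-! ### Independent uniform ranks -/

section ranks
open MeasureTheory
variable {n : ℕ} {G : SimpleGraph (Fin n)}

theorem volume_setOf_lt_le {t : ℝ} (ht : 0 ≤ t) :
    volume {a : unitInterval | t < (a : ℝ)} ≤ ENNReal.ofReal (1 - t) := by
  by_cases h : t ≤ 1
  · have : {a : unitInterval | t < (a : ℝ)} = Set.Ioi (⟨t, ht, h⟩ : unitInterval) := by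
      ext a; simp [← Subtype.coe_lt_coe]
    rw [this, unitInterval.volume_Ioi]
  · have : {a : unitInterval | t < (a : ℝ)} = ∅ := by
      ext a
      simp only [Set.mem_ofPred_eq, Set.mem_empty_iff_false, iff_false, not_lt]
      exact a.2.2.trans (not_le.1 h).le
    rw [this, measure_empty]; exact zero_le

theorem volume_box (S : Fin n → Set unitInterval) :
    volume {π : Fin n → unitInterval | ∀ x, π x ∈ S x} = ∏ x, volume (S x) := by
  rw [← volume_pi_pi]
  congr 1; ext π; simp [Set.mem_pi]

/-- Superadditivity of the lower integral needs no measurability of the summands. -/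
theorem sum_lintegral_le {α ι : Type} [MeasurableSpace α] {μ : Measure α} (s : Finset ι)
    (f : ι → α → ℝ≥0∞) : ∑ i ∈ s, ∫⁻ a, f i a ∂μ ≤ ∫⁻ a, ∑ i ∈ s, f i a ∂μ := by
  classical
  induction s using Finset.induction_on with
  | empty => simp
  | insert i s hi ih =>
    simp_rw [Finset.sum_insert hi]
    exact (add_le_add_right ih _).trans (le_lintegral_add _ _)

/-- Replacing one coordinate by an independent copy. -/
theorem measurePreserving_update (v : Fin n) : MeasurePreserving
    (fun z : unitInterval × (Fin n → unitInterval) => Function.update z.2 v z.1)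
    (volume.prod volume) volume := by
  have hmeas : Measurable
      (fun z : unitInterval × (Fin n → unitInterval) => Function.update z.2 v z.1) := by
    refine measurable_pi_iff.2 fun x => ?_
    by_cases hx : x = v
    · subst hx; simpa using measurable_fst
    · simp only [Function.update_of_ne hx]; fun_prop
  refine ⟨hmeas, ?_⟩
  rw [volume_pi]
  symm
  refine Measure.pi_eq fun s hs => ?_
  rw [Measure.map_apply hmeas (MeasurableSet.univ_pi hs)]
  have hpre : (fun z : unitInterval × (Fin n → unitInterval) => Function.update z.2 v z.1) ⁻¹'
      Set.univ.pi s = s v ×ˢ Set.univ.pi (Function.update s v Set.univ) := by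
    ext z
    simp only [Set.mem_preimage, Set.mem_pi, Set.mem_univ, true_implies, Set.mem_prod]
    constructor
    · intro h
      refine ⟨by simpa using h v, fun x => ?_⟩
      by_cases hx : x = v
      · subst hx; simp
      · have := h x
        rwa [Function.update_of_ne hx] at this ⊢
    · rintro ⟨h1, h2⟩ x
      by_cases hx : x = v
      · subst hx; simpa using h1
      · have := h2 x
        rwa [Function.update_of_ne hx] at this ⊢
  rw [hpre, Measure.prod_prod, ← volume_pi, volume_pi_pi,
    ← Finset.mul_prod_erase Finset.univ (fun i => volume (s i)) (Finset.mem_univ v),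
    ← Finset.mul_prod_erase Finset.univ _ (Finset.mem_univ v)]
  rw [Function.update_self, measure_univ, one_mul]
  congr 1
  refine Finset.prod_congr rfl fun x hx => ?_
  rw [Function.update_of_ne (Finset.ne_of_mem_erase hx)]

theorem volume_eq_lintegral_update (v : Fin n) {E : Set (Fin n → unitInterval)}
    (hE : MeasurableSet E) : volume E =
      ∫⁻ ρ : unitInterval, volume {π : Fin n → unitInterval | Function.update π v ρ ∈ E} := by
  have h := measurePreserving_update v
  rw [← h.measure_preimage hE.nullMeasurableSet, Measure.prod_apply (h.measurable hE)]
  rfl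

theorem ae_injective : ∀ᵐ π : Fin n → unitInterval, Function.Injective π := by
  have hpair : ∀ x y : Fin n, x ≠ y → ∀ᵐ π : Fin n → unitInterval, π x ≠ π y := by
    intro x y hxy
    have hE : MeasurableSet {π : Fin n → unitInterval | π x = π y} :=
      measurableSet_eq_fun (measurable_pi_apply x) (measurable_pi_apply y)
    rw [ae_iff]
    simp only [ne_eq, not_not]
    rw [volume_eq_lintegral_update x hE]
    simp only [Set.mem_ofPred_eq, Function.update_self, Function.update_of_ne hxy.symm]
    refine lintegral_eq_zero_of_ae_eq_zero (Filter.Eventually.of_forall fun ρ => ?_)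
    simp_rw [eq_comm (a := ρ)]
    exact Measure.pi_hyperplane (α := fun _ => unitInterval) (fun _ => volume) y ρ
  have h : ∀ᵐ π : Fin n → unitInterval, ∀ x y, x ≠ y → π x ≠ π y := by
    rw [ae_all_iff]; intro x
    rw [ae_all_iff]; intro y
    by_cases hxy : x = y
    · simp [hxy]
    · filter_upwards [hpair x y hxy] with π h _ using h
  filter_upwards [h] with π h x y hxy
  by_contra hne
  exact h x y hne hxy

/-- With high probability no node of large degree has a pivot of large rank. -/
theorem volume_heavy_le {T : ℝ} (hT : 0 ≤ T) (u : Fin n) :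
    volume {π : Fin n → unitInterval | ∃ v, IsPiv G π v u ∧ T / 2 < (π v : ℝ) * fdeg G u} ≤
      ENNReal.ofReal (Real.exp (-(T / 2))) := by
  classical
  rcases (fdeg_nonneg (G := G) u).eq_or_lt with h0 | hpos
  · rw [← h0]
    have : {π : Fin n → unitInterval | ∃ v, IsPiv G π v u ∧ T / 2 < (π v : ℝ) * 0} = ∅ := by
      ext π
      simp only [mul_zero, Set.mem_ofPred_eq, Set.mem_empty_iff_false, iff_false]
      rintro ⟨v, _, h⟩; linarith
    rw [this, measure_empty]; exact zero_le
  set t := T / 2 / fdeg G u with ht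
  have ht0 : 0 ≤ t := by positivity
  calc _ ≤ volume {π : Fin n → unitInterval | ∀ x, π x ∈
          if G.Adj u x then {a : unitInterval | t < (a : ℝ)} else Set.univ} := by
        refine measure_mono ?_
        rintro π ⟨v, hv, hlt⟩ x
        split_ifs with hx
        · rw [Set.mem_ofPred_eq, ht, div_lt_iff₀ hpos]
          refine hlt.trans_le ?_
          gcongr
          exact hv.2 x (Or.inr hx)
        · trivial
    _ = ∏ x, volume (if G.Adj u x then {a : unitInterval | t < (a : ℝ)} else Set.univ) :=
        volume_box _
    _ ≤ ∏ x, ENNReal.ofReal (Real.exp (-(t * adjW G u x))) := by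
        refine Finset.prod_le_prod' fun x _ => ?_
        split_ifs with hx
        · rw [adjW_of_adj hx, mul_one]
          exact (volume_setOf_lt_le ht0).trans
            (ENNReal.ofReal_le_ofReal (Real.one_sub_le_exp_neg t))
        · rw [adjW_of_not_adj hx]; simp
    _ = ENNReal.ofReal (Real.exp (∑ x, -(t * adjW G u x))) := by
        rw [Real.exp_sum, ENNReal.ofReal_prod_of_nonneg fun x _ => Real.exp_nonneg _]
    _ = _ := by
        congr 2
        rw [Finset.sum_neg_distrib, ← Finset.mul_sum]
        change -(t * fdeg G u) = _
        rw [ht, div_mul_cancel₀ _ hpos.ne']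

/-! ### Light nodes among the later neighbours, conditioned on the nodes ranked below `v`. -/

/-- `laterIn` when `Q` is the set of the nodes of smaller rank than `v`. -/
noncomputable def laterGiven (G : SimpleGraph (Fin n)) (v u : Fin n) (Q : Finset (Fin n)) :
    Finset (Fin n) :=
  open Classical in Finset.univ.filter fun w =>
    u < w ∧ G.Adj u w ∧ G.Adj w v ∧ ∀ x ∈ Q, x ≠ w ∧ ¬ G.Adj w x

/-- `laterLow` when `Q` is the set of the nodes of smaller rank than `v`. -/
noncomputable def laterLowGiven (G : SimpleGraph (Fin n)) (ε : ℝ) (v u : Fin n)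
    (Q : Finset (Fin n)) : Finset (Fin n) :=
  open Classical in (laterGiven G v u Q).filter fun w =>
    ε ^ 2 * deg G w w ≤ (laterGiven G v u Q).card ∧
    ε ^ 2 * deg G w v ≤ (laterGiven G v u Q).card

/-- The event that the nodes of smaller rank than `v` are those of `Q`, and no node of
`laterLowGiven` is light. -/
def missEvent (G : SimpleGraph (Fin n)) (ε T : ℝ) (v u : Fin n) (Q : Finset (Fin n)) :
    Set (Fin n → unitInterval) :=
  {π | (∀ x ∈ Q, π x < π v) ∧ (∀ x, x ∉ Q → π v ≤ π x) ∧
    (π v : ℝ) * (laterGiven G v u Q).card ≤ T / 2 ∧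
    ∀ w ∈ laterLowGiven G ε v u Q, T < (π w : ℝ) * (laterGiven G v u Q).card}

theorem measurableSet_missEvent (ε T : ℝ) (v u : Fin n) (Q : Finset (Fin n)) :
    MeasurableSet (missEvent G ε T v u Q) := by
  have hc : ∀ x : Fin n, Measurable fun π : Fin n → unitInterval => π x := measurable_pi_apply
  have hr : ∀ x : Fin n, Measurable fun π : Fin n → unitInterval => (π x : ℝ) :=
    fun x => measurable_subtype_coe.comp (hc x)
  have heq : missEvent G ε T v u Q = (⋂ x ∈ Q, {π : Fin n → unitInterval | π x < π v}) ∩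
      ((⋂ x, ⋂ (_ : x ∉ Q), {π : Fin n → unitInterval | π v ≤ π x}) ∩
      ({π : Fin n → unitInterval | (π v : ℝ) * (laterGiven G v u Q).card ≤ T / 2} ∩
      ⋂ w ∈ laterLowGiven G ε v u Q,
        {π : Fin n → unitInterval | T < (π w : ℝ) * (laterGiven G v u Q).card})) := by
    ext π; simp [missEvent]
  rw [heq]
  refine MeasurableSet.inter ?_ (MeasurableSet.inter ?_ (MeasurableSet.inter ?_ ?_))
  · exact Finset.measurableSet_biInter _ fun x _ => measurableSet_lt (hc x) (hc v)
  · exact MeasurableSet.iInter fun x => MeasurableSet.iInter fun _ =>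
      measurableSet_le (hc v) (hc x)
  · exact measurableSet_le ((hr v).mul_const _) measurable_const
  · exact Finset.measurableSet_biInter _ fun x _ =>
      measurableSet_lt measurable_const ((hr x).mul_const _)

/-- With the rank `ρ` of `v` fixed, the event lies in a box: ranks below `ρ` on `Q`, above `T / α`
on the low nodes, at least `ρ` elsewhere. Compared with the probability of `Q` alone, each low node
gains a factor `exp (-(t / 2))`, and there are at least `α / 2` of them. -/
theorem volume_missEvent_slice_le {ε T : ℝ} (hT : 0 ≤ T) {u v : Fin n} (hvu : v < u)
    {Q : Finset (Fin n)} (hvQ : v ∉ Q) (hα : 1 ≤ (laterGiven G v u Q).card)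
    (hlow : (laterGiven G v u Q).card ≤ 2 * (laterLowGiven G ε v u Q).card) (ρ : unitInterval) :
    volume {π : Fin n → unitInterval | Function.update π v ρ ∈ missEvent G ε T v u Q} ≤
      ENNReal.ofReal (Real.exp (-(T / 4))) * ((∏ _x ∈ Q, ENNReal.ofReal ρ) *
        ∏ _x ∈ (Finset.univ.erase v) \ Q, ENNReal.ofReal (1 - ρ)) := by
  classical
  set a : ℝ := ((laterGiven G v u Q).card : ℝ) with ha
  have ha1 : (1 : ℝ) ≤ a := by rw [ha]; exact_mod_cast hα
  have ha0 : 0 < a := by linarith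
  have hρ0 := ρ.2.1
  have hρ1 := ρ.2.2
  by_cases hρ : (ρ : ℝ) * a ≤ T / 2
  swap
  · have : {π : Fin n → unitInterval | Function.update π v ρ ∈ missEvent G ε T v u Q} = ∅ := by
      ext π
      simp only [Set.mem_ofPred_eq, Set.mem_empty_iff_false, iff_false]
      rintro ⟨_, _, h, _⟩
      rw [Function.update_self] at h
      exact hρ h
    rw [this, measure_empty]; exact zero_le
  set t := T / a with ht
  have ht0 : 0 ≤ t := by positivity
  have hρt : (ρ : ℝ) ≤ t / 2 := by rw [ht, div_div, le_div_iff₀ (by positivity)]; linarith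
  set low := laterLowGiven G ε v u Q with hlowdef
  have hmemlow : ∀ w ∈ low, u < w ∧ w ∉ Q := by
    intro w hw
    have h1 := (Finset.mem_filter.1 (Finset.mem_filter.1 hw).1).2
    exact ⟨h1.1, fun hQ => (h1.2.2.2 w hQ).1 rfl⟩
  set S : Fin n → Set unitInterval := fun x => if x = v then Set.univ else if x ∈ Q then Set.Iio ρ
    else if x ∈ low then {b : unitInterval | t < (b : ℝ)} else Set.Ici ρ with hS
  set f : Fin n → ℝ≥0∞ := fun x => if x = v then 1 else if x ∈ Q then ENNReal.ofReal ρ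
    else ENNReal.ofReal (1 - ρ) with hf
  set h : Fin n → ℝ≥0∞ := fun x => if x ∈ low then ENNReal.ofReal (Real.exp (-(t / 2))) else 1
    with hh
  -- Since `ρ ≤ t / 2`, one factor `1 - t / 2` of `(1 - t / 2)²` is at most `1 - ρ`; the other is
  -- the gain.
  have hfac : 1 - t ≤ (1 - ρ) * Real.exp (-(t / 2)) := by
    have h1 := Real.one_sub_le_exp_neg (t / 2)
    have h2 := Real.exp_pos (-(t / 2))
    by_cases ht1 : t ≤ 1
    · calc 1 - t ≤ (1 - t / 2) * (1 - t / 2) := by nlinarith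
        _ ≤ (1 - ρ) * Real.exp (-(t / 2)) := by
          apply mul_le_mul _ h1 _ _ <;> linarith
    · have : 0 ≤ (1 - (ρ : ℝ)) * Real.exp (-(t / 2)) := mul_nonneg (by linarith) h2.le
      linarith
  have hle : ∀ x, volume (S x) ≤ f x * h x := by
    intro x
    simp only [hS, hf, hh]
    by_cases hxv : x = v
    · subst hxv
      have hxl : x ∉ low := fun hx => lt_asymm hvu (hmemlow x hx).1
      simp [hxl]
    · by_cases hxQ : x ∈ Q
      · have hxl : x ∉ low := fun hx => (hmemlow x hx).2 hxQ
        simp [hxv, hxQ, hxl]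
      · by_cases hxl : x ∈ low
        · simp only [hxv, hxQ, hxl, if_true, if_false]
          rw [← ENNReal.ofReal_mul (by linarith)]
          exact (volume_setOf_lt_le ht0).trans (ENNReal.ofReal_le_ofReal hfac)
        · simp [hxv, hxQ, hxl]
  calc _ ≤ volume {π : Fin n → unitInterval | ∀ x, π x ∈ S x} := by
        refine measure_mono ?_
        rintro π ⟨h1, h2, _, h4⟩ x
        rw [Function.update_self] at h1 h2
        simp only [hS]
        split_ifs with hxv hxQ hxl
        · trivial
        · have := h1 x hxQ
          rwa [Function.update_of_ne hxv] at this
        · have := h4 x hxl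
          rw [Function.update_of_ne hxv] at this
          rw [Set.mem_ofPred_eq, ht, div_lt_iff₀ ha0]
          exact this
        · have := h2 x hxQ
          rwa [Function.update_of_ne hxv] at this
    _ = ∏ x, volume (S x) := volume_box S
    _ ≤ ∏ x, f x * h x := Finset.prod_le_prod' fun x _ => hle x
    _ = (∏ x, h x) * ∏ x, f x := by rw [Finset.prod_mul_distrib, mul_comm]
    _ ≤ _ := by
        refine mul_le_mul' ?_ (le_of_eq ?_)
        · simp only [hh]
          rw [Finset.prod_ite_mem, Finset.univ_inter, Finset.prod_const,
            ← ENNReal.ofReal_pow (Real.exp_nonneg _), ← Real.exp_nat_mul]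
          apply ENNReal.ofReal_le_ofReal
          apply Real.exp_le_exp.2
          have h1 : a ≤ 2 * (low.card : ℝ) := by rw [ha]; exact_mod_cast hlow
          have h2 : T = t * a := by rw [ht, div_mul_cancel₀ _ ha0.ne']
          have h3 : t * a ≤ t * (2 * (low.card : ℝ)) := mul_le_mul_of_nonneg_left h1 ht0
          linarith
        · have hQ : Q ⊆ Finset.univ.erase v := fun x hx =>
            Finset.mem_erase.2 ⟨fun e => hvQ (e ▸ hx), Finset.mem_univ _⟩
          rw [← Finset.mul_prod_erase _ _ (Finset.mem_univ v), ← Finset.prod_sdiff hQ]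
          simp only [hf, if_true, one_mul]
          rw [mul_comm]
          congr 1
          · refine Finset.prod_congr rfl fun x hx => ?_
            rw [if_neg (fun e : x = v => hvQ (e ▸ hx)), if_pos hx]
          · refine Finset.prod_congr rfl fun x hx => ?_
            rw [Finset.mem_sdiff, Finset.mem_erase] at hx
            rw [if_neg hx.1.1, if_neg hx.2]

/-- With high probability the pivots have light nodes. -/
theorem volume_miss_le {ε T : ℝ} (hT : 0 ≤ T) {u v : Fin n} (hvu : v < u) :
    volume {π : Fin n → unitInterval | IsPiv G π v v ∧ 1 ≤ (laterIn G π v u).card ∧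
      (laterIn G π v u).card ≤ 2 * (laterLow G ε π v u).card ∧
      (π v : ℝ) * (laterIn G π v u).card ≤ T / 2 ∧
      ∀ w ∈ laterLow G ε π v u, T < (π w : ℝ) * (laterIn G π v u).card} ≤
      ENNReal.ofReal (Real.exp (-(T / 4))) := by
  classical
  set N := Finset.univ.erase v with hN
  set good := N.powerset.filter fun Q => 1 ≤ (laterGiven G v u Q).card ∧
    (laterGiven G v u Q).card ≤ 2 * (laterLowGiven G ε v u Q).card with hgood
  set g : Finset (Fin n) → unitInterval → ℝ≥0∞ := fun Q ρ =>
    ENNReal.ofReal (Real.exp (-(T / 4))) * ((∏ _x ∈ Q, ENNReal.ofReal ρ) *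
        ∏ _x ∈ N \ Q, ENNReal.ofReal (1 - ρ)) with hg
  calc _ ≤ volume (⋃ Q ∈ good, missEvent G ε T v u Q) := by
        refine measure_mono ?_
        rintro π ⟨h0, h1, h2, h3, h4⟩
        -- If `v` is its own pivot, then a later `w` is in its cluster exactly when `w` is adjacent
        -- to `v` and `N[w]` misses `Q`. So `Q` determines the later neighbours, whatever the ranks
        -- above that of `v`.
        set Q := Finset.univ.filter fun x => π x < π v with hQ
        have hl : laterIn G π v u = laterGiven G v u Q := by
          ext w
          simp only [laterIn, laterGiven, Finset.mem_filter, Finset.mem_univ, true_and, hQ]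
          refine and_congr_right fun huw => and_congr_right fun _ => ?_
          constructor
          · rintro ⟨h5, _⟩
            refine ⟨h5.1.resolve_left (hvu.trans huw).ne, fun x hx => ⟨?_, ?_⟩⟩
            · rintro rfl; exact absurd (h5.2 x (Or.inl rfl)) (not_le.2 hx)
            · intro hwx; exact absurd (h5.2 x (Or.inr hwx)) (not_le.2 hx)
          · rintro ⟨h5, h6⟩
            refine ⟨⟨Or.inr h5, fun x hx => ?_⟩, h0⟩
            by_contra hcon
            have := h6 x (not_le.1 hcon)
            exact hx.elim this.1 this.2
        have hll : laterLow G ε π v u = laterLowGiven G ε v u Q := by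
          unfold laterLow laterLowGiven; rw [hl]
        rw [hl, hll] at h2
        rw [hl] at h1 h3
        rw [hl, hll] at h4
        simp only [Set.mem_iUnion]
        refine ⟨Q, ?_, ?_, ?_, h3, h4⟩
        · rw [hgood, Finset.mem_filter, Finset.mem_powerset]
          refine ⟨fun x hx => ?_, h1, h2⟩
          rw [hN, Finset.mem_erase]
          refine ⟨?_, Finset.mem_univ _⟩
          rintro rfl
          simp [hQ] at hx
        · intro x hx; exact (Finset.mem_filter.1 hx).2
        · intro x hx
          by_contra hcon
          exact hx (Finset.mem_filter.2 ⟨Finset.mem_univ _, not_le.1 hcon⟩)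
    _ ≤ ∑ Q ∈ good, volume (missEvent G ε T v u Q) := measure_biUnion_finset_le _ _
    _ ≤ ∑ Q ∈ good, ∫⁻ ρ : unitInterval, g Q ρ := by
        refine Finset.sum_le_sum fun Q hQ => ?_
        rw [volume_eq_lintegral_update v (measurableSet_missEvent _ _ _ _ _)]
        rw [hgood, Finset.mem_filter, Finset.mem_powerset] at hQ
        refine lintegral_mono fun ρ => ?_
        exact volume_missEvent_slice_le hT hvu
          (fun hv => (Finset.mem_erase.1 (hQ.1 hv)).1 rfl) hQ.2.1 hQ.2.2 ρ
    _ ≤ ∑ Q ∈ N.powerset, ∫⁻ ρ : unitInterval, g Q ρ :=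
        Finset.sum_le_sum_of_subset (Finset.filter_subset _ _)
    _ ≤ ∫⁻ ρ : unitInterval, ∑ Q ∈ N.powerset, g Q ρ := sum_lintegral_le _ _
    _ = ∫⁻ _ : unitInterval, ENNReal.ofReal (Real.exp (-(T / 4))) := by
        refine lintegral_congr fun ρ => ?_
        simp only [hg]
        -- Summing over all `Q` gives `(ρ + (1 - ρ)) ^ (n - 1) = 1`, so conditioning on `Q` costs no
        -- union bound.
        rw [← Finset.mul_sum, ← Finset.prod_add, ← ENNReal.ofReal_add ρ.2.1 (by linarith [ρ.2.2])]
        simp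
    _ = _ := by simp

end ranks


/-! ### Pivots with small clusters -/

section smallClusters
open MeasureTheory
variable {n : ℕ} {G : SimpleGraph (Fin n)} {π : Fin n → unitInterval} {v x : Fin n}

open Classical in
/-- Number of disagreements of the reference clustering at `v`. -/
noncomputable def refDisagreement (G : SimpleGraph (Fin n)) (π : Fin n → unitInterval)
    (v : Fin n) : ℝ :=
  ∑ y, if refClustering G π v = refClustering G π y then nonW G v y else adjW G v y

theorem refDisagreement_nonneg (v : Fin n) : 0 ≤ refDisagreement G π v :=
  Finset.sum_nonneg fun y _ => by
    split_ifs
    · exact nonW_nonneg v y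
    · exact adjW_nonneg v y

theorem fdeg_sub_le_refDisagreement {S : Finset (Fin n)}
    (hS : ∀ y, G.Adj v y → refClustering G π v = refClustering G π y → y ∈ S) :
    fdeg G v - S.card ≤ refDisagreement G π v := by
  classical
  have h1 : (S.card : ℝ) = ∑ y, if y ∈ S then 1 else 0 := by simp
  unfold fdeg refDisagreement
  rw [h1, ← Finset.sum_sub_distrib]
  refine Finset.sum_le_sum fun y _ => ?_
  have h2 := adjW_le_one (G := G) v y
  have h3 := nonW_nonneg (G := G) v y
  have h4 := adjW_nonneg (G := G) v y
  by_cases ha : G.Adj v y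
  · by_cases hc : refClustering G π v = refClustering G π y
    · rw [if_pos hc, if_pos (hS y ha hc)]; linarith
    · rw [if_neg hc]; split_ifs <;> linarith
  · rw [adjW_of_not_adj ha]; split_ifs <;> linarith

/-- After the exchange `x` carries the small rank of `v` and is the pivot of `v`. If `x` is its own
pivot, the neighbours of `v` in the new cluster other than `x` belonged to the old cluster of `v`;
if not, `v` is a singleton and all its edges are cut. -/
theorem refCluster_bound_of_swap (hπ : Function.Injective π) (hvv : IsPiv G π v v)
    (hx : x = v ∨ G.Adj v x) {b : ℝ} (hb : ((refCluster G π v).card : ℝ) ≤ b) :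
    IsPiv G (π ∘ Equiv.swap v x) x v ∧
      fdeg G v - b ≤ refDisagreement G (π ∘ Equiv.swap v x) v := by
  classical
  set τ := π ∘ Equiv.swap v x with hτ
  have hτinj : Function.Injective τ := hπ.comp (Equiv.injective _)
  have hτx : τ x = π v := by simp [hτ]
  have hτv : τ v = π x := by simp [hτ]
  have hτy : ∀ y, y ≠ v → y ≠ x → τ y = π y := fun y h1 h2 => by
    simp [hτ, Equiv.swap_apply_of_ne_of_ne h1 h2]
  have hpiv : IsPiv G τ x v := by
    refine ⟨hx, fun y hy => ?_⟩
    rw [hτx]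
    by_cases h1 : y = v
    · subst h1; rw [hτv]; exact hvv.2 x hx
    · by_cases h2 : y = x
      · subst h2; rw [hτx]
      · rw [hτy y h1 h2]; exact hvv.2 y hy
  refine ⟨hpiv, ?_⟩
  by_cases hxx : IsPiv G τ x x
  · have hrv : refClustering G τ v = Sum.inl x :=
      (refClustering_eq_inl_iff hτinj).2 ⟨hpiv, hxx⟩
    have hsub : ∀ y, G.Adj v y → refClustering G τ v = refClustering G τ y →
        y ∈ insert x ((refCluster G π v).erase v) := by
      intro y hvy hc
      rw [hrv, eq_comm, refClustering_eq_inl_iff hτinj] at hc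
      rw [Finset.mem_insert]
      by_cases hyx : y = x
      · exact Or.inl hyx
      right
      rw [Finset.mem_erase]
      refine ⟨hvy.ne', mem_refCluster.2 ⟨⟨Or.inr hvy.symm, fun z hz => ?_⟩, hvv⟩⟩
      by_cases h1 : z = v
      · rw [h1]
      · by_cases h2 : z = x
        · rw [h2]; exact hvv.2 x hx
        · rw [← hτx, ← hτy z h1 h2]; exact hc.1.2 z hz
    refine le_trans ?_ (fdeg_sub_le_refDisagreement hsub)
    have hvmem : v ∈ refCluster G π v := mem_refCluster.2 hvv.isRef
    have h1 : (insert x ((refCluster G π v).erase v)).card ≤ (refCluster G π v).card := by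
      refine (Finset.card_insert_le _ _).trans ?_
      rw [Finset.card_erase_add_one hvmem]
    have h2 : ((insert x ((refCluster G π v).erase v)).card : ℝ) ≤ (refCluster G π v).card := by
      exact_mod_cast h1
    linarith
  · have hb0 : 0 ≤ b := (Nat.cast_nonneg _).trans hb
    refine le_trans ?_ (fdeg_sub_le_refDisagreement (S := ∅) fun y hvy hc => ?_)
    · simpa using hb0
    · exfalso
      cases hr : refClustering G τ v with
      | inl w =>
        have hw := (refClustering_eq_inl_iff hτinj).1 hr
        exact hxx ((hw.1.eq hτinj hpiv) ▸ hw.2)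
      | inr w =>
        have h1 := refClustering_eq_inr hr
        have h2 := refClustering_eq_inr (hc ▸ hr)
        exact hvy.ne (h1 ▸ h2)

theorem lintegral_swap (v x : Fin n) (f : (Fin n → unitInterval) → ℝ≥0∞) :
    ∫⁻ π : Fin n → unitInterval, f (π ∘ Equiv.swap v x) = ∫⁻ π, f π := by
  have h := volume_measurePreserving_piCongrLeft (fun _ : Fin n => unitInterval) (Equiv.swap v x)
  rw [← h.lintegral_comp_emb (MeasurableEquiv.measurableEmbedding _) f]
  refine lintegral_congr fun π => ?_
  congr 1
  funext y
  obtain ⟨z, rfl⟩ := (Equiv.swap v x).surjective y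
  rw [MeasurableEquiv.coe_piCongrLeft, Equiv.piCongrLeft_apply_apply]
  simp

open Classical in
/-- Twice the charge for a pivot whose cluster is small compared to its degree. -/
theorem lintegral_smallCluster_le {ε : ℝ} (hε' : ε ≤ 3 / 4) (v : Fin n) :
    ∫⁻ π : Fin n → unitInterval, ENNReal.ofReal (if IsPiv G π v v ∧
      ((refCluster G π v).card : ℝ) < ε * fdeg G v then fdeg G v ^ 2 else 0) ≤
      4 * ∫⁻ π : Fin n → unitInterval, ENNReal.ofReal (refDisagreement G π v) := by
  set d := fdeg G v with hd
  have hd0 : 0 ≤ d := fdeg_nonneg v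
  set N := Finset.univ.filter fun x => x = v ∨ G.Adj v x with hN
  have hcard : d ≤ N.card := by
    have h1 : (Finset.univ.filter fun x => G.Adj v x) ⊆ N := by
      intro x hx
      rw [Finset.mem_filter] at hx
      exact Finset.mem_filter.2 ⟨hx.1, Or.inr hx.2⟩
    have h2 : d = ((Finset.univ.filter fun x => G.Adj v x).card : ℝ) := by
      rw [hd, fdeg, Finset.card_filter, Nat.cast_sum]
      exact Finset.sum_congr rfl fun x _ => by unfold adjW; split_ifs <;> simp
    rw [h2]; exact_mod_cast Finset.card_le_card h1
  set F : Fin n → (Fin n → unitInterval) → ℝ≥0∞ := fun x π =>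
    if IsPiv G π x v ∧ d / 4 ≤ refDisagreement G π v then ENNReal.ofReal d else 0 with hF
  set E : (Fin n → unitInterval) → ℝ≥0∞ := fun π => if IsPiv G π v v ∧
      ((refCluster G π v).card : ℝ) < ε * d then ENNReal.ofReal d else 0 with hE
  -- The exchange preserves the measure and maps the small-cluster event into the event that `x` is
  -- the pivot of `v` and at least `d - (3/4) d` disagreements occur at `v`.
  have h1 : ∀ x ∈ N, ∫⁻ π, E π ≤ ∫⁻ π, F x π := by
    intro x hx
    rw [← lintegral_swap v x (F x)]
    refine lintegral_mono_ae ?_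
    filter_upwards [ae_injective] with π hπ
    simp only [hE]
    split_ifs with h
    · have h2 : ((refCluster G π v).card : ℝ) ≤ 3 / 4 * d := h.2.le.trans (by gcongr)
      obtain ⟨h3, h4⟩ := refCluster_bound_of_swap hπ h.1 (Finset.mem_filter.1 hx).2 h2
      simp only [hF]
      rw [if_pos ⟨h3, by linarith⟩]
    · exact zero_le
  -- For injective ranks `v` has only one pivot, so the events for distinct `x` are disjoint. The
  -- `|N[v]| ≥ d` copies turn the charge `d` into `d²`.
  have h2 : (N.card : ℝ≥0∞) * ∫⁻ π, E π ≤
      ∫⁻ π : Fin n → unitInterval, 4 * ENNReal.ofReal (refDisagreement G π v) := by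
    calc (N.card : ℝ≥0∞) * ∫⁻ π, E π = ∑ _x ∈ N, ∫⁻ π, E π := by simp
      _ ≤ ∑ x ∈ N, ∫⁻ π, F x π := Finset.sum_le_sum h1
      _ ≤ ∫⁻ π, ∑ x ∈ N, F x π := sum_lintegral_le _ _
      _ ≤ _ := by
        refine lintegral_mono_ae ?_
        filter_upwards [ae_injective] with π hπ
        by_cases hex : ∃ x ∈ N, IsPiv G π x v ∧ d / 4 ≤ refDisagreement G π v
        · obtain ⟨x, hx, hx1, hx2⟩ := hex
          rw [Finset.sum_eq_single x]
          · simp only [hF]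
            rw [if_pos ⟨hx1, hx2⟩, show (4 : ℝ≥0∞) = ENNReal.ofReal 4 by norm_num,
              ← ENNReal.ofReal_mul (by norm_num)]
            exact ENNReal.ofReal_le_ofReal (by linarith)
          · intro y _ hyx
            simp only [hF]
            rw [if_neg]
            rintro ⟨h, _⟩; exact hyx (h.eq hπ hx1)
          · intro h; exact absurd hx h
        · rw [Finset.sum_eq_zero]
          · exact zero_le
          · intro x hx
            simp only [hF]
            rw [if_neg fun h => hex ⟨x, hx, h⟩]
  rw [lintegral_const_mul' _ _ (by norm_num)] at h2
  refine le_trans ?_ h2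
  rw [← lintegral_const_mul' _ _ (by simp)]
  refine lintegral_mono fun π => ?_
  simp only [hE]
  split_ifs
  · rw [← ENNReal.ofReal_natCast, ← ENNReal.ofReal_mul (Nat.cast_nonneg _), sq]
    exact ENNReal.ofReal_le_ofReal (by gcongr)
  · simp

theorem sum_refDisagreement : ∑ v, ENNReal.ofReal (refDisagreement G π v) =
    2 * (cost G (refClustering G π) : ℝ≥0∞) := by
  classical
  rw [← ENNReal.ofReal_sum_of_nonneg fun v _ => refDisagreement_nonneg v]
  have h : ∑ v, refDisagreement G π v = 2 * (cost G (refClustering G π) : ℝ) := by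
    unfold refDisagreement
    convert (two_mul_cost_eq_sum (G := G) (refClustering G π)).symm
  rw [h, ENNReal.ofReal_mul (by norm_num), ENNReal.ofReal_natCast]
  norm_num

/-! ### Functions of the order of the ranks -/

/-- Such a function factors through the finite Boolean matrix of rank comparisons, which is
measurable. -/
theorem measurable_of_order {β : Type} [MeasurableSpace β] [Inhabited β]
    (F : (Fin n → unitInterval) → β)
    (hF : ∀ π τ : Fin n → unitInterval, (∀ x y, π x ≤ π y ↔ τ x ≤ τ y) → F π = F τ) :
    Measurable F := by
  classical
  set g : (Fin n → unitInterval) → Fin n → Fin n → Bool := fun π x y => decide (π x ≤ π y) with hg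
  have hgm : Measurable g := by
    refine measurable_pi_iff.2 fun x => measurable_pi_iff.2 fun y => ?_
    refine measurable_to_bool ?_
    have : (fun π => g π x y) ⁻¹' {true} = {π : Fin n → unitInterval | π x ≤ π y} := by
      ext π; simp [hg]
    rw [this]
    exact measurableSet_le (measurable_pi_apply x) (measurable_pi_apply y)
  have hfac : Function.FactorsThrough F g := by
    intro π τ h
    refine hF π τ fun x y => ?_
    have := congrFun (congrFun h x) y
    simpa [hg] using this
  have : F = Function.extend g F (fun _ => default) ∘ g := by
    ext1 π
    exact (hfac.extend_apply _ π).symm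
  rw [this]
  exact (measurable_of_finite _).comp hgm

theorem isPiv_congr {π τ : Fin n → unitInterval} (h : ∀ x y, π x ≤ π y ↔ τ x ≤ τ y)
    (v u : Fin n) : IsPiv G π v u ↔ IsPiv G τ v u := by
  unfold IsPiv
  simp_rw [h]

theorem refClustering_congr {π τ : Fin n → unitInterval} (h : ∀ x y, π x ≤ π y ↔ τ x ≤ τ y) :
    refClustering G π = refClustering G τ := by
  have harg : ∀ S : Finset (Fin n), argminRank π S = argminRank τ S := fun S => by
    unfold argminRank
    simp_rw [h]
  have hr : ∀ u, refPivot G π u = refPivot G τ u := fun u => harg _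
  funext u
  unfold refClustering
  simp_rw [hr]

theorem measurable_cost_refClustering :
    Measurable fun π : Fin n → unitInterval => (cost G (refClustering G π) : ℝ≥0∞) :=
  measurable_of_order _ fun π τ h => by rw [refClustering_congr h]

open Classical in
theorem measurable_smallCluster (ε : ℝ) (v : Fin n) :
    Measurable fun π : Fin n → unitInterval => ENNReal.ofReal (if IsPiv G π v v ∧
      ((refCluster G π v).card : ℝ) < ε * fdeg G v then fdeg G v ^ 2 else 0) := by
  refine measurable_of_order _ fun π τ h => ?_
  have : refCluster G π v = refCluster G τ v := by
    ext u; rw [mem_refCluster, mem_refCluster]; unfold IsRef; rw [isPiv_congr h, isPiv_congr h]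
  simp only [this, isPiv_congr h]

end smallClusters


/-! ### The expected costs -/

section main
open MeasureTheory
variable {n : ℕ} {G : SimpleGraph (Fin n)} {ε L : ℝ} {s : ℕ}

theorem cost_le_sq {α : Type} (f : Fin n → α) : cost G f ≤ n ^ 2 := by
  classical
  unfold cost
  refine (Finset.card_le_univ _).trans ?_
  simp [sq]

theorem cost_eq_zero_iff {α : Type} {f : Fin n → α} :
    cost G f = 0 ↔ ∀ x y, x < y → (G.Adj x y ↔ f x = f y) := by
  classical
  unfold cost
  rw [Finset.card_eq_zero, Finset.filter_eq_empty_iff]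
  constructor
  · intro h x y hxy
    have := h (Finset.mem_univ (x, y))
    dsimp only at this
    tauto
  · rintro h ⟨x, y⟩ _ ⟨hxy, h'⟩
    have := h x y hxy
    tauto

theorem cost_eq_zero_of_le_one {α : Type} (hn : n ≤ 1) (f : Fin n → α) : cost G f = 0 := by
  refine cost_eq_zero_iff.2 fun x y h => ?_
  have := Fin.lt_def.1 h
  have := y.2
  omega

theorem isDisjointUnionOfCliques_of_cost_eq_zero {α : Type} {f : Fin n → α} (h : cost G f = 0) :
    IsDisjointUnionOfCliques G := by
  have hlt := cost_eq_zero_iff.1 h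
  have hne : ∀ x y, x ≠ y → (G.Adj x y ↔ f x = f y) := by
    intro x y hxy
    rcases lt_or_gt_of_ne hxy with h1 | h1
    · exact hlt x y h1
    · rw [G.adj_comm, eq_comm]; exact hlt y x h1
  intro x y z hxy hyz hxz
  rw [hne x z hxz, (hne x y hxy.ne).1 hxy, (hne y z hyz.ne).1 hyz]

theorem cost_refClustering_eq_zero (hG : IsDisjointUnionOfCliques G) {π : Fin n → unitInterval}
    (hπ : Function.Injective π) : cost G (refClustering G π) = 0 := by
  classical
  have hsub : ∀ u w x, G.Adj u w → (x = u ∨ G.Adj u x) → (x = w ∨ G.Adj w x) := by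
    rintro u w x huw (rfl | hx)
    · exact Or.inr huw.symm
    · by_cases h : x = w
      · exact Or.inl h
      · exact Or.inr (hG w u x huw.symm hx (Ne.symm h))
  have hpiv : ∀ u w v, G.Adj u w → IsPiv G π v u → IsPiv G π v w := by
    intro u w v huw h
    refine ⟨(hsub u w v huw (h.1.imp id id)), fun x hx => h.2 x (hsub w u x huw.symm hx)⟩
  have hself : ∀ u v, IsPiv G π v u → IsPiv G π v v := by
    intro u v h
    rcases h.1 with rfl | h1
    · exact h
    · exact hpiv u v v h1 h
  refine cost_eq_zero_iff.2 fun x y hlt => ⟨fun hadj => ?_, fun heq => ?_⟩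
  · obtain ⟨v, hv⟩ : ∃ v, IsPiv G π v x := by
      obtain ⟨v, hv, hmin⟩ := Finset.exists_min_image
        (Finset.univ.filter fun y => y = x ∨ G.Adj x y) π ⟨x, by simp⟩
      exact ⟨v, by simpa using hv, fun y hy => hmin y (by simpa using hy)⟩
    have h1 := (refClustering_eq_inl_iff hπ).2 ⟨hv, hself x v hv⟩
    have hvy := hpiv x y v hadj hv
    have h2 := (refClustering_eq_inl_iff hπ).2 ⟨hvy, hself y v hvy⟩
    exact h1.trans h2.symm
  · by_contra hadj
    cases hr : refClustering G π x with
    | inr w => exact hlt.ne ((refClustering_eq_inr hr).symm.trans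
        (refClustering_eq_inr (heq ▸ hr)))
    | inl v =>
      have h1 := ((refClustering_eq_inl_iff hπ).1 hr).1.1
      have h2 := ((refClustering_eq_inl_iff hπ).1 (heq ▸ hr)).1.1
      rcases h1 with rfl | h1
      · rcases h2 with rfl | h2
        · exact hlt.ne rfl
        · exact hadj h2.symm
      · rcases h2 with rfl | h2
        · exact hadj h1
        · exact hadj (hG x v y h1 h2.symm hlt.ne)

/-- The ranks for which the light nodes may be missing. -/
def badRanks (G : SimpleGraph (Fin n)) (ε T : ℝ) : Set (Fin n → unitInterval) :=
  (⋃ u, {π | ∃ v, IsPiv G π v u ∧ T / 2 < (π v : ℝ) * fdeg G u}) ∪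
  ⋃ u, ⋃ v, {π | v < u ∧ IsPiv G π v v ∧ 1 ≤ (laterIn G π v u).card ∧
      (laterIn G π v u).card ≤ 2 * (laterLow G ε π v u).card ∧
      (π v : ℝ) * (laterIn G π v u).card ≤ T / 2 ∧
      ∀ w ∈ laterLow G ε π v u, T < (π w : ℝ) * (laterIn G π v u).card}

theorem volume_badRanks_le {T : ℝ} (hT : 0 ≤ T) : volume (badRanks G ε T) ≤
    n * ENNReal.ofReal (Real.exp (-(T / 2))) + n * (n * ENNReal.ofReal (Real.exp (-(T / 4)))) := by
  unfold badRanks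
  refine (measure_union_le _ _).trans (add_le_add ?_ ?_)
  · refine (measure_iUnion_fintype_le _ _).trans
      ((Finset.sum_le_sum fun u _ => volume_heavy_le hT u).trans ?_)
    simp
  · refine (measure_iUnion_fintype_le _ _).trans ((Finset.sum_le_sum fun u _ =>
      (measure_iUnion_fintype_le _ _).trans (Finset.sum_le_sum (g := fun _ =>
        ENNReal.ofReal (Real.exp (-(T / 4)))) fun v _ => ?_)).trans ?_)
    · by_cases hvu : v < u
      · simp only [hvu, true_and]
        exact volume_miss_le hT hvu
      · simp [hvu]
    · simp

theorem le_of_not_mem_badRanks {T : ℝ} {π : Fin n → unitInterval} (hπ : π ∉ badRanks G ε T)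
    {u v : Fin n} (h : IsPiv G π v u) : (π v : ℝ) * fdeg G u ≤ T / 2 := by
  by_contra hcon
  exact hπ (Or.inl (Set.mem_iUnion.2 ⟨u, v, h, not_le.1 hcon⟩))

/-- The two kinds of bad event fit together: the later neighbours of `u` number at most its degree,
so excluding the heavy event gives the bound `T / 2` required in the miss event. -/
theorem hasLightNodes_of_not_mem_badRanks {π : Fin n → unitInterval}
    (hπ : π ∉ badRanks G ε (ε ^ 2 * L)) : HasLightNodes G ε L π := by
  classical
  intro u v hvu hr h1 h2
  by_contra hcon
  push Not at hcon
  refine hπ (Or.inr (Set.mem_iUnion.2 ⟨u, Set.mem_iUnion.2 ⟨v, hvu, hr.2, h1, h2, ?_, hcon⟩⟩))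
  refine le_trans ?_ (le_of_not_mem_badRanks hπ hr.1)
  have hcard : ((laterIn G π v u).card : ℝ) ≤ fdeg G u := by
    rw [card_laterIn]
    refine Finset.sum_le_sum fun w _ => ?_
    have := adjW_nonneg (G := G) u w
    split_ifs <;> linarith
  exact mul_le_mul_of_nonneg_left hcard (π v).2.1

open Classical in
/-- Charge for the pivots whose cluster is small compared to their degree. -/
noncomputable def smallClusterCharge (G : SimpleGraph (Fin n)) (ε : ℝ)
    (π : Fin n → unitInterval) : ℝ≥0∞ :=
  ∑ v, ENNReal.ofReal (if IsPiv G π v v ∧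
    ((refCluster G π v).card : ℝ) < ε * fdeg G v then fdeg G v ^ 2 else 0)

theorem measurable_smallClusterCharge (ε : ℝ) : Measurable (smallClusterCharge G ε) :=
  Finset.measurable_fun_sum _ fun v _ => measurable_smallCluster ε v

theorem lintegral_smallClusterCharge_le (hε' : ε ≤ 3 / 4) :
    ∫⁻ π, smallClusterCharge G ε π ≤ 8 * expectedCostReference G := by
  classical
  unfold smallClusterCharge
  rw [lintegral_finsetSum _ fun v _ => measurable_smallCluster ε v]
  refine (Finset.sum_le_sum fun v _ => lintegral_smallCluster_le hε' v).trans ?_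
  rw [← Finset.mul_sum]
  refine (mul_le_mul_right (sum_lintegral_le _ _) _).trans ?_
  simp_rw [sum_refDisagreement]
  rw [lintegral_const_mul' _ _ (by norm_num), ← mul_assoc]
  unfold expectedCostReference
  norm_num

theorem cost_comparator_le {π : Fin n → unitInterval} {p : Fin n → Option (Fin n)}
    (hπ : Function.Injective π) (hε : 0 < ε) (hε' : ε < 1 / 1000)
    (hf : IsFaithful G ε L π n p) (hH : HasLightNodes G ε L π) :
    (cost G (comparator G π p) : ℝ≥0∞) ≤
      ENNReal.ofReal (1 + 12 * ε) * (cost G (refClustering G π) : ℝ≥0∞) +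
      ENNReal.ofReal (5 / 2 * ε ^ 3) * smallClusterCharge G ε π := by
  classical
  have h := two_mul_cost_comparator_le hπ hε hε' hf hH
  unfold smallClusterCharge
  have h0 : ∀ v, 0 ≤ if IsPiv G π v v ∧ ((refCluster G π v).card : ℝ) < ε * fdeg G v
      then fdeg G v ^ 2 else 0 := fun v => by split_ifs <;> positivity
  rw [← ENNReal.ofReal_sum_of_nonneg fun v _ => h0 v, ← ENNReal.ofReal_natCast,
    ← ENNReal.ofReal_natCast, ← ENNReal.ofReal_mul (by positivity),
    ← ENNReal.ofReal_mul (by positivity), ← ENNReal.ofReal_add (by positivity)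
      (mul_nonneg (by positivity) (Finset.sum_nonneg fun v _ => h0 v))]
  apply ENNReal.ofReal_le_ofReal
  linarith

/-- The cost of the algorithm for typical ranks. -/
theorem ev_cost_sparsePivot_le_of_good {π : Fin n → unitInterval} (hn : 2 ≤ n)
    (hπ : Function.Injective π) (hε : 0 < ε) (hε' : ε < 1 / 1000) (hL : 0 ≤ L)
    (hgood : π ∉ badRanks G ε (ε ^ 2 * L)) :
    ev (sparsePivot G ε L s π) (fun σ => (cost G σ.clustering : ℝ≥0∞)) ≤
      ENNReal.ofReal (4 + 3000 * ε) *
        (ENNReal.ofReal (1 + 12 * ε) * (cost G (refClustering G π) : ℝ≥0∞) +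
        ENNReal.ofReal (5 / 2 * ε ^ 3) * smallClusterCharge G ε π +
        (n : ℝ≥0∞) ^ 2 * (n * ENNReal.ofReal (Real.exp (-(ε * s / 8))))) := by
  classical
  have hH := hasLightNodes_of_not_mem_badRanks hgood
  have hLv : ∀ v, IsPiv G π v v → (π v : ℝ) * fdeg G v ≤ L := fun v hv => by
    refine (le_of_not_mem_badRanks hgood hv).trans ?_
    have : ε ^ 2 ≤ 1 := by nlinarith
    nlinarith
  refine (ev_cost_sparsePivot_le hn hε hε').trans (mul_le_mul_right ?_ _)
  have hb := ev_pivotProcess_not_faithful (G := G) (L := L) (s := s) hπ hLv hε n le_rfl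
  set A := ENNReal.ofReal (1 + 12 * ε) * (cost G (refClustering G π) : ℝ≥0∞) +
        ENNReal.ofReal (5 / 2 * ε ^ 3) * smallClusterCharge G ε π
  refine (ev_mono (g := fun p => A + (n : ℝ≥0∞) ^ 2 *
    (if IsFaithful G ε L π n p then 0 else 1)) fun p => ?_).trans ?_
  · by_cases hf : IsFaithful G ε L π n p
    · rw [if_pos hf, mul_zero, add_zero]
      exact cost_comparator_le hπ hε hε' hf hH
    · rw [if_neg hf, mul_one]
      refine le_trans ?_ le_add_self
      exact_mod_cast cost_le_sq _
  · rw [ev_add, ev_const, ev_mul_left]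
    gcongr

/-- The expected cost of the algorithm up to a small additive error. -/
theorem expectedCostSparsePivot_le (hn : 2 ≤ n) (hε : 0 < ε) (hε' : ε < 1 / 1000) (hL : 0 ≤ L) :
    expectedCostSparsePivot G ε L s ≤
      ENNReal.ofReal (4 + 3000 * ε) * (ENNReal.ofReal (1 + 13 * ε) * expectedCostReference G) +
      (ENNReal.ofReal (4 + 3000 * ε) *
        ((n : ℝ≥0∞) ^ 2 * (n * ENNReal.ofReal (Real.exp (-(ε * s / 8))))) +
      (n : ℝ≥0∞) ^ 2 * (n * ENNReal.ofReal (Real.exp (-(ε ^ 2 * L / 2))) +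
        n * (n * ENNReal.ofReal (Real.exp (-(ε ^ 2 * L / 4)))))) := by
  classical
  set c := ENNReal.ofReal (4 + 3000 * ε) with hc
  set δ := (n : ℝ≥0∞) ^ 2 * (n * ENNReal.ofReal (Real.exp (-(ε * s / 8)))) with hδ
  set bad := badRanks G ε (ε ^ 2 * L) with hbad
  have hpt : ∀ᵐ π : Fin n → unitInterval,
      ev (sparsePivot G ε L s π) (fun σ => (cost G σ.clustering : ℝ≥0∞)) ≤
      (c * (ENNReal.ofReal (1 + 12 * ε) * (cost G (refClustering G π) : ℝ≥0∞) +
        ENNReal.ofReal (5 / 2 * ε ^ 3) * smallClusterCharge G ε π + δ)) +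
      bad.indicator (fun _ => (n : ℝ≥0∞) ^ 2) π := by
    filter_upwards [ae_injective] with π hπ
    by_cases hb : π ∈ bad
    · rw [Set.indicator_of_mem hb]
      refine le_trans ?_ le_add_self
      refine (ev_mono (g := fun _ => (n : ℝ≥0∞) ^ 2) fun σ => ?_).trans (ev_const _ _).le
      exact_mod_cast cost_le_sq _
    · rw [Set.indicator_of_notMem hb, add_zero]
      exact ev_cost_sparsePivot_le_of_good hn hπ hε hε' hL hb
  -- Measurability is needed only for the upper bound, in order to split its integral; the integrand
  -- of the algorithm enters through monotonicity alone.
  have hm1 : Measurable fun π : Fin n → unitInterval =>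
      ENNReal.ofReal (1 + 12 * ε) * (cost G (refClustering G π) : ℝ≥0∞) :=
    measurable_cost_refClustering.const_mul _
  have hm2 : Measurable fun π : Fin n → unitInterval =>
      ENNReal.ofReal (5 / 2 * ε ^ 3) * smallClusterCharge G ε π :=
    (measurable_smallClusterCharge ε).const_mul _
  have hm3 : Measurable fun π : Fin n → unitInterval =>
      ENNReal.ofReal (1 + 12 * ε) * (cost G (refClustering G π) : ℝ≥0∞) +
      ENNReal.ofReal (5 / 2 * ε ^ 3) * smallClusterCharge G ε π := hm1.add hm2
  have hm4 : Measurable fun π : Fin n → unitInterval =>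
      c * (ENNReal.ofReal (1 + 12 * ε) * (cost G (refClustering G π) : ℝ≥0∞) +
      ENNReal.ofReal (5 / 2 * ε ^ 3) * smallClusterCharge G ε π + δ) :=
    (hm3.add_const δ).const_mul c
  have hS := lintegral_smallClusterCharge_le (G := G) (ε := ε) (by linarith)
  calc expectedCostSparsePivot G ε L s
      ≤ _ := lintegral_mono_ae hpt
    _ = c * (ENNReal.ofReal (1 + 12 * ε) * expectedCostReference G +
          ENNReal.ofReal (5 / 2 * ε ^ 3) * (∫⁻ π, smallClusterCharge G ε π) + δ) +
        ∫⁻ π : Fin n → unitInterval, bad.indicator (fun _ => (n : ℝ≥0∞) ^ 2) π := by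
        rw [lintegral_add_left hm4,
          lintegral_const_mul' _ _ ENNReal.ofReal_ne_top,
          lintegral_add_left hm3, lintegral_add_left hm1,
          lintegral_const_mul' _ _ ENNReal.ofReal_ne_top,
          lintegral_const_mul' _ _ ENNReal.ofReal_ne_top, lintegral_const, measure_univ, mul_one]
        rfl
    _ ≤ c * (ENNReal.ofReal (1 + 13 * ε) * expectedCostReference G + δ) +
        (n : ℝ≥0∞) ^ 2 * (n * ENNReal.ofReal (Real.exp (-(ε ^ 2 * L / 2))) +
        n * (n * ENNReal.ofReal (Real.exp (-(ε ^ 2 * L / 4))))) := by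
        refine add_le_add (mul_le_mul_right (add_le_add_left ?_ _) _) ?_
        · refine (add_le_add_right (mul_le_mul_right hS _) _).trans ?_
          rw [← mul_assoc, show (8 : ℝ≥0∞) = ENNReal.ofReal 8 by norm_num,
            ← ENNReal.ofReal_mul (by positivity), ← add_mul,
            ← ENNReal.ofReal_add (by positivity) (by positivity)]
          refine mul_le_mul_left (ENNReal.ofReal_le_ofReal ?_) _
          have : ε ^ 3 ≤ ε * (1 / 1000) := by nlinarith [mul_pos hε hε]
          linarith
        · refine (lintegral_indicator_const_le _ _).trans (mul_le_mul_right ?_ _)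
          exact volume_badRanks_le (by positivity)
    _ = _ := by rw [mul_add]; ring

/-- The constant is chosen so that each exponential is at most `n^(-m)` with `m = c + 4 + 20 / ε`.
The 4 absorbs the polynomial factors, `c` remains, and `9 n^(-20/ε) ≤ ε` yields the factor `ε`. -/
theorem error_le {ε : ℝ} (hn : 2 ≤ n) (hε : 0 < ε) (hε' : ε < 1 / 1000) (c : ℕ) {L : ℝ} {s : ℕ}
    (hL : 8 * (c + 4 + 20 / ε) / ε ^ 2 * Real.log n ≤ L)
    (hs : 8 * (c + 4 + 20 / ε) / ε ^ 2 * Real.log n ≤ s) :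
    ENNReal.ofReal (4 + 3000 * ε) *
        ((n : ℝ≥0∞) ^ 2 * (n * ENNReal.ofReal (Real.exp (-(ε * s / 8))))) +
      (n : ℝ≥0∞) ^ 2 * (n * ENNReal.ofReal (Real.exp (-(ε ^ 2 * L / 2))) +
        n * (n * ENNReal.ofReal (Real.exp (-(ε ^ 2 * L / 4))))) ≤
      ENNReal.ofReal ε * ((n : ℝ≥0∞) ^ c)⁻¹ := by
  set m : ℝ := c + 4 + 20 / ε with hm
  set l := Real.log n with hl
  have hn' : (2 : ℝ) ≤ n := by exact_mod_cast hn
  have hl0 : 0.69 ≤ l := by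
    have h1 : Real.log 2 ≤ l := Real.log_le_log (by norm_num) hn'
    have h2 := Real.log_two_gt_d9
    linarith
  have hm0 : 0 ≤ m := by positivity
  have hml : 0 ≤ m * l := mul_nonneg hm0 (by linarith)
  have hL' : 8 * (m * l) ≤ ε ^ 2 * L := by
    have h1 := mul_le_mul_of_nonneg_left hL (by positivity : 0 ≤ ε ^ 2)
    calc 8 * (m * l) = ε ^ 2 * (8 * m / ε ^ 2 * l) := by field_simp
      _ ≤ _ := h1
  have hs' : 8 * (m * l) ≤ ε * s := by
    have h1 := mul_le_mul_of_nonneg_left hs hε.le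
    calc 8 * (m * l) ≤ 8 * (m * l) / ε := by
          rw [le_div_iff₀ hε]; nlinarith
      _ = ε * (8 * m / ε ^ 2 * l) := by field_simp
      _ ≤ _ := h1
  set e := Real.exp (-(m * l)) with he
  have he0 : 0 < e := Real.exp_pos _
  have e1 : Real.exp (-(ε * s / 8)) ≤ e := Real.exp_le_exp.2 (by linarith)
  have e2 : Real.exp (-(ε ^ 2 * L / 2)) ≤ e := Real.exp_le_exp.2 (by linarith)
  have e3 : Real.exp (-(ε ^ 2 * L / 4)) ≤ e := Real.exp_le_exp.2 (by linarith)
  have hreal : (4 + 3000 * ε) * ((n : ℝ) ^ 2 * (n * e)) + (n : ℝ) ^ 2 * (n * e + n * (n * e)) ≤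
      ε * ((n : ℝ) ^ c)⁻¹ := by
    have hexp : (n : ℝ) = Real.exp l := (Real.exp_log (by linarith)).symm
    have h1 : (n : ℝ) ^ 4 * e = ((n : ℝ) ^ c)⁻¹ * Real.exp (-(20 / ε * l)) := by
      rw [hexp, he, ← Real.exp_nat_mul, ← Real.exp_nat_mul, ← Real.exp_neg, ← Real.exp_add,
        ← Real.exp_add]
      congr 1; rw [hm]; push_cast; ring
    have h2 : 9 * Real.exp (-(20 / ε * l)) ≤ ε := by
      have h3 : 13.8 / ε ≤ 20 / ε * l := by
        rw [div_mul_eq_mul_div]; gcongr; linarith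
      have h4 := Real.add_one_le_exp (20 / ε * l)
      rw [Real.exp_neg, ← div_eq_mul_inv, div_le_iff₀ (Real.exp_pos _)]
      have h5 : 13.8 / ε ≤ Real.exp (20 / ε * l) := by linarith
      calc (9 : ℝ) ≤ ε * (13.8 / ε) := by rw [mul_div_cancel₀ _ hε.ne']; norm_num
        _ ≤ _ := by gcongr
    have h3 : (n : ℝ) ^ 3 * e ≤ (n : ℝ) ^ 4 * e := by
      gcongr
      · linarith
      · norm_num
    have h4 : 0 ≤ (n : ℝ) ^ 3 * e := by positivity
    have h5 : 3000 * ε * ((n : ℝ) ^ 3 * e) ≤ 3 * ((n : ℝ) ^ 3 * e) := by gcongr; linarith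
    calc _ ≤ 9 * ((n : ℝ) ^ 4 * e) := by nlinarith
      _ = ((n : ℝ) ^ c)⁻¹ * (9 * Real.exp (-(20 / ε * l))) := by rw [h1]; ring
      _ ≤ ((n : ℝ) ^ c)⁻¹ * ε := by gcongr
      _ = _ := mul_comm _ _
  have hcast : (n : ℝ≥0∞) = ENNReal.ofReal n := (ENNReal.ofReal_natCast n).symm
  have hn0 : (0 : ℝ) < n := by linarith
  calc _ ≤ ENNReal.ofReal (4 + 3000 * ε) * ((n : ℝ≥0∞) ^ 2 * (n * ENNReal.ofReal e)) +
      (n : ℝ≥0∞) ^ 2 * (n * ENNReal.ofReal e + n * (n * ENNReal.ofReal e)) := by gcongr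
    _ = ENNReal.ofReal ((4 + 3000 * ε) * ((n : ℝ) ^ 2 * (n * e)) +
          (n : ℝ) ^ 2 * (n * e + n * (n * e))) := by
        have hq : 0 ≤ 4 + 3000 * ε := by positivity
        generalize 4 + 3000 * ε = q at hq
        rw [ENNReal.ofReal_add (by positivity) (by positivity), ENNReal.ofReal_mul hq,
          ENNReal.ofReal_mul (by positivity), ENNReal.ofReal_mul (by positivity),
          ENNReal.ofReal_mul (p := (n : ℝ) ^ 2) (by positivity),
          ENNReal.ofReal_add (by positivity) (by positivity), ENNReal.ofReal_mul (by positivity),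
          ENNReal.ofReal_mul (by positivity), ENNReal.ofReal_mul (by positivity),
          ENNReal.ofReal_pow (by positivity), hcast]
    _ ≤ ENNReal.ofReal (ε * ((n : ℝ) ^ c)⁻¹) := ENNReal.ofReal_le_ofReal hreal
    _ = _ := by
        rw [ENNReal.ofReal_mul hε.le, ENNReal.ofReal_inv_of_pos (by positivity),
          ENNReal.ofReal_pow hn0.le, hcast]

/-- A clustering of cost 0 exhibits `G` as a disjoint union of cliques, so here the cost is a
positive integer for every choice of ranks. -/
theorem one_le_expectedCostReference (hG : ¬ IsDisjointUnionOfCliques G) :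
    1 ≤ expectedCostReference G := by
  unfold expectedCostReference
  calc (1 : ℝ≥0∞) = ∫⁻ _ : Fin n → unitInterval, 1 := by simp
    _ ≤ _ := by
      refine lintegral_mono fun π => ?_
      have : 1 ≤ cost G (refClustering G π) := Nat.one_le_iff_ne_zero.2 fun h =>
        hG (isDisjointUnionOfCliques_of_cost_eq_zero h)
      change (1 : ℝ≥0∞) ≤ _
      exact_mod_cast this

theorem expectedCostReference_eq_zero (hG : IsDisjointUnionOfCliques G) :
    expectedCostReference G = 0 := by
  unfold expectedCostReference
  refine lintegral_eq_zero_of_ae_eq_zero ?_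
  filter_upwards [ae_injective] with π hπ
  simp [cost_refClustering_eq_zero hG hπ]

theorem expectedCostSparsePivot_eq_zero (hn : n ≤ 1) : expectedCostSparsePivot G ε L s = 0 := by
  unfold expectedCostSparsePivot
  simp [cost_eq_zero_of_le_one hn]

end main

end CorrelationClustering

theorem theorem1 :
    ∃ K : ℝ, 0 < K ∧ ∀ ε : ℝ, 0 < ε → ε < 1 / 1000 → ∀ c : ℕ, ∃ A : ℝ, 0 < A ∧
      ∀ (n : ℕ) (G : SimpleGraph (Fin n)) (L : ℝ) (s : ℕ),
        A * Real.log n ≤ L → A * Real.log n ≤ s →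
        (¬ CorrelationClustering.IsDisjointUnionOfCliques G →
          CorrelationClustering.expectedCostSparsePivot G ε L s ≤
            ENNReal.ofReal (4 * (1 + K * ε)) *
              CorrelationClustering.expectedCostReference G) ∧
        (CorrelationClustering.IsDisjointUnionOfCliques G →
          CorrelationClustering.expectedCostReference G = 0 ∧
          CorrelationClustering.expectedCostSparsePivot G ε L s ≤
            ((n : ENNReal) ^ c)⁻¹) := by
  open CorrelationClustering in
  -- `K = 1000` leaves room for `(4 + 3000ε)(1 + 13ε) + ε ≤ 4 + 4000ε`. The value of `A` is the one
  -- required by `error_le`.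
  refine ⟨1000, by norm_num, fun ε hε hε' c =>
    ⟨8 * (c + 4 + 20 / ε) / ε ^ 2, by positivity, fun n G L s hL hs => ?_⟩⟩
  -- For `n ≤ 1` there are no pairs and every cost is 0; the estimates above need `log n > 0`.
  rcases Nat.lt_or_ge n 2 with hn | hn
  · rw [expectedCostSparsePivot_eq_zero (by omega)]
    exact ⟨fun _ => zero_le, fun hG => ⟨expectedCostReference_eq_zero hG, zero_le⟩⟩
  have hL0 : 0 ≤ L := by
    refine le_trans (mul_nonneg (by positivity) (Real.log_nonneg ?_)) hL
    exact_mod_cast (by omega : 1 ≤ n)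
  have hmain := (expectedCostSparsePivot_le (G := G) (s := s) hn hε hε' hL0).trans
    (add_le_add_right (error_le hn hε hε' c hL hs) _)
  -- So the additive error is at most `ε`, hence at most `ε` times the reference cost when that is
  -- at least 1.
  have hinv : ((n : ENNReal) ^ c)⁻¹ ≤ 1 :=
    ENNReal.inv_le_one.2 (one_le_pow₀ (by exact_mod_cast (by omega : 1 ≤ n)))
  refine ⟨fun hG => hmain.trans ?_, fun hG => ?_⟩
  · rw [← mul_assoc, ← ENNReal.ofReal_mul (by positivity)]
    calc _ ≤ ENNReal.ofReal ((4 + 3000 * ε) * (1 + 13 * ε)) * expectedCostReference G +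
          ENNReal.ofReal ε * expectedCostReference G := by
          gcongr
          exact hinv.trans (one_le_expectedCostReference hG)
      _ = ENNReal.ofReal ((4 + 3000 * ε) * (1 + 13 * ε) + ε) * expectedCostReference G := by
          rw [← add_mul, ← ENNReal.ofReal_add (by positivity) hε.le]
      _ ≤ _ := by
          gcongr
          nlinarith
  · have h0 := expectedCostReference_eq_zero hG
    refine ⟨h0, hmain.trans ?_⟩
    rw [h0, mul_zero, mul_zero, zero_add]
    exact mul_le_of_le_one_left' (by rw [ENNReal.ofReal_le_one]; linarith)
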